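/- Let $k$ be a field with $\operatorname{char} k\notin\{2,3\}$, let $q\in k^\times$ be not a root of unity, let $n$ be a natural number and $I=\{1,\dots,n\}$. For a vector space $V$ with basis $x_1,\dots,x_n$ and a matrix $\mathbf q=(q_{ij})_{i,j\in I}$ of non-zero scalars, consider the braiding $c(x_i\otimes x_j)=q_{ij}\,x_j\otimes x_i$ of diagonal type. The tensor algebra $T(V)$ is a braided bialgebra whose coproduct $\Delta$ is the algebra map to the braided tensor product $T(V)\otimes T(V)$ with $\Delta(x_i)=x_i\otimes 1+1\otimes x_i$, and the Nichols algebra is $\mathcal B(V)=T(V)/\mathcal I$, where $\mathcal I$ is the sum of all homogeneous two-sided ideals $J\subseteq\bigoplus_{m\ge 2}V^{\otimes m}$ of $T(V)$ with $\Delta(J)\subseteq J\otimes T(V)+T(V)\otimes J$. We write $\mathcal B(V)=T(V)$ if the projection $T(V)\to\mathcal B(V)$ is bijective. Let $e_1,\dots,e_n$ be the standard basis vectors, $|m|=\sum_i m_i$ for $m\in\mathbb N_0^n$, and $(r)_t=1+t+\dots+t^{r-1}$. For $|m|\ge 2$ define $P_m\in\mathbb Z[p_{ij}\mid i,j\in I]$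 as follows, where $i\neq j$ and $s_{ij}=p_{ij}p_{ji}$: - $P_{r e_i}=(r)_{p_{ii}}$ for $r\ge2$; - $P_{e_i+re_j}=1-p_{jj}^{r-1}s_{ij}$ for $r\ge1$; - $P_{2e_i+re_j}=1+p_{jj}^{r(r-1)/2}(-s_{ij})^{r}p_{ii}$ for $r\ge1$; - $P_{3e_i+3e_j}=(3)_{p_{ii}^2s_{ij}^3p_{jj}^2}$; - $P_{3e_i+4e_j}=(1-p_{ii}^2s_{ij}^4p_{jj}^4)\,(3)_{p_{ii}s_{ij}^2p_{jj}^2}$; - $P_{3e_i+6e_j}=(1-p_{ii}s_{ij}^3p_{jj}^5)\,(3)_{p_{ii}^2s_{ij}^6p_{jj}^{10}}$; - $P_{4e_i+4e_j}=(1+p_{ii}^3s_{ij}^4p_{jj}^3)(1+p_{ii}^6s_{ij}^8p_{jj}^6)$; - $P_m=1-\prod_{i}p_{ii}^{m_i(m_i-1)}\prod_{i<j}s_{ij}^{m_im_j}$ for all other $m$. (1) Let $(a_{ij})\in\mathbb Z^{n\times n}$ and $q_{ij}=q^{a_{ij}}$. Put $K(m)=\sum_{i,j}a_{ij}m_im_j$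 and $\lambda(m)=\sum_i a_{ii}m_i$ for $m\in\mathbb N_0^n$. Call the following degrees exceptional: $re_i$ with $r\ge2$ and ($a_{ii}\ne0$ or $r\neq 0$ in $k$); $2e_i+2re_j$ with $r\ge1$, $i\ne j$; $3e_i+3e_j$ and $4e_i+4e_j$ with $i\ne j$. (The condition "$a_{ii}\ne0$ or $r\ne0$ in $k$" is automatic if $\operatorname{char}k=0$ or if all $a_{ii}\neq0$.) Then $P_m(\mathbf q)\ne0$ for every exceptional $m$, and for every other $m\in\mathbb N_0^n$ with $|m|\ge2$ we have $P_m(\mathbf q)=0$ if and only if $K(m)=\lambda(m)$. Moreover, $\mathcal B(V)=T(V)$ if and only if the equation $K(m)=\lambda(m)$ has no solution $m\in\mathbb N_0^n$ with $|m|\ge2$ that is not exceptional. (2) Let $n=2$, let $a>b>0$ be integers, and let $q_{11}=q_{22}=q^a$ and $q_{12},q_{21}\in q^{\mathbb Z}$ with $q_{12}q_{21}=q^{-b}$. Then $\mathcal B(V)=T(V)$. -/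

import Mathlib

open scoped TensorProduct

/-! ### The Nichols algebra of a braided vector space of diagonal type

`V` is a vector space with basis `x_1, …, x_n` and braiding `c (x_i ⊗ x_j) = q_{ij} x_j ⊗ x_i`. -/

namespace DiagonalNichols

section Nichols

variable {k : Type*} [Field k] {n : ℕ} {V : Type*} [AddCommGroup V] [Module k V]

/-- The braiding `c` of diagonal type with braiding matrix `Q` with respect to the basis `x`,
`c (x_i ⊗ x_j) = q_{ij} x_j ⊗ x_i`. -/
noncomputable def braiding (x : Module.Basis (Fin n) k V) (Q : Matrix (Fin n) (Fin n) k) :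
    V ⊗[k] V →ₗ[k] V ⊗[k] V :=
  (x.tensorProduct x).constr k fun p => Q p.1 p.2 • (x p.2 ⊗ₜ[k] x p.1)

/-- The algebra endomorphism `g_i` of `T(V)` with `g_i (x_j) = q_{ij} x_j`. The braiding of `V`
extends to `T(V)` by `c (x_i ⊗ u) = g_i (u) ⊗ x_i`. -/
noncomputable def scaling (x : Module.Basis (Fin n) k V) (Q : Matrix (Fin n) (Fin n) k)
    (i : Fin n) : TensorAlgebra k V →ₐ[k] TensorAlgebra k V :=
  TensorAlgebra.lift k
    (x.constr k fun j => Q i j • TensorAlgebra.ι k (x j) : V →ₗ[k] TensorAlgebra k V)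

/-- Left multiplication by `x_i ⊗ 1 + 1 ⊗ x_i` in the braided tensor product algebra
`T(V) ⊗ T(V)`, whose product is `(a ⊗ b)(c' ⊗ d) = a c(b ⊗ c') d`; explicitly
`u ⊗ v ↦ x_i u ⊗ v + g_i (u) ⊗ x_i v`. -/
noncomputable def mulPrimitive (x : Module.Basis (Fin n) k V) (Q : Matrix (Fin n) (Fin n) k)
    (i : Fin n) : Module.End k (TensorAlgebra k V ⊗[k] TensorAlgebra k V) :=
  TensorProduct.map (LinearMap.mulLeft k (TensorAlgebra.ι k (x i))) LinearMap.id +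
    TensorProduct.map (scaling x Q i).toLinearMap
      (LinearMap.mulLeft k (TensorAlgebra.ι k (x i)))

/-- The coproduct of the braided bialgebra `T(V)`: the unique algebra map from `T(V)` to the
braided tensor product `T(V) ⊗ T(V)` with `x_i ↦ x_i ⊗ 1 + 1 ⊗ x_i` for all `i`. On a product
`x_{i_1} ⋯ x_{i_m}` it is computed by applying to `1 ⊗ 1` the left multiplications by
`x_{i_m} ⊗ 1 + 1 ⊗ x_{i_m}`, …, `x_{i_1} ⊗ 1 + 1 ⊗ x_{i_1}`. -/
noncomputable def coproduct (x : Module.Basis (Fin n) k V) (Q : Matrix (Fin n) (Fin n) k) :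
    TensorAlgebra k V →ₗ[k] TensorAlgebra k V ⊗[k] TensorAlgebra k V :=
  LinearMap.applyₗ (1 ⊗ₜ[k] 1) ∘ₗ
    (TensorAlgebra.lift k (x.constr k (mulPrimitive x Q))).toLinearMap

/-- The braiding, on basis vectors. -/
theorem braiding_basis (x : Module.Basis (Fin n) k V) (Q : Matrix (Fin n) (Fin n) k)
    (i j : Fin n) : braiding x Q (x i ⊗ₜ[k] x j) = Q i j • (x j ⊗ₜ[k] x i) := by
  have h := (x.tensorProduct x).constr_basis k
    (fun p => Q p.1 p.2 • (x p.2 ⊗ₜ[k] x p.1)) (i, j)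
  rw [Module.Basis.tensorProduct_apply] at h
  exact h

/-- On `V ⊗ V` the extended braiding `u ↦ g_i (u) ⊗ x_i` is the braiding of `V`. -/
theorem scaling_braiding (x : Module.Basis (Fin n) k V) (Q : Matrix (Fin n) (Fin n) k)
    (i : Fin n) (v : V) :
    scaling x Q i (TensorAlgebra.ι k v) ⊗ₜ[k] TensorAlgebra.ι k (x i) =
      TensorProduct.map (TensorAlgebra.ι k) (TensorAlgebra.ι k) (braiding x Q (x i ⊗ₜ[k] v)) := by
  have h : ∀ v : V,
      (((TensorProduct.mk k _ _).flip (TensorAlgebra.ι k (x i))) ∘ₗ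
        (scaling x Q i).toLinearMap ∘ₗ TensorAlgebra.ι k) v =
      (TensorProduct.map (TensorAlgebra.ι k) (TensorAlgebra.ι k) ∘ₗ braiding x Q ∘ₗ
        TensorProduct.mk k V V (x i)) v := by
    intro v
    congr 1
    apply x.ext
    intro j
    simp [scaling, braiding_basis, TensorProduct.smul_tmul']
  exact h v

/-- `Δ(1) = 1 ⊗ 1`. -/
theorem coproduct_one (x : Module.Basis (Fin n) k V) (Q : Matrix (Fin n) (Fin n) k) :
    coproduct x Q 1 = 1 ⊗ₜ[k] 1 := by
  simp [coproduct]

/-- `Δ(x_i w) = (x_i ⊗ 1 + 1 ⊗ x_i) Δ(w)`. -/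
theorem coproduct_mul (x : Module.Basis (Fin n) k V) (Q : Matrix (Fin n) (Fin n) k)
    (i : Fin n) (w : TensorAlgebra k V) :
    coproduct x Q (TensorAlgebra.ι k (x i) * w) = mulPrimitive x Q i (coproduct x Q w) := by
  simp [coproduct]

/-- The graded components `V^{⊗ m}` of `T(V)`. -/
abbrev tensorPower (k V : Type*) [Field k] [AddCommGroup V] [Module k V] (m : ℕ) :
    Submodule k (TensorAlgebra k V) :=
  LinearMap.range (TensorAlgebra.ι k : V →ₗ[k] TensorAlgebra k V) ^ m

/-- A two-sided ideal of `T(V)`, as a subspace. -/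
def idealSubmodule (I : TwoSidedIdeal (TensorAlgebra k V)) : Submodule k (TensorAlgebra k V) :=
  (TwoSidedIdeal.asIdeal I).restrictScalars k

/-- The two-sided ideals `I` of `T(V)` which are homogeneous, are contained in
`⨁_{m ≥ 2} V^{⊗ m}`, and are coideals: `Δ(I) ⊆ I ⊗ T(V) + T(V) ⊗ I`. -/
structure IsHomogeneousBiideal (x : Module.Basis (Fin n) k V) (Q : Matrix (Fin n) (Fin n) k)
    (I : TwoSidedIdeal (TensorAlgebra k V)) : Prop where
  homogeneous : ∀ r ∈ I, ∀ m : ℕ, GradedAlgebra.proj (tensorPower k V) m r ∈ I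
  degree_ge_two : ∀ r ∈ I, ∀ m < 2, GradedAlgebra.proj (tensorPower k V) m r = 0
  coideal : ∀ r ∈ I, coproduct x Q r ∈
    LinearMap.range (TensorProduct.map (idealSubmodule I).subtype
      (LinearMap.id : TensorAlgebra k V →ₗ[k] TensorAlgebra k V)) ⊔
    LinearMap.range (TensorProduct.map
      (LinearMap.id : TensorAlgebra k V →ₗ[k] TensorAlgebra k V) (idealSubmodule I).subtype)

/-- The defining ideal of the Nichols algebra: the sum of all homogeneous two-sided ideals of
`T(V)` in degrees at least two which are coideals. -/
noncomputable def nicholsIdeal (x : Module.Basis (Fin n) k V) (Q : Matrix (Fin n) (Fin n) k) :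
    TwoSidedIdeal (TensorAlgebra k V) :=
  sSup {I | IsHomogeneousBiideal x Q I}

/-- The Nichols algebra `B(V)` of the braided vector space of diagonal type with basis `x` and
braiding matrix `Q`, as a quotient of the tensor algebra `T(V)`. -/
abbrev NicholsAlgebra (x : Module.Basis (Fin n) k V) (Q : Matrix (Fin n) (Fin n) k) : Type _ :=
  (nicholsIdeal x Q).ringCon.Quotient

/-- The canonical projection `T(V) → B(V)`. -/
noncomputable def nicholsProj (x : Module.Basis (Fin n) k V) (Q : Matrix (Fin n) (Fin n) k) :
    TensorAlgebra k V →+* NicholsAlgebra x Q :=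
  (nicholsIdeal x Q).ringCon.mk'

/-- `B(V) = T(V)`: the canonical projection `T(V) → B(V)` is bijective. -/
def NicholsIsFree (x : Module.Basis (Fin n) k V) (Q : Matrix (Fin n) (Fin n) k) : Prop :=
  Function.Bijective (nicholsProj x Q)

end Nichols

/-! ### The polynomials `P_m` -/

section Polynomials

variable {n : ℕ}

/-- `(m)_t = 1 + t + ⋯ + t^{m-1}`. -/
def qNumber {R : Type*} [CommRing R] (m : ℕ) (t : R) : R :=
  ∑ s ∈ Finset.range m, t ^ s

/-- The total degree `|m| = m_1 + ⋯ + m_n`. -/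
def totalDegree (m : Fin n → ℕ) : ℕ := ∑ i, m i

/-- The indeterminate `p_{ij}`. -/
noncomputable def p (i j : Fin n) : MvPolynomial (Fin n × Fin n) ℤ := MvPolynomial.X (i, j)

/-- `m = c e_i + d e_j` with `i ≠ j` and `c, d > 0`, where `ij = (i, j)`. -/
def IsPair (m : Fin n → ℕ) (ij : Fin n × Fin n) (c d : ℕ) : Prop :=
  ij.1 ≠ ij.2 ∧ 0 < c ∧ 0 < d ∧ m = Pi.single ij.1 c + Pi.single ij.2 d

open Classical in
/-- The polynomials `P_m ∈ ℤ[p_{ij}]`, to be used for `|m| ≥ 2`. In the cases in which `m` is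
supported on two indices, `i` is the index of the coefficient that is written first; when the
indices can be exchanged the polynomial does not depend on the choice. -/
noncomputable def P (m : Fin n → ℕ) : MvPolynomial (Fin n × Fin n) ℤ :=
  if h : ∃ i, m = Pi.single i (m i) then
    qNumber (m h.choose) (p h.choose h.choose)
  else if h : ∃ ij : Fin n × Fin n, IsPair m ij 1 (m ij.2) then
    let i := h.choose.1
    let j := h.choose.2
    1 - p j j ^ (m j - 1) * (p i j * p j i)
  else if h : ∃ ij : Fin n × Fin n, IsPair m ij 2 (m ij.2) then
    let i := h.choose.1
    let j := h.choose.2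
    1 + p j j ^ (m j * (m j - 1) / 2) * (-(p i j * p j i)) ^ m j * p i i
  else if h : ∃ ij : Fin n × Fin n, IsPair m ij 3 3 then
    let i := h.choose.1
    let j := h.choose.2
    qNumber 3 (p i i ^ 2 * (p i j * p j i) ^ 3 * p j j ^ 2)
  else if h : ∃ ij : Fin n × Fin n, IsPair m ij 3 4 then
    let i := h.choose.1
    let j := h.choose.2
    (1 - p i i ^ 2 * (p i j * p j i) ^ 4 * p j j ^ 4) *
      qNumber 3 (p i i * (p i j * p j i) ^ 2 * p j j ^ 2)
  else if h : ∃ ij : Fin n × Fin n, IsPair m ij 3 6 then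
    let i := h.choose.1
    let j := h.choose.2
    (1 - p i i * (p i j * p j i) ^ 3 * p j j ^ 5) *
      qNumber 3 (p i i ^ 2 * (p i j * p j i) ^ 6 * p j j ^ 10)
  else if h : ∃ ij : Fin n × Fin n, IsPair m ij 4 4 then
    let i := h.choose.1
    let j := h.choose.2
    (1 + p i i ^ 3 * (p i j * p j i) ^ 4 * p j j ^ 3) *
      (1 + p i i ^ 6 * (p i j * p j i) ^ 8 * p j j ^ 6)
  else
    1 - (∏ i, p i i ^ (m i * (m i - 1))) *
      ∏ i, ∏ j ∈ Finset.Ioi i, (p i j * p j i) ^ (m i * m j)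

/-- The value `P_m(Q)` of `P_m` at a matrix `Q`. -/
noncomputable def evalP {k : Type*} [Field k] (Q : Matrix (Fin n) (Fin n) k) (m : Fin n → ℕ) : k :=
  MvPolynomial.aeval (fun ij : Fin n × Fin n => Q ij.1 ij.2) (P m)

theorem IsPair.unique {m : Fin n → ℕ} {i j : Fin n} {ij : Fin n × Fin n} {c d c' d' : ℕ}
    (h : IsPair m (i, j) c d) (h' : IsPair m ij c' d') :
    (ij = (i, j) ∧ c = c' ∧ d = d') ∨ (ij = (j, i) ∧ c = d' ∧ d = c') := by
  obtain ⟨i', j'⟩ := ij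
  obtain ⟨hij, hc, hd, hm⟩ := h
  obtain ⟨hij', hc', hd', hm'⟩ := h'
  simp only at hij hij' hm hm'
  rw [hm] at hm'
  have e := fun t => congrFun hm' t
  simp only [Pi.add_apply, Pi.single_apply] at e
  have e1 := e i
  have e2 := e j
  have e3 := e i'
  have e4 := e j'
  grind

theorem IsPair.not_single {m : Fin n → ℕ} {i j : Fin n} {c d : ℕ} (h : IsPair m (i, j) c d) :
    ¬ ∃ l, m = Pi.single l (m l) := by
  rintro ⟨l, hl⟩
  obtain ⟨hij, hc, hd, hm⟩ := h
  simp only at hij hm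
  have e := fun t => (congrFun hm t).symm.trans (congrFun hl t)
  simp only [Pi.add_apply, Pi.single_apply] at e
  have e1 := e i
  have e2 := e j
  grind

theorem IsPair.snd {m : Fin n → ℕ} {ij : Fin n × Fin n} {c d : ℕ} (h : IsPair m ij c d) :
    m ij.2 = d := by
  obtain ⟨hij, hc, hd, rfl⟩ := h
  simp [hij]

theorem IsPair.symm {m : Fin n → ℕ} {i j : Fin n} {c d : ℕ} (h : IsPair m (i, j) c d) :
    IsPair m (j, i) d c :=
  ⟨h.1.symm, h.2.2.1, h.2.1, by rw [h.2.2.2]; exact add_comm _ _⟩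

theorem P_single (i : Fin n) {c : ℕ} (hc : 0 < c) : P (Pi.single i c) = qNumber c (p i i) := by
  have h : ∃ l, (Pi.single i c : Fin n → ℕ) = Pi.single l ((Pi.single i c : Fin n → ℕ) l) :=
    ⟨i, by simp⟩
  have hl : h.choose = i := by
    have e := congrFun h.choose_spec i
    by_contra hne
    rw [Pi.single_eq_same, Pi.single_eq_of_ne (Ne.symm hne)] at e
    omega
  rw [P, dif_pos h, hl, Pi.single_eq_same]

theorem P_one {m : Fin n → ℕ} {i j : Fin n} {d : ℕ} (h : IsPair m (i, j) 1 d) :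
    P m = 1 - p j j ^ (d - 1) * (p i j * p j i) := by
  have h2 : ∃ ij : Fin n × Fin n, IsPair m ij 1 (m ij.2) := ⟨(i, j), by rw [h.snd]; exact h⟩
  rw [P, dif_neg h.not_single, dif_pos h2]
  rcases h.unique (h2.choose_spec) with ⟨e, -, -⟩ | ⟨e, e3, e4⟩
  · simp only [e, h.snd]
  · simp only [e, h.symm.snd] at e4 ⊢
    subst e4
    simp [mul_comm]

theorem P_two {m : Fin n → ℕ} {i j : Fin n} {d : ℕ} (h : IsPair m (i, j) 2 d) :
    P m = 1 + p j j ^ (d * (d - 1) / 2) * (-(p i j * p j i)) ^ d * p i i := by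
  by_cases hd : d = 1
  · subst hd
    rw [P_one h.symm]
    simp
    ring
  have h1 : ¬ ∃ ij : Fin n × Fin n, IsPair m ij 1 (m ij.2) := by
    rintro ⟨⟨a, b⟩, hab⟩
    have := h.unique hab
    grind
  have h2 : ∃ ij : Fin n × Fin n, IsPair m ij 2 (m ij.2) := ⟨(i, j), by rw [h.snd]; exact h⟩
  rw [P, dif_neg h.not_single, dif_neg h1, dif_pos h2]
  rcases h.unique (h2.choose_spec) with ⟨e, -, -⟩ | ⟨e, e3, e4⟩
  · simp only [e, h.snd]
  · simp only [e, h.symm.snd] at e4 ⊢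
    subst e4
    norm_num
    ring

theorem P_three_three {m : Fin n → ℕ} {i j : Fin n} (h : IsPair m (i, j) 3 3) :
    P m = qNumber 3 (p i i ^ 2 * (p i j * p j i) ^ 3 * p j j ^ 2) := by
  have h1 : ¬ ∃ ij : Fin n × Fin n, IsPair m ij 1 (m ij.2) := by
    rintro ⟨⟨a, b⟩, hab⟩
    have := h.unique hab
    grind
  have h2 : ¬ ∃ ij : Fin n × Fin n, IsPair m ij 2 (m ij.2) := by
    rintro ⟨⟨a, b⟩, hab⟩
    have := h.unique hab
    grind
  have h3 : ∃ ij : Fin n × Fin n, IsPair m ij 3 3 := ⟨(i, j), h⟩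
  rw [P, dif_neg h.not_single, dif_neg h1, dif_neg h2, dif_pos h3]
  rcases h.unique (h3.choose_spec) with ⟨e, -, -⟩ | ⟨e, e3, e4⟩
  · simp only [e]
  · simp only [e]
    congr 1
    ring

theorem P_three_four {m : Fin n → ℕ} {i j : Fin n} (h : IsPair m (i, j) 3 4) :
    P m = (1 - p i i ^ 2 * (p i j * p j i) ^ 4 * p j j ^ 4) *
      qNumber 3 (p i i * (p i j * p j i) ^ 2 * p j j ^ 2) := by
  have h1 : ¬ ∃ ij : Fin n × Fin n, IsPair m ij 1 (m ij.2) := by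
    rintro ⟨⟨a, b⟩, hab⟩
    have := h.unique hab
    grind
  have h2 : ¬ ∃ ij : Fin n × Fin n, IsPair m ij 2 (m ij.2) := by
    rintro ⟨⟨a, b⟩, hab⟩
    have := h.unique hab
    grind
  have h3 : ¬ ∃ ij : Fin n × Fin n, IsPair m ij 3 3 := by
    rintro ⟨⟨a, b⟩, hab⟩
    have := h.unique hab
    grind
  have h4 : ∃ ij : Fin n × Fin n, IsPair m ij 3 4 := ⟨(i, j), h⟩
  rw [P, dif_neg h.not_single, dif_neg h1, dif_neg h2, dif_neg h3, dif_pos h4]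
  rcases h.unique (h4.choose_spec) with ⟨e, -, -⟩ | ⟨e, e3, e4⟩
  · simp only [e]
  · omega

theorem P_three_six {m : Fin n → ℕ} {i j : Fin n} (h : IsPair m (i, j) 3 6) :
    P m = (1 - p i i * (p i j * p j i) ^ 3 * p j j ^ 5) *
      qNumber 3 (p i i ^ 2 * (p i j * p j i) ^ 6 * p j j ^ 10) := by
  have h1 : ¬ ∃ ij : Fin n × Fin n, IsPair m ij 1 (m ij.2) := by
    rintro ⟨⟨a, b⟩, hab⟩
    have := h.unique hab
    grind
  have h2 : ¬ ∃ ij : Fin n × Fin n, IsPair m ij 2 (m ij.2) := by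
    rintro ⟨⟨a, b⟩, hab⟩
    have := h.unique hab
    grind
  have h3 : ¬ ∃ ij : Fin n × Fin n, IsPair m ij 3 3 := by
    rintro ⟨⟨a, b⟩, hab⟩
    have := h.unique hab
    grind
  have h4 : ¬ ∃ ij : Fin n × Fin n, IsPair m ij 3 4 := by
    rintro ⟨⟨a, b⟩, hab⟩
    have := h.unique hab
    grind
  have h5 : ∃ ij : Fin n × Fin n, IsPair m ij 3 6 := ⟨(i, j), h⟩
  rw [P, dif_neg h.not_single, dif_neg h1, dif_neg h2, dif_neg h3, dif_neg h4, dif_pos h5]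
  rcases h.unique (h5.choose_spec) with ⟨e, -, -⟩ | ⟨e, e3, e4⟩
  · simp only [e]
  · omega

theorem P_four_four {m : Fin n → ℕ} {i j : Fin n} (h : IsPair m (i, j) 4 4) :
    P m = (1 + p i i ^ 3 * (p i j * p j i) ^ 4 * p j j ^ 3) *
      (1 + p i i ^ 6 * (p i j * p j i) ^ 8 * p j j ^ 6) := by
  have h1 : ¬ ∃ ij : Fin n × Fin n, IsPair m ij 1 (m ij.2) := by
    rintro ⟨⟨a, b⟩, hab⟩
    have := h.unique hab
    grind
  have h2 : ¬ ∃ ij : Fin n × Fin n, IsPair m ij 2 (m ij.2) := by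
    rintro ⟨⟨a, b⟩, hab⟩
    have := h.unique hab
    grind
  have h3 : ¬ ∃ ij : Fin n × Fin n, IsPair m ij 3 3 := by
    rintro ⟨⟨a, b⟩, hab⟩
    have := h.unique hab
    grind
  have h4 : ¬ ∃ ij : Fin n × Fin n, IsPair m ij 3 4 := by
    rintro ⟨⟨a, b⟩, hab⟩
    have := h.unique hab
    grind
  have h5 : ¬ ∃ ij : Fin n × Fin n, IsPair m ij 3 6 := by
    rintro ⟨⟨a, b⟩, hab⟩
    have := h.unique hab
    grind
  have h6 : ∃ ij : Fin n × Fin n, IsPair m ij 4 4 := ⟨(i, j), h⟩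
  rw [P, dif_neg h.not_single, dif_neg h1, dif_neg h2, dif_neg h3, dif_neg h4, dif_neg h5,
    dif_pos h6]
  rcases h.unique (h6.choose_spec) with ⟨e, -, -⟩ | ⟨e, e3, e4⟩
  · simp only [e]
  · simp only [e]
    ring

end Polynomials

/-! ### The diophantine equation -/

section Diophantine

variable {n : ℕ}

/-- The matrix `(q^{a_{ij}})`. -/
def powerMatrix {k : Type*} [Field k] (q : k) (a : Matrix (Fin n) (Fin n) ℤ) :
    Matrix (Fin n) (Fin n) k :=
  Matrix.of fun i j => q ^ a i j

/-- `K(m) = ∑_{i,j} a_{ij} m_i m_j`. -/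
def quadForm (a : Matrix (Fin n) (Fin n) ℤ) (m : Fin n → ℕ) : ℤ :=
  ∑ i, ∑ j, a i j * (m i : ℤ) * (m j : ℤ)

/-- `λ(m) = ∑_i a_{ii} m_i`. -/
def linForm (a : Matrix (Fin n) (Fin n) ℤ) (m : Fin n → ℕ) : ℤ :=
  ∑ i, a i i * (m i : ℤ)

/-- The exceptional degrees. In the first case, the degree `m e_i` is exceptional unless both
`a_{ii} = 0` and `m = 0` in `k`; the latter cannot happen in characteristic zero. -/
def IsExceptional (k : Type*) [Field k] (a : Matrix (Fin n) (Fin n) ℤ) (m : Fin n → ℕ) : Prop :=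
  (∃ i : Fin n, ∃ c : ℕ, 2 ≤ c ∧ (a i i ≠ 0 ∨ (c : k) ≠ 0) ∧ m = Pi.single i c) ∨
  (∃ i j : Fin n, i ≠ j ∧ ∃ c : ℕ, 1 ≤ c ∧ m = Pi.single i 2 + Pi.single j (2 * c)) ∨
  (∃ i j : Fin n, i ≠ j ∧
    (m = Pi.single i 3 + Pi.single j 3 ∨ m = Pi.single i 4 + Pi.single j 4))

end Diophantine

end DiagonalNichols

/-!
The defining ideal of `B(V)` consists of the elements that are killed by all iterated skew
derivations, so `B(V) = T(V)` if and only if the component `Δ_{m-1,1}` of the coproduct is injective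
in every degree `m ≠ 0`. Let `γ` be the braided rotation which moves the first letter of a word to
its end, and `γ'` the rotation of all letters but the first, twisted by the double braiding with the
first letter. Then `Δ_{m-1,1} (1 - γ) = (1 - γ') (id ⊗ Δ_{m-2,1})`, and a power of `γ'` is
multiplication by the monodromy `q^{K(m) - λ(m)}`. Now assume injectivity in all smaller degrees.

* If `K(m) ≠ λ(m)`, then `1 - γ'` is injective in degree `m`, hence so is `Δ_{m-1,1} (1 - γ)`, and
  therefore `Δ_{m-1,1}` is injective, its source being finite dimensional.
* If `K(m) = λ(m)`, then injectivity of `Δ_{m-1,1}` forces `dim ker (1 - γ) = dim ker (1 - γ')`.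
  Since `q` is not a root of unity, these dimensions are the numbers of orbits of the underlying
  rotations of words. For `m` supported on at least two indices, comparing fixed points by means of
  the growth of multinomial coefficients shows that they differ unless `m` is exceptional.
* In the exceptional degrees with `K(m) = λ(m)` the dimensions agree. Multiplying one `q_{ii}` by
  `1 + ε` over the dual numbers makes the monodromy different from `1`, so that `1 - γ'` becomes
  injective up to `ε`, and the constant terms of the solutions still show that `Δ_{m-1,1}` is
  injective. Here `m_i (m_i - 1)` has to be non-zero in `k`, which is where `char k ≠ 2, 3` enters.
-/

namespace DiagonalNichols

/-! ### Words in the tensor algebra -/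

section Words

variable {ι R M : Type*} [CommRing R] [AddCommGroup M] [Module R M] (x : Module.Basis ι R M)

/-- The monomial `x_{i_1} ⋯ x_{i_m}` of `T(M)` belonging to the word `i_1 … i_m`. -/
noncomputable def word (w : List ι) : TensorAlgebra R M :=
  (w.map fun i => TensorAlgebra.ι R (x i)).prod

@[simp] theorem word_nil : word x [] = 1 := rfl

theorem word_cons (i : ι) (w : List ι) : word x (i :: w) = TensorAlgebra.ι R (x i) * word x w :=
  rfl

/-- The basis of `T(M)` consisting of the monomials. -/
noncomputable def wordBasis : Module.Basis (List ι) R (TensorAlgebra R M) :=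
  x.tensorAlgebra.reindex FreeMonoid.toList

theorem equivFreeAlgebra_symm_equivMonoidAlgebra_symm_single (w : FreeMonoid ι) :
    (TensorAlgebra.equivFreeAlgebra x).symm
      (FreeAlgebra.equivMonoidAlgebraFreeMonoid.symm (MonoidAlgebra.single w 1)) =
        word x w.toList := by
  induction w using FreeMonoid.recOn with
  | one => simp [← MonoidAlgebra.one_def]
  | of_mul i w ih =>
    rw [← one_mul (1 : R), ← MonoidAlgebra.single_mul_single, map_mul, map_mul, ih,
      FreeMonoid.toList_mul, FreeMonoid.toList_of, List.singleton_append, word_cons]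
    simp [FreeAlgebra.equivMonoidAlgebraFreeMonoid]

theorem wordBasis_apply (w : List ι) : wordBasis x w = word x w := by
  rw [wordBasis, Module.Basis.reindex_apply, Module.Basis.tensorAlgebra, Module.Basis.map_apply]
  exact equivFreeAlgebra_symm_equivMonoidAlgebra_symm_single x (FreeMonoid.ofList w)

@[elab_as_elim]
theorem word_span_induction {P : TensorAlgebra R M → Prop} (u : TensorAlgebra R M)
    (word : ∀ w, P (word x w)) (add : ∀ u v, P u → P v → P (u + v))
    (smul : ∀ (c : R) u, P u → P (c • u)) : P u := by
  have h_span : u ∈ Submodule.span R (Set.range (wordBasis x)) :=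
    (wordBasis x).span_eq ▸ Submodule.mem_top
  induction h_span using Submodule.span_induction with
  | mem _ h => obtain ⟨w, rfl⟩ := h; exact wordBasis_apply x w ▸ word w
  | zero => exact zero_smul R (1 : TensorAlgebra R M) ▸ smul 0 1 (word [])
  | add u v _ _ hu hv => exact add u v hu hv
  | smul c u _ hu => exact smul c u hu

@[elab_as_elim]
theorem word_induction {P : TensorAlgebra R M → Prop} (u : TensorAlgebra R M) (one : P 1)
    (ι_mul : ∀ i u, P u → P (TensorAlgebra.ι R (x i) * u))
    (add : ∀ u v, P u → P v → P (u + v)) (smul : ∀ (c : R) u, P u → P (c • u)) : P u := by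
  induction u using word_span_induction x with
  | word w =>
    induction w with
    | nil => exact one
    | cons i w ih => exact ι_mul i _ ih
  | add u v hu hv => exact add u v hu hv
  | smul c u hu => exact smul c u hu

/-- The coefficient of the monomial of the word `w`. For `w = []` this is the counit of `T(M)`. -/
noncomputable def wordCoeff (w : List ι) : TensorAlgebra R M →ₗ[R] R :=
  (wordBasis x).coord w

theorem wordCoeff_word [DecidableEq ι] (w u : List ι) :
    wordCoeff x w (word x u) = if u = w then 1 else 0 := by
  rw [wordCoeff, ← wordBasis_apply, Module.Basis.coord_apply, Module.Basis.repr_self,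
    Finsupp.single_apply]

theorem wordCoeff_nil_one : wordCoeff x [] 1 = 1 := by
  classical simpa using wordCoeff_word x [] []

theorem wordCoeff_cons_one (i : ι) (w : List ι) : wordCoeff x (i :: w) 1 = 0 := by
  classical simpa using wordCoeff_word x (i :: w) []

theorem wordCoeff_nil_ι_mul (i : ι) (u : TensorAlgebra R M) :
    wordCoeff x [] (TensorAlgebra.ι R (x i) * u) = 0 := by
  classical
  induction u using word_span_induction x with
  | word w => simp [← word_cons, wordCoeff_word]
  | add u v hu hv => rw [mul_add, map_add, hu, hv, add_zero]
  | smul c u hu => rw [mul_smul_comm, map_smul, hu, smul_zero]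

theorem wordCoeff_cons_ι_mul [DecidableEq ι] (i j : ι) (w : List ι) (u : TensorAlgebra R M) :
    wordCoeff x (j :: w) (TensorAlgebra.ι R (x i) * u) =
      if i = j then wordCoeff x w u else 0 := by
  induction u using word_span_induction x with
  | word v => by_cases h : i = j <;> simp [← word_cons, wordCoeff_word, h]
  | add u v hu hv => rw [mul_add, map_add, hu, hv]; split_ifs <;> simp
  | smul c u hu => rw [mul_smul_comm, map_smul, hu]; split_ifs <;> simp

theorem wordCoeff_nil_mul_ι (i : ι) (u : TensorAlgebra R M) :
    wordCoeff x [] (u * TensorAlgebra.ι R (x i)) = 0 := by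
  induction u using word_induction x with
  | one => simpa using wordCoeff_nil_ι_mul x i 1
  | ι_mul j u _ => rw [mul_assoc, wordCoeff_nil_ι_mul]
  | add u v hu hv => rw [add_mul, map_add, hu, hv, add_zero]
  | smul c u hu => rw [smul_mul_assoc, map_smul, hu, smul_zero]

end Words

/-! ### Contraction of tensors -/

section Contraction

variable {R X Y : Type*} [CommRing R] [AddCommGroup X] [Module R X] [AddCommGroup Y] [Module R Y]

/-- The contraction `id ⊗ f : X ⊗ Y → X` of the second tensor factor with a functional `f`. -/
noncomputable def contractSnd (f : Y →ₗ[R] R) : X ⊗[R] Y →ₗ[R] X :=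
  (TensorProduct.rid R X).toLinearMap ∘ₗ f.lTensor X

@[simp] theorem contractSnd_tmul (f : Y →ₗ[R] R) (a : X) (b : Y) :
    contractSnd f (a ⊗ₜ[R] b) = f b • a := by
  simp [contractSnd]

theorem contractSnd_map {X' Y' : Type*} [AddCommGroup X'] [Module R X'] [AddCommGroup Y']
    [Module R Y'] (f : Y' →ₗ[R] R) (φ : X →ₗ[R] X') (ψ : Y →ₗ[R] Y') (z : X ⊗[R] Y) :
    contractSnd f (TensorProduct.map φ ψ z) = φ (contractSnd (f ∘ₗ ψ) z) := by
  induction z with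
  | zero => simp
  | add a b ha hb => rw [map_add, map_add, map_add, map_add, ha, hb]
  | tmul a b => simp

theorem map_eq_apply_contractSnd_tmul_one (f : X →ₗ[R] R) (g : Y →ₗ[R] R) (z : X ⊗[R] Y) :
    TensorProduct.map f g z = f (contractSnd g z) ⊗ₜ 1 := by
  induction z with
  | zero => simp
  | add a b ha hb => rw [map_add, map_add, map_add, TensorProduct.add_tmul, ha, hb]
  | tmul a b =>
    rw [TensorProduct.map_tmul, contractSnd_tmul, map_smul, TensorProduct.smul_tmul, smul_eq_mul,
      mul_one]

theorem eq_zero_of_contractSnd_eq_zero [Module.Free R X] {κ : Type*} (g : κ → Y →ₗ[R] R)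
    (hg : ∀ b, (∀ j, g j b = 0) → b = 0) (z : X ⊗[R] Y)
    (hz : ∀ j, contractSnd (g j) z = 0) : z = 0 := by
  classical
  let B := Module.Free.chooseBasis R X
  have apply_coord (j i) (z : X ⊗[R] Y) :
      g j (TensorProduct.equivFinsuppOfBasisLeft B z i) = B.coord i (contractSnd (g j) z) := by
    induction z with
    | zero => simp
    | add a b ha hb => rw [map_add, Finsupp.add_apply, map_add, map_add, map_add, ha, hb]
    | tmul a b => simp [mul_comm]
  rw [← (TensorProduct.equivFinsuppOfBasisLeft B).map_eq_zero_iff]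
  ext i
  exact hg _ fun j => by rw [apply_coord, hz, map_zero]

theorem eq_zero_of_map_eq_zero [Module.Free R X] {κ κ' : Type*} (f : κ → X →ₗ[R] R)
    (g : κ' → Y →ₗ[R] R) (hf : ∀ a, (∀ i, f i a = 0) → a = 0)
    (hg : ∀ b, (∀ j, g j b = 0) → b = 0) (z : X ⊗[R] Y)
    (hz : ∀ i j, TensorProduct.map (f i) (g j) z = 0) : z = 0 :=
  eq_zero_of_contractSnd_eq_zero g hg z fun j => hf _ fun i => by
    have h := hz i j
    rw [map_eq_apply_contractSnd_tmul_one] at h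
    simpa using congrArg (TensorProduct.rid R R) h

end Contraction

theorem mem_range_sup_range_of_map_eq_zero {k X κ : Type*} [Field k] [AddCommGroup X] [Module k X]
    (f : κ → X →ₗ[k] k) (J : Submodule k X) (hJ : ∀ u, u ∈ J ↔ ∀ i, f i u = 0) (z : X ⊗[k] X)
    (hz : ∀ i j, TensorProduct.map (f i) (f j) z = 0) :
    z ∈ LinearMap.range (TensorProduct.map J.subtype (LinearMap.id : X →ₗ[k] X)) ⊔
      LinearMap.range (TensorProduct.map (LinearMap.id : X →ₗ[k] X) J.subtype) := by
  have hle : ∀ i, J ≤ LinearMap.ker (f i) := fun i u hu => (hJ u).1 hu i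
  have h_exact : Function.Exact J.subtype J.mkQ := fun u => by simp
  have h_ker := TensorProduct.map_ker h_exact J.mkQ_surjective h_exact J.mkQ_surjective
  have h_separating : ∀ a : X ⧸ J, (∀ i, J.liftQ (f i) (hle i) a = 0) → a = 0 := fun a ha => by
    obtain ⟨u, rfl⟩ := J.mkQ_surjective a
    rw [Submodule.mkQ_apply, Submodule.Quotient.mk_eq_zero, hJ]
    exact ha
  rw [sup_comm]
  change z ∈ LinearMap.range (J.subtype.lTensor X) ⊔ LinearMap.range (J.subtype.rTensor X)
  rw [← h_ker, LinearMap.mem_ker]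
  refine eq_zero_of_map_eq_zero _ _ h_separating h_separating _ fun i j => ?_
  rw [TensorProduct.map_map, Submodule.liftQ_mkQ, Submodule.liftQ_mkQ, hz]

/-! ### Skew derivations -/

section SkewDerivations

variable {k : Type*} [Field k] {n : ℕ} {V : Type*} [AddCommGroup V] [Module k V]
  (x : Module.Basis (Fin n) k V) (Q : Matrix (Fin n) (Fin n) k)

theorem scaling_ι (i j : Fin n) :
    scaling x Q i (TensorAlgebra.ι k (x j)) = Q i j • TensorAlgebra.ι k (x j) := by
  simp [scaling]

theorem scaling_comm (i j : Fin n) (u : TensorAlgebra k V) :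
    scaling x Q i (scaling x Q j u) = scaling x Q j (scaling x Q i u) := by
  induction u using word_induction x with
  | one => simp
  | ι_mul l u hu => simp [scaling_ι, hu, smul_smul, mul_comm]
  | add u v hu hv => simp only [map_add, hu, hv]
  | smul c u hu => simp only [map_smul, hu]

theorem wordCoeff_nil_scaling (i : Fin n) (u : TensorAlgebra k V) :
    wordCoeff x [] (scaling x Q i u) = wordCoeff x [] u := by
  induction u using word_induction x with
  | one => simp
  | ι_mul l u _ => simp [scaling_ι, wordCoeff_nil_ι_mul]
  | add u v hu hv => simp only [map_add, hu, hv]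
  | smul c u hu => simp only [map_smul, hu]

theorem mulPrimitive_tmul (i : Fin n) (u v : TensorAlgebra k V) :
    mulPrimitive x Q i (u ⊗ₜ v) = (TensorAlgebra.ι k (x i) * u) ⊗ₜ v +
      scaling x Q i u ⊗ₜ (TensorAlgebra.ι k (x i) * v) := by
  simp [mulPrimitive]

theorem contractSnd_mulPrimitive (f : TensorAlgebra k V →ₗ[k] k) (i : Fin n)
    (z : TensorAlgebra k V ⊗[k] TensorAlgebra k V) :
    contractSnd f (mulPrimitive x Q i z) = TensorAlgebra.ι k (x i) * contractSnd f z +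
      scaling x Q i
        (contractSnd (f ∘ₗ LinearMap.mulLeft k (TensorAlgebra.ι k (x i))) z) := by
  rw [mulPrimitive, LinearMap.add_apply, map_add, contractSnd_map, contractSnd_map,
    LinearMap.comp_id, LinearMap.mulLeft_apply, AlgHom.toLinearMap_apply]

theorem contractSnd_counit_coproduct (u : TensorAlgebra k V) :
    contractSnd (wordCoeff x []) (coproduct x Q u) = u := by
  have h_mulLeft (i) :
      wordCoeff x [] ∘ₗ LinearMap.mulLeft k (TensorAlgebra.ι k (x i)) = 0 :=
    LinearMap.ext (wordCoeff_nil_ι_mul x i)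
  induction u using word_induction x with
  | one => simp [coproduct_one, wordCoeff_nil_one]
  | ι_mul i u hu =>
    rw [coproduct_mul, contractSnd_mulPrimitive, hu, h_mulLeft]
    simp [contractSnd]
  | add u v hu hv => simp only [map_add, hu, hv]
  | smul c u hu => simp only [map_smul, hu]

/-- The skew derivation `∂_j = (id ⊗ ε_j) Δ` of `T(V)`, where `ε_j` is the coefficient of `x_j`. -/
noncomputable def skewDer (j : Fin n) : TensorAlgebra k V →ₗ[k] TensorAlgebra k V :=
  contractSnd (wordCoeff x [j]) ∘ₗ coproduct x Q

@[simp] theorem skewDer_one (j : Fin n) : skewDer x Q j 1 = 0 := by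
  simp [skewDer, coproduct_one, wordCoeff_cons_one]

theorem skewDer_ι_mul (i j : Fin n) (u : TensorAlgebra k V) :
    skewDer x Q j (TensorAlgebra.ι k (x i) * u) = TensorAlgebra.ι k (x i) * skewDer x Q j u +
      if i = j then scaling x Q i u else 0 := by
  have h_mulLeft : wordCoeff x [j] ∘ₗ LinearMap.mulLeft k (TensorAlgebra.ι k (x i)) =
      if i = j then wordCoeff x [] else 0 :=
    LinearMap.ext fun v => by
      simp only [LinearMap.comp_apply, LinearMap.mulLeft_apply, wordCoeff_cons_ι_mul]
      split_ifs <;> rfl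
  rw [skewDer, LinearMap.comp_apply, coproduct_mul, contractSnd_mulPrimitive, h_mulLeft]
  split_ifs
  · rw [contractSnd_counit_coproduct, LinearMap.comp_apply]
  · simp [contractSnd]

theorem skewDer_mul_ι (i j : Fin n) (u : TensorAlgebra k V) :
    skewDer x Q j (u * TensorAlgebra.ι k (x i)) = (if i = j then u else 0) +
      Q j i • (skewDer x Q j u * TensorAlgebra.ι k (x i)) := by
  induction u using word_induction x with
  | one => simpa using skewDer_ι_mul x Q i j 1
  | ι_mul l u hu =>
    rw [mul_assoc, skewDer_ι_mul, hu, skewDer_ι_mul, map_mul, scaling_ι]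
    split_ifs <;> subst_vars <;> simp [mul_add, add_mul, mul_assoc, add_assoc]
  | add u v hu hv =>
    rw [add_mul, map_add, hu, hv, map_add, add_mul, smul_add]
    split_ifs <;> abel
  | smul c u hu =>
    rw [smul_mul_assoc, map_smul, hu, map_smul, smul_mul_assoc, smul_add, smul_comm c]
    split_ifs <;> simp

theorem skewDer_scaling (i j : Fin n) (u : TensorAlgebra k V) :
    skewDer x Q j (scaling x Q i u) = Q i j • scaling x Q i (skewDer x Q j u) := by
  induction u using word_induction x with
  | one => simp
  | ι_mul l u hu =>
    rw [map_mul, scaling_ι, smul_mul_assoc, map_smul, skewDer_ι_mul, hu, skewDer_ι_mul, map_add,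
      map_mul, scaling_ι]
    split_ifs with hl
    · subst hl
      simp [smul_smul, scaling_comm x Q i l]
    · simp [smul_smul, mul_comm]
  | add u v hu hv => simp only [map_add, hu, hv, smul_add]
  | smul c u hu => rw [map_smul, map_smul, hu, map_smul, map_smul, smul_comm]

theorem wordCoeff_nil_skewDer (j : Fin n) (u : TensorAlgebra k V) :
    wordCoeff x [] (skewDer x Q j u) = wordCoeff x [j] u := by
  induction u using word_induction x with
  | one => simp [wordCoeff_cons_one]
  | ι_mul i u _ =>
    rw [skewDer_ι_mul, map_add, wordCoeff_nil_ι_mul, zero_add, wordCoeff_cons_ι_mul]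
    split_ifs
    · rw [wordCoeff_nil_scaling]
    · simp
  | add u v hu hv => simp only [map_add, hu, hv]
  | smul c u hu => simp only [map_smul, hu]

theorem map_scaling_mulPrimitive (i j : Fin n) (z : TensorAlgebra k V ⊗[k] TensorAlgebra k V) :
    TensorProduct.map (scaling x Q i).toLinearMap (scaling x Q i).toLinearMap
        (mulPrimitive x Q j z) =
      Q i j • mulPrimitive x Q j
        (TensorProduct.map (scaling x Q i).toLinearMap (scaling x Q i).toLinearMap z) := by
  induction z with
  | zero => simp
  | add a b ha hb => simp only [map_add, ha, hb, smul_add]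
  | tmul a b =>
    simp [mulPrimitive_tmul, scaling_ι, TensorProduct.smul_tmul', scaling_comm x Q i j]

theorem coproduct_scaling (i : Fin n) (u : TensorAlgebra k V) :
    coproduct x Q (scaling x Q i u) =
      TensorProduct.map (scaling x Q i).toLinearMap (scaling x Q i).toLinearMap
        (coproduct x Q u) := by
  induction u using word_induction x with
  | one => simp [coproduct_one]
  | ι_mul j u hu =>
    rw [coproduct_mul, map_scaling_mulPrimitive, map_mul, scaling_ι, smul_mul_assoc, map_smul,
      coproduct_mul, hu]
  | add u v hu hv => simp only [map_add, hu, hv]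
  | smul c u hu => simp only [map_smul, hu]

theorem map_skewDer_mulPrimitive (i j : Fin n) (z : TensorAlgebra k V ⊗[k] TensorAlgebra k V) :
    TensorProduct.map LinearMap.id (skewDer x Q j) (mulPrimitive x Q i z) =
      mulPrimitive x Q i (TensorProduct.map LinearMap.id (skewDer x Q j) z) +
        if i = j then TensorProduct.map (scaling x Q i).toLinearMap
          (scaling x Q i).toLinearMap z else 0 := by
  induction z with
  | zero => simp
  | add a b ha hb =>
    simp only [map_add, ha, hb]
    split_ifs <;> abel
  | tmul a b =>
    simp only [mulPrimitive_tmul, map_add, TensorProduct.map_tmul, LinearMap.id_apply,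
      skewDer_ι_mul, TensorProduct.tmul_add]
    split_ifs <;> simp [add_assoc]

/-- This is coassociativity of `Δ`, contracted with `ε_j` in the third factor. -/
theorem map_skewDer_coproduct (j : Fin n) (u : TensorAlgebra k V) :
    TensorProduct.map LinearMap.id (skewDer x Q j) (coproduct x Q u) =
      coproduct x Q (skewDer x Q j u) := by
  induction u using word_induction x with
  | one => simp [coproduct_one]
  | ι_mul i u hu =>
    rw [coproduct_mul, map_skewDer_mulPrimitive, hu, skewDer_ι_mul, map_add, coproduct_mul]
    split_ifs <;> simp [coproduct_scaling]
  | add u v hu hv => simp only [map_add, hu, hv]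
  | smul c u hu => simp only [map_smul, hu]

/-- The functional `ε ∂_{i_m} ⋯ ∂_{i_1}` on `T(V)` belonging to the word `i_1 … i_m`, that is, the
pairing of `T(V)` with the monomials of the dual tensor algebra. -/
noncomputable def wordPairing : List (Fin n) → TensorAlgebra k V →ₗ[k] k
  | [] => wordCoeff x []
  | j :: w => wordPairing w ∘ₗ skewDer x Q j

theorem wordPairing_cons (j : Fin n) (w : List (Fin n)) (u : TensorAlgebra k V) :
    wordPairing x Q (j :: w) u = wordPairing x Q w (skewDer x Q j u) := rfl

theorem map_wordPairing_coproduct (w w' : List (Fin n)) (u : TensorAlgebra k V) :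
    TensorProduct.map (wordPairing x Q w) (wordPairing x Q w') (coproduct x Q u) =
      wordPairing x Q (w' ++ w) u ⊗ₜ 1 := by
  induction w' generalizing u with
  | nil =>
    rw [map_eq_apply_contractSnd_tmul_one, wordPairing, contractSnd_counit_coproduct,
      List.nil_append]
  | cons j w' ih =>
    rw [List.cons_append, wordPairing_cons, ← ih, ← map_skewDer_coproduct,
      TensorProduct.map_map, LinearMap.comp_id, wordPairing]

theorem exists_wordPairing_scaling_eq (w : List (Fin n)) (i : Fin n) :
    ∃ c : k, ∀ u, wordPairing x Q w (scaling x Q i u) = c * wordPairing x Q w u := by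
  induction w with
  | nil => exact ⟨1, fun u => by rw [one_mul]; exact wordCoeff_nil_scaling x Q i u⟩
  | cons j w ih =>
    obtain ⟨c, hc⟩ := ih
    refine ⟨Q i j * c, fun u => ?_⟩
    rw [wordPairing_cons, skewDer_scaling, map_smul, hc, wordPairing_cons, smul_eq_mul, mul_assoc]

end SkewDerivations

/-! ### Homogeneous components -/

section Grading

variable {k : Type*} [Field k] {n : ℕ} {V : Type*} [AddCommGroup V] [Module k V]

local notation "π" => GradedAlgebra.proj (tensorPower k V)

theorem proj_zero_one : π 0 1 = 1 := by
  rw [GradedAlgebra.proj_apply]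
  exact DirectSum.decompose_of_mem_same _ SetLike.GradedOne.one_mem

theorem proj_succ_one (m : ℕ) : π (m + 1) 1 = 0 := by
  rw [GradedAlgebra.proj_apply]
  exact DirectSum.decompose_of_mem_ne _ SetLike.GradedOne.one_mem m.succ_ne_zero.symm

theorem ι_mem_tensorPower_one (v : V) : TensorAlgebra.ι k v ∈ tensorPower k V 1 := by
  rw [tensorPower, pow_one]
  exact LinearMap.mem_range_self _ v

theorem proj_zero_ι_mul (v : V) (u : TensorAlgebra k V) : π 0 (TensorAlgebra.ι k v * u) = 0 := by
  rw [GradedAlgebra.proj_apply]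
  exact DirectSum.coe_decompose_mul_of_left_mem_of_not_le _ (ι_mem_tensorPower_one v)
    (Nat.not_succ_le_self 0)

theorem proj_succ_ι_mul (m : ℕ) (v : V) (u : TensorAlgebra k V) :
    π (m + 1) (TensorAlgebra.ι k v * u) = TensorAlgebra.ι k v * π m u := by
  rw [GradedAlgebra.proj_apply, GradedAlgebra.proj_apply, add_comm]
  exact DirectSum.coe_decompose_mul_add_of_left_mem _ (ι_mem_tensorPower_one v)

variable (x : Module.Basis (Fin n) k V) (Q : Matrix (Fin n) (Fin n) k)

theorem proj_scaling (m : ℕ) (i : Fin n) (u : TensorAlgebra k V) :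
    π m (scaling x Q i u) = scaling x Q i (π m u) := by
  induction u using word_induction x generalizing m with
  | one => cases m <;> simp only [proj_zero_one, proj_succ_one, map_one, map_zero]
  | ι_mul j u hu =>
    rw [map_mul, scaling_ι, smul_mul_assoc, map_smul]
    cases m with
    | zero => rw [proj_zero_ι_mul, proj_zero_ι_mul, smul_zero, map_zero]
    | succ m => rw [proj_succ_ι_mul, proj_succ_ι_mul, hu, map_mul, scaling_ι, smul_mul_assoc]
  | add u v hu hv => simp only [map_add, hu, hv]
  | smul c u hu => simp only [map_smul, hu]

theorem skewDer_proj_zero (j : Fin n) (u : TensorAlgebra k V) : skewDer x Q j (π 0 u) = 0 := by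
  induction u using word_induction x with
  | one => rw [proj_zero_one, skewDer_one]
  | ι_mul i u _ => rw [proj_zero_ι_mul, map_zero]
  | add u v hu hv => simp only [map_add, hu, hv, add_zero]
  | smul c u hu => simp only [map_smul, hu, smul_zero]

theorem skewDer_proj_succ (m : ℕ) (j : Fin n) (u : TensorAlgebra k V) :
    skewDer x Q j (π (m + 1) u) = π m (skewDer x Q j u) := by
  induction u using word_induction x generalizing m with
  | one => rw [proj_succ_one, skewDer_one, map_zero, map_zero]
  | ι_mul i u hu =>
    rw [proj_succ_ι_mul, skewDer_ι_mul, skewDer_ι_mul, map_add, apply_ite (π m), map_zero,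
      proj_scaling]
    congr 1
    cases m with
    | zero => rw [skewDer_proj_zero, mul_zero, proj_zero_ι_mul]
    | succ m => rw [hu, proj_succ_ι_mul]
  | add u v hu hv => simp only [map_add, hu, hv]
  | smul c u hu => simp only [map_smul, hu]

theorem wordCoeff_proj (w : List (Fin n)) (m : ℕ) (u : TensorAlgebra k V) :
    wordCoeff x w (π m u) = if w.length = m then wordCoeff x w u else 0 := by
  induction u using word_induction x generalizing w m with
  | one =>
    cases w <;> cases m <;>
      simp [-GradedAlgebra.proj_apply, proj_zero_one, proj_succ_one, wordCoeff_cons_one]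
  | ι_mul i u hu =>
    cases w <;> cases m <;>
      simp [-GradedAlgebra.proj_apply, proj_zero_ι_mul, proj_succ_ι_mul, wordCoeff_nil_ι_mul,
        wordCoeff_cons_ι_mul, hu, ← ite_and, and_comm]
  | add u v hu hv => simp only [map_add, hu, hv]; split_ifs <;> simp
  | smul c u hu => simp only [map_smul, hu]; split_ifs <;> simp

theorem wordPairing_proj (w : List (Fin n)) (m : ℕ) (u : TensorAlgebra k V) :
    wordPairing x Q w (π m u) = if w.length = m then wordPairing x Q w u else 0 := by
  induction w generalizing m u with
  | nil => exact wordCoeff_proj x [] m u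
  | cons j w ih =>
    cases m with
    | zero => rw [wordPairing_cons, skewDer_proj_zero, map_zero]; rfl
    | succ m =>
      rw [wordPairing_cons, skewDer_proj_succ, ih, wordPairing_cons, List.length_cons]
      simp only [Nat.add_right_cancel_iff]

theorem eq_zero_of_proj_eq_zero (u : TensorAlgebra k V) (h : ∀ m, π m u = 0) : u = 0 := by
  refine (DirectSum.decompose (tensorPower k V)).injective ?_
  rw [DirectSum.decompose_zero]
  exact DFinsupp.ext fun m => Subtype.ext (h m)

end Grading

/-! ### The defining ideal as a radical -/

section Radical

variable {k : Type*} [Field k] {n : ℕ} {V : Type*} [AddCommGroup V] [Module k V]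
  (x : Module.Basis (Fin n) k V) (Q : Matrix (Fin n) (Fin n) k)

/-- The radical of the pairing between `T(V)` and the words: the elements `u` of `T(V)` with
`ε ∂_{i_m} ⋯ ∂_{i_1} u = 0` for all words `i_1 … i_m`. It is the defining ideal of the Nichols
algebra. -/
noncomputable def radical : Submodule k (TensorAlgebra k V) :=
  ⨅ w, LinearMap.ker (wordPairing x Q w)

theorem mem_radical {u : TensorAlgebra k V} :
    u ∈ radical x Q ↔ ∀ w, wordPairing x Q w u = 0 := by
  simp [radical]

theorem skewDer_mem_radical {u : TensorAlgebra k V} (hu : u ∈ radical x Q) (j : Fin n) :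
    skewDer x Q j u ∈ radical x Q :=
  (mem_radical x Q).2 fun w => (mem_radical x Q).1 hu (j :: w)

theorem proj_mem_radical {u : TensorAlgebra k V} (hu : u ∈ radical x Q) (m : ℕ) :
    GradedAlgebra.proj (tensorPower k V) m u ∈ radical x Q :=
  (mem_radical x Q).2 fun w => by rw [wordPairing_proj, (mem_radical x Q).1 hu, ite_self]

theorem wordCoeff_eq_zero_of_mem_radical {u : TensorAlgebra k V} (hu : u ∈ radical x Q)
    {w : List (Fin n)} (hw : w.length < 2) : wordCoeff x w u = 0 := by
  match w, hw with
  | [], _ => exact (mem_radical x Q).1 hu []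
  | [j], _ => rw [← wordCoeff_nil_skewDer x Q]; exact (mem_radical x Q).1 hu [j]

theorem ι_mul_mem_radical {u : TensorAlgebra k V} (hu : u ∈ radical x Q) (i : Fin n) :
    TensorAlgebra.ι k (x i) * u ∈ radical x Q := by
  rw [mem_radical]
  intro w
  induction w generalizing u with
  | nil => exact wordCoeff_nil_ι_mul x i u
  | cons j w ih =>
    rw [wordPairing_cons, skewDer_ι_mul, map_add, ih (skewDer_mem_radical x Q hu j), zero_add]
    split_ifs
    · obtain ⟨c, hc⟩ := exists_wordPairing_scaling_eq x Q w i
      rw [hc, (mem_radical x Q).1 hu, mul_zero]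
    · exact map_zero _

theorem mul_ι_mem_radical {u : TensorAlgebra k V} (hu : u ∈ radical x Q) (i : Fin n) :
    u * TensorAlgebra.ι k (x i) ∈ radical x Q := by
  rw [mem_radical]
  intro w
  induction w generalizing u with
  | nil => exact wordCoeff_nil_mul_ι x i u
  | cons j w ih =>
    rw [wordPairing_cons, skewDer_mul_ι, map_add, map_smul, ih (skewDer_mem_radical x Q hu j),
      smul_zero, add_zero]
    split_ifs
    · exact (mem_radical x Q).1 hu w
    · exact map_zero _

theorem mul_mem_radical_left (a : TensorAlgebra k V) {u : TensorAlgebra k V}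
    (hu : u ∈ radical x Q) : a * u ∈ radical x Q := by
  induction a using word_induction x with
  | one => rwa [one_mul]
  | ι_mul i a ha => rw [mul_assoc]; exact ι_mul_mem_radical x Q ha i
  | add a b ha hb => rw [add_mul]; exact add_mem ha hb
  | smul c a ha => rw [smul_mul_assoc]; exact Submodule.smul_mem _ c ha

theorem mul_mem_radical_right (a : TensorAlgebra k V) {u : TensorAlgebra k V}
    (hu : u ∈ radical x Q) : u * a ∈ radical x Q := by
  induction a using word_induction x generalizing u with
  | one => rwa [mul_one]
  | ι_mul i a ha => rw [← mul_assoc]; exact ha (mul_ι_mem_radical x Q hu i)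
  | add a b ha hb => rw [mul_add]; exact add_mem (ha hu) (hb hu)
  | smul c a ha => rw [mul_smul_comm]; exact Submodule.smul_mem _ c (ha hu)

/-- `radical x Q`, as a two-sided ideal of `T(V)`. -/
noncomputable def radicalIdeal : TwoSidedIdeal (TensorAlgebra k V) :=
  .mk' (radical x Q) (zero_mem _) add_mem neg_mem (mul_mem_radical_left x Q _)
    (mul_mem_radical_right x Q _)

theorem mem_radicalIdeal {u : TensorAlgebra k V} : u ∈ radicalIdeal x Q ↔ u ∈ radical x Q := by
  simp [radicalIdeal]

theorem radicalIdeal_isHomogeneousBiideal : IsHomogeneousBiideal x Q (radicalIdeal x Q) where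
  homogeneous r hr m := by
    rw [mem_radicalIdeal] at hr ⊢
    exact proj_mem_radical x Q hr m
  degree_ge_two r hr m hm := by
    refine (wordBasis x).ext_elem fun w => ?_
    change wordCoeff x w _ = wordCoeff x w 0
    rw [wordCoeff_proj, map_zero, ite_eq_right_iff]
    rintro rfl
    exact wordCoeff_eq_zero_of_mem_radical x Q ((mem_radicalIdeal x Q).1 hr) hm
  coideal r hr := by
    refine mem_range_sup_range_of_map_eq_zero (wordPairing x Q) _ (fun u => ?_) _ fun w w' => ?_
    · rw [← mem_radical, ← mem_radicalIdeal]
      simp [idealSubmodule]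
    · rw [map_wordPairing_coproduct, (mem_radical x Q).1 ((mem_radicalIdeal x Q).1 hr),
        TensorProduct.zero_tmul]

variable {x Q} {I : TwoSidedIdeal (TensorAlgebra k V)}

theorem mem_idealSubmodule {u : TensorAlgebra k V} : u ∈ idealSubmodule I ↔ u ∈ I := by
  simp [idealSubmodule]

theorem IsHomogeneousBiideal.wordCoeff_eq_zero (hI : IsHomogeneousBiideal x Q I)
    {w : List (Fin n)} (hw : w.length < 2) {r : TensorAlgebra k V} (hr : r ∈ I) :
    wordCoeff x w r = 0 := by
  have h := wordCoeff_proj x w w.length r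
  rwa [hI.degree_ge_two r hr _ hw, map_zero, if_pos rfl, eq_comm] at h

theorem IsHomogeneousBiideal.skewDer_mem (hI : IsHomogeneousBiideal x Q I)
    {r : TensorAlgebra k V} (hr : r ∈ I) (j : Fin n) : skewDer x Q j r ∈ I := by
  have h_le : LinearMap.range (TensorProduct.map (idealSubmodule I).subtype
        (LinearMap.id : TensorAlgebra k V →ₗ[k] TensorAlgebra k V)) ⊔
      LinearMap.range (TensorProduct.map
        (LinearMap.id : TensorAlgebra k V →ₗ[k] TensorAlgebra k V) (idealSubmodule I).subtype) ≤
      (idealSubmodule I).comap (contractSnd (wordCoeff x [j])) := by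
    refine sup_le ?_ ?_ <;> rintro _ ⟨z, rfl⟩ <;>
      rw [Submodule.mem_comap, contractSnd_map]
    · exact Subtype.property _
    · have h_zero : wordCoeff x [j] ∘ₗ (idealSubmodule I).subtype = 0 :=
        LinearMap.ext fun b => hI.wordCoeff_eq_zero (by simp) (mem_idealSubmodule.1 b.2)
      simp [h_zero, contractSnd]
  exact mem_idealSubmodule.1 (h_le (hI.coideal r hr))

theorem IsHomogeneousBiideal.le_radicalIdeal (hI : IsHomogeneousBiideal x Q I) :
    I ≤ radicalIdeal x Q := by
  intro r hr
  rw [mem_radicalIdeal, mem_radical]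
  intro w
  induction w generalizing r with
  | nil => exact hI.wordCoeff_eq_zero (w := []) (by simp) hr
  | cons j _ ih => exact ih (hI.skewDer_mem hr j)

variable (x Q)

theorem nicholsIdeal_eq_radicalIdeal : nicholsIdeal x Q = radicalIdeal x Q :=
  le_antisymm (sSup_le fun _ hI => hI.le_radicalIdeal)
    (le_sSup (radicalIdeal_isHomogeneousBiideal x Q))

theorem nicholsIsFree_iff_radical_eq_bot : NicholsIsFree x Q ↔ radical x Q = ⊥ := by
  rw [NicholsIsFree, nicholsProj, Function.Bijective,
    and_iff_left (RingCon.mk'_surjective _), injective_iff_map_eq_zero, Submodule.eq_bot_iff]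
  refine forall_congr' fun u => ?_
  rw [← mem_radicalIdeal, ← nicholsIdeal_eq_radicalIdeal, TwoSidedIdeal.mem_iff, ← RingCon.eq]
  exact Iff.rfl

/-- For `⇐`, the homogeneous components of an element of the radical vanish by induction on the
degree, since `∂_j` lowers the degree by one and preserves the radical. -/
theorem radical_eq_bot_iff : radical x Q = ⊥ ↔
    ∀ u, wordCoeff x [] u = 0 → (∀ j, skewDer x Q j u = 0) → u = 0 := by
  rw [Submodule.eq_bot_iff]
  constructor
  · intro h u h_counit h_der
    refine h u ((mem_radical x Q).2 fun w => ?_)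
    cases w with
    | nil => exact h_counit
    | cons j w => rw [wordPairing_cons, h_der, map_zero]
  · intro h u hu
    refine eq_zero_of_proj_eq_zero u fun m => ?_
    induction m generalizing u with
    | zero =>
      refine h _ ?_ fun j => skewDer_proj_zero x Q j u
      exact (mem_radical x Q).1 (proj_mem_radical x Q hu 0) []
    | succ m ih =>
      refine h _ ?_ fun j => ?_
      · exact (mem_radical x Q).1 (proj_mem_radical x Q hu (m + 1)) []
      · rw [skewDer_proj_succ]
        exact ih _ (skewDer_mem_radical x Q hu j)

end Radical

/-! ### The component `Δ_{m-1,1}` of the coproduct and the braided rotations -/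

section Supported

variable {α β R M : Type*} [CommRing R] [AddCommGroup M] [Module R M] {s : Set α}

theorem eqOn_supported {F G : (α →₀ R) →ₗ[R] M}
    (h : ∀ w ∈ s, F (Finsupp.single w 1) = G (Finsupp.single w 1)) {f : α →₀ R}
    (hf : f ∈ Finsupp.supported R R s) : F f = G f := by
  rw [Finsupp.supported_eq_span_single] at hf
  exact LinearMap.eqOn_span (Set.forall_mem_image.2 h) hf

theorem map_mem_of_mem_supported {F : (α →₀ R) →ₗ[R] M} {S : Submodule R M}
    (h : ∀ w ∈ s, F (Finsupp.single w 1) ∈ S) {f : α →₀ R} (hf : f ∈ Finsupp.supported R R s) :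
    F f ∈ S := by
  rw [Finsupp.supported_eq_span_single] at hf
  exact (Submodule.span_le (p := S.comap F)).2 (Set.forall_mem_image.2 h) hf

theorem apply_eq_zero_of_mem_supported {f : α →₀ R} (hf : f ∈ Finsupp.supported R R s) {w : α}
    (hw : w ∉ s) : f w = 0 :=
  Finsupp.notMem_support_iff.1 fun h => hw (hf h)

end Supported

section Operators

variable {ι R : Type*} [CommRing R]

/-- The scalar `χ_i(w)` of the braiding `x_i ⊗ w ↦ χ_i(w) w ⊗ x_i` for a word `w`. With the
transposed matrix it is the scalar of `w ⊗ x_i ↦ x_i ⊗ w`. -/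
def braidScalar (Q : Matrix ι ι R) (i : ι) (w : List ι) : R :=
  (w.map (Q i)).prod

@[simp] theorem braidScalar_nil (Q : Matrix ι ι R) (i : ι) : braidScalar Q i [] = 1 := rfl

@[simp] theorem braidScalar_cons (Q : Matrix ι ι R) (i l : ι) (w : List ι) :
    braidScalar Q i (l :: w) = Q i l * braidScalar Q i w := by
  simp [braidScalar]

@[simp] theorem braidScalar_append (Q : Matrix ι ι R) (i : ι) (w w' : List ι) :
    braidScalar Q i (w ++ w') = braidScalar Q i w * braidScalar Q i w' := by
  simp [braidScalar]

theorem braidScalar_perm (Q : Matrix ι ι R) (i : ι) {w w' : List ι} (h : w.Perm w') :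
    braidScalar Q i w = braidScalar Q i w' :=
  (h.map _).prod_eq

variable (R) in
/-- The linear map which inserts the letter `i` in the second position of a word. -/
noncomputable def insertSecond (i : ι) : (List ι →₀ R) →ₗ[R] (List ι →₀ R) :=
  Finsupp.linearCombination R fun
    | [] => 0
    | y :: v => Finsupp.single (y :: i :: v) 1

@[simp] theorem insertSecond_nil (i : ι) (c : R) :
    insertSecond R i (Finsupp.single [] c) = 0 := by
  simp [insertSecond]

@[simp] theorem insertSecond_cons (i y : ι) (v : List ι) (c : R) :
    insertSecond R i (Finsupp.single (y :: v) c) = Finsupp.single (y :: i :: v) c := by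
  simp [insertSecond]

/-- The value of `totalSkewDer` on a word. -/
noncomputable def totalSkewDerWord (Q : Matrix ι ι R) : List ι → (List ι →₀ R)
  | [] => 0
  | i :: w => insertSecond R i (totalSkewDerWord Q w) +
      Finsupp.single (i :: w) (braidScalar Q i w)

/-- The component `Δ_{m-1,1}` of the coproduct in the basis of words, that is, the collection of
all skew derivations at once. The word `y v` in the target stands for the tensor `v ⊗ x_y`. -/
noncomputable def totalSkewDer (Q : Matrix ι ι R) : (List ι →₀ R) →ₗ[R] (List ι →₀ R) :=
  Finsupp.linearCombination R (totalSkewDerWord Q)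

/-- The operator `id ⊗ Δ_{m-2,1}`. The word `y i v` in the target stands for `x_i v ⊗ x_y`. -/
noncomputable def tailSkewDer (Q : Matrix ι ι R) : (List ι →₀ R) →ₗ[R] (List ι →₀ R) :=
  Finsupp.linearCombination R fun
    | [] => 0
    | i :: w => insertSecond R i (totalSkewDerWord Q w)

/-- The braided rotation `γ : x_i w ↦ χ_i(w) w x_i`. -/
noncomputable def braidRot (Q : Matrix ι ι R) : (List ι →₀ R) →ₗ[R] (List ι →₀ R) :=
  Finsupp.linearCombination R fun
    | [] => 0
    | i :: w => Finsupp.single (w ++ [i]) (braidScalar Q i w)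

/-- The braided rotation `γ'` of the tail of a word, twisted by the monodromy of the moved letter
with the first letter. -/
noncomputable def tailBraidRot (Q : Matrix ι ι R) : (List ι →₀ R) →ₗ[R] (List ι →₀ R) :=
  Finsupp.linearCombination R fun
    | [] => 0
    | [_] => 0
    | y :: i :: w => Finsupp.single (y :: (w ++ [i])) (braidScalar Q i w * (Q i y * Q y i))

@[simp] theorem totalSkewDer_nil (Q : Matrix ι ι R) (c : R) :
    totalSkewDer Q (Finsupp.single [] c) = 0 := by
  simp [totalSkewDer, totalSkewDerWord]

theorem totalSkewDer_cons (Q : Matrix ι ι R) (i : ι) (w : List ι) (c : R) :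
    totalSkewDer Q (Finsupp.single (i :: w) c) =
      insertSecond R i (totalSkewDer Q (Finsupp.single w c)) +
        Finsupp.single (i :: w) (c * braidScalar Q i w) := by
  simp [totalSkewDer, totalSkewDerWord]

@[simp] theorem tailSkewDer_nil (Q : Matrix ι ι R) (c : R) :
    tailSkewDer Q (Finsupp.single [] c) = 0 := by
  simp [tailSkewDer]

theorem tailSkewDer_cons (Q : Matrix ι ι R) (i : ι) (w : List ι) (c : R) :
    tailSkewDer Q (Finsupp.single (i :: w) c) =
      insertSecond R i (totalSkewDer Q (Finsupp.single w c)) := by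
  simp [tailSkewDer, totalSkewDer]

@[simp] theorem braidRot_nil (Q : Matrix ι ι R) (c : R) :
    braidRot Q (Finsupp.single [] c) = 0 := by
  simp [braidRot]

theorem braidRot_cons (Q : Matrix ι ι R) (i : ι) (w : List ι) (c : R) :
    braidRot Q (Finsupp.single (i :: w) c) =
      Finsupp.single (w ++ [i]) (c * braidScalar Q i w) := by
  simp [braidRot]

@[simp] theorem tailBraidRot_nil (Q : Matrix ι ι R) (c : R) :
    tailBraidRot Q (Finsupp.single [] c) = 0 := by
  simp [tailBraidRot]

@[simp] theorem tailBraidRot_singleton (Q : Matrix ι ι R) (y : ι) (c : R) :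
    tailBraidRot Q (Finsupp.single [y] c) = 0 := by
  simp [tailBraidRot]

theorem tailBraidRot_cons_cons (Q : Matrix ι ι R) (y i : ι) (w : List ι) (c : R) :
    tailBraidRot Q (Finsupp.single (y :: i :: w) c) =
      Finsupp.single (y :: (w ++ [i])) (c * (braidScalar Q i w * (Q i y * Q y i))) := by
  simp only [tailBraidRot, Finsupp.linearCombination_single, Finsupp.smul_single, smul_eq_mul]

end Operators

section Permutation

variable {ι R : Type*} [CommRing R]

theorem insertSecond_mem_supported_perm (i : ι) (w : List ι) {f : List ι →₀ R}
    (hf : f ∈ Finsupp.supported R R {v | v.Perm w}) :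
    insertSecond R i f ∈ Finsupp.supported R R {v | v.Perm (i :: w)} := by
  refine map_mem_of_mem_supported (fun v hv => ?_) hf
  match v, hv with
  | [], _ => simp
  | y :: v, hv =>
    rw [insertSecond_cons]
    exact Finsupp.single_mem_supported R _ ((List.Perm.swap i y v).trans (List.Perm.cons i hv))

theorem totalSkewDer_single_mem_supported_perm (Q : Matrix ι ι R) (w : List ι) (c : R) :
    totalSkewDer Q (Finsupp.single w c) ∈ Finsupp.supported R R {v | v.Perm w} := by
  induction w with
  | nil => simp
  | cons i w ih =>
    rw [totalSkewDer_cons]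
    exact add_mem (insertSecond_mem_supported_perm i w ih)
      (Finsupp.single_mem_supported R _ (List.Perm.refl _))

theorem tailSkewDer_single_mem_supported_perm (Q : Matrix ι ι R) (w : List ι) (c : R) :
    tailSkewDer Q (Finsupp.single w c) ∈ Finsupp.supported R R {v | v.Perm w} := by
  match w with
  | [] => simp
  | i :: w =>
    rw [tailSkewDer_cons]
    exact insertSecond_mem_supported_perm i w (totalSkewDer_single_mem_supported_perm Q w c)

theorem braidRot_single_mem_supported_perm (Q : Matrix ι ι R) (w : List ι) (c : R) :
    braidRot Q (Finsupp.single w c) ∈ Finsupp.supported R R {v | v.Perm w} := by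
  match w with
  | [] => simp
  | i :: w =>
    rw [braidRot_cons]
    exact Finsupp.single_mem_supported R _ (List.perm_append_singleton i w)

theorem tailBraidRot_single_mem_supported_perm (Q : Matrix ι ι R) (w : List ι) (c : R) :
    tailBraidRot Q (Finsupp.single w c) ∈ Finsupp.supported R R {v | v.Perm w} := by
  match w with
  | [] => simp
  | [_] => simp
  | y :: i :: w =>
    rw [tailBraidRot_cons_cons]
    exact Finsupp.single_mem_supported R _ ((List.perm_append_singleton i w).cons y)

end Permutation

section KeyIdentity

variable {ι R : Type*} [CommRing R]

/-- Right multiplication of the first tensor factor by `x_i` in the braided tensor product, in the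
encoding of `totalSkewDer`: `(v ⊗ x_y) (x_i ⊗ 1) = q_{yi} v x_i ⊗ x_y`. -/
noncomputable def appendLetter (Q : Matrix ι ι R) (i : ι) : (List ι →₀ R) →ₗ[R] (List ι →₀ R) :=
  Finsupp.linearCombination R fun
    | [] => 0
    | y :: v => Finsupp.single (y :: (v ++ [i])) (Q y i)

@[simp] theorem appendLetter_nil (Q : Matrix ι ι R) (i : ι) (c : R) :
    appendLetter Q i (Finsupp.single [] c) = 0 := by
  simp [appendLetter]

theorem appendLetter_cons (Q : Matrix ι ι R) (i y : ι) (v : List ι) (c : R) :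
    appendLetter Q i (Finsupp.single (y :: v) c) =
      Finsupp.single (y :: (v ++ [i])) (c * Q y i) := by
  simp [appendLetter]

theorem insertSecond_appendLetter (Q : Matrix ι ι R) (i j : ι) (f : List ι →₀ R) :
    insertSecond R j (appendLetter Q i f) = appendLetter Q i (insertSecond R j f) := by
  induction f using Finsupp.induction_linear with
  | zero => simp
  | add f g hf hg => rw [map_add, map_add, hf, hg, map_add, map_add]
  | single w c =>
    match w with
    | [] => simp
    | y :: v => simp only [appendLetter_cons, insertSecond_cons, List.cons_append]

theorem totalSkewDer_append_singleton (Q : Matrix ι ι R) (u : List ι) (i : ι) (c : R) :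
    totalSkewDer Q (Finsupp.single (u ++ [i]) c) =
      Finsupp.single (i :: u) c + appendLetter Q i (totalSkewDer Q (Finsupp.single u c)) := by
  induction u with
  | nil => simp [totalSkewDer_cons]
  | cons j u ih =>
    rw [List.cons_append, totalSkewDer_cons, ih, map_add, totalSkewDer_cons, map_add,
      insertSecond_appendLetter, insertSecond_cons, appendLetter_cons]
    simp [add_assoc, mul_assoc]

theorem tailBraidRot_insertSecond (Q : Matrix ι ι R) (i : ι) (u : List ι) {f : List ι →₀ R}
    (hf : f ∈ Finsupp.supported R R {v | v.Perm u}) :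
    tailBraidRot Q (insertSecond R i f) = braidScalar Q i u • appendLetter Q i f := by
  refine eqOn_supported (F := tailBraidRot Q ∘ₗ insertSecond R i)
    (G := braidScalar Q i u • appendLetter Q i) (fun v hv => ?_) hf
  match v, hv with
  | [], _ => simp
  | y :: v, hv =>
    rw [LinearMap.comp_apply, insertSecond_cons, tailBraidRot_cons_cons, LinearMap.smul_apply,
      appendLetter_cons, Finsupp.smul_single, ← braidScalar_perm Q i hv, braidScalar_cons,
      smul_eq_mul]
    congr 1
    ring

theorem totalSkewDer_sub_braidRot (Q : Matrix ι ι R) (f : List ι →₀ R) :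
    totalSkewDer Q (f - braidRot Q f) =
      tailSkewDer Q f - tailBraidRot Q (tailSkewDer Q f) := by
  induction f using Finsupp.induction_linear with
  | zero => simp
  | add f g hf hg =>
    rw [map_add, add_sub_add_comm, map_add, hf, hg, map_add, map_add, add_sub_add_comm]
  | single w c =>
    match w with
    | [] => simp
    | i :: u =>
      have rotated : totalSkewDer Q (braidRot Q (Finsupp.single (i :: u) c)) =
          Finsupp.single (i :: u) (c * braidScalar Q i u) +
            tailBraidRot Q (insertSecond R i (totalSkewDer Q (Finsupp.single u c))) := by
        rw [braidRot_cons, totalSkewDer_append_singleton,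
          tailBraidRot_insertSecond Q i u (totalSkewDer_single_mem_supported_perm Q u c), mul_comm,
          ← smul_eq_mul (braidScalar Q i u) c, ← Finsupp.smul_single, ← Finsupp.smul_single,
          map_smul, map_smul]
      rw [map_sub, rotated, totalSkewDer_cons, tailSkewDer_cons]
      abel

end KeyIdentity

section Powers

variable {ι R : Type*} [CommRing R]

open scoped Matrix

/-- The product of the scalars `q_{ab}` over all ordered pairs of different positions of a word;
this is the scalar by which the full twist acts on the word. -/
def monodromy (Q : Matrix ι ι R) : List ι → R
  | [] => 1
  | i :: w => braidScalar Q i w * braidScalar Qᵀ i w * monodromy Q w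

/-- The scalar of the braiding `u ⊗ v ↦ v ⊗ u` of two words. -/
def wordBraidScalar (Q : Matrix ι ι R) (u v : List ι) : R :=
  (u.map fun a => braidScalar Q a v).prod

theorem wordBraidScalar_nil_right (Q : Matrix ι ι R) (u : List ι) :
    wordBraidScalar Q u [] = 1 := by
  simp [wordBraidScalar]

theorem wordBraidScalar_append_singleton (Q : Matrix ι ι R) (u v : List ι) (i : ι) :
    wordBraidScalar Q u (v ++ [i]) = wordBraidScalar Q u v * braidScalar Qᵀ i u := by
  simp only [wordBraidScalar, braidScalar_append, braidScalar_cons, braidScalar_nil, mul_one,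
    List.prod_map_mul]
  rfl

theorem wordBraidScalar_cons (Q : Matrix ι ι R) (i : ι) (u v : List ι) :
    wordBraidScalar Q (i :: u) v = braidScalar Q i v * wordBraidScalar Q u v := by
  simp [wordBraidScalar]

theorem braidRot_pow_append (Q : Matrix ι ι R) (u v : List ι) (c : R) :
    (braidRot Q ^ u.length) (Finsupp.single (u ++ v) c) =
      Finsupp.single (v ++ u) (c * (monodromy Q u * wordBraidScalar Q u v)) := by
  induction u generalizing v c with
  | nil => simp [monodromy, wordBraidScalar]
  | cons i u ih =>
    rw [List.length_cons, pow_succ, Module.End.mul_apply, List.cons_append, braidRot_cons,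
      List.append_assoc, ih, braidScalar_append, wordBraidScalar_append_singleton,
      wordBraidScalar_cons, monodromy, List.append_assoc, List.singleton_append]
    congr 1
    ring

theorem braidRot_pow_length (Q : Matrix ι ι R) (w : List ι) (c : R) :
    (braidRot Q ^ w.length) (Finsupp.single w c) = Finsupp.single w (c * monodromy Q w) := by
  simpa [wordBraidScalar_nil_right] using braidRot_pow_append Q w [] c

theorem tailBraidRot_pow_cons_append (Q : Matrix ι ι R) (y : ι) (u v : List ι) (c : R) :
    (tailBraidRot Q ^ u.length) (Finsupp.single (y :: (u ++ v)) c) =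
      Finsupp.single (y :: (v ++ u))
        (c * (monodromy Q u * wordBraidScalar Q u v *
          (braidScalar Qᵀ y u * braidScalar Q y u))) := by
  induction u generalizing v c with
  | nil => simp [monodromy, wordBraidScalar]
  | cons i u ih =>
    rw [List.length_cons, pow_succ, Module.End.mul_apply, List.cons_append,
      tailBraidRot_cons_cons, List.append_assoc, ih, braidScalar_append,
      wordBraidScalar_append_singleton, wordBraidScalar_cons, monodromy, List.append_assoc,
      List.singleton_append, braidScalar_cons, braidScalar_cons, Matrix.transpose_apply]
    congr 1
    ring

theorem tailBraidRot_pow_length (Q : Matrix ι ι R) (y : ι) (w : List ι) (c : R) :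
    (tailBraidRot Q ^ w.length) (Finsupp.single (y :: w) c) =
      Finsupp.single (y :: w) (c * monodromy Q (y :: w)) := by
  have h := tailBraidRot_pow_cons_append Q y w [] c
  rw [List.append_nil, List.nil_append, wordBraidScalar_nil_right] at h
  rw [h, monodromy]
  congr 1
  ring

end Powers

section Components

variable {ι R : Type*} [DecidableEq ι] [CommRing R]

/-- The words of degree `m ∈ ℕ₀^ι`, in which each letter `i` occurs `m i` times. -/
def wordsOf (m : ι → ℕ) : Set (List ι) := {w | ∀ i, w.count i = m i}

theorem mem_wordsOf {m : ι → ℕ} {w : List ι} : w ∈ wordsOf m ↔ ∀ i, w.count i = m i :=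
  Iff.rfl

theorem mem_wordsOf_count (w : List ι) : w ∈ wordsOf fun i => w.count i := fun _ => rfl

theorem length_of_mem_wordsOf [Fintype ι] {m : ι → ℕ} {w : List ι} (hw : w ∈ wordsOf m) :
    w.length = ∑ i, m i := by
  rw [← Finset.sum_congr rfl fun i _ => hw i]
  simpa using (Multiset.sum_count_eq_card (s := Finset.univ) (m := (w : Multiset ι))
    fun a _ => Finset.mem_univ a).symm

theorem ne_nil_of_mem_wordsOf [Fintype ι] {m : ι → ℕ} (hm : 0 < ∑ i, m i) {w : List ι}
    (hw : w ∈ wordsOf m) : w ≠ [] := by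
  rw [← length_of_mem_wordsOf hw] at hm
  exact List.ne_nil_of_length_pos hm

theorem mem_wordsOf_iff_of_perm {m : ι → ℕ} {w w' : List ι} (h : w.Perm w') :
    w ∈ wordsOf m ↔ w' ∈ wordsOf m := by
  simp only [mem_wordsOf, h.count_eq]

theorem cons_mem_wordsOf {m : ι → ℕ} {i : ι} {w : List ι} :
    i :: w ∈ wordsOf m ↔ m i ≠ 0 ∧ w ∈ wordsOf (m - Pi.single i 1) := by
  simp only [mem_wordsOf, List.count_cons, beq_iff_eq, Pi.sub_apply]
  constructor
  · refine fun h => ⟨fun h0 => by simpa [h0] using h i, fun j => ?_⟩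
    obtain rfl | hj := eq_or_ne i j
    · simp [← h i]
    · simp [← h j, hj, hj.symm]
  · rintro ⟨hi, h⟩ j
    obtain rfl | hj := eq_or_ne i j
    · simp only [h i, Pi.single_eq_same, if_true]
      omega
    · simp [h j, hj, hj.symm]

theorem sum_sub_single_add_one [Fintype ι] {m : ι → ℕ} {i : ι} (hi : m i ≠ 0) :
    ∑ j, (m - Pi.single i 1 : ι → ℕ) j + 1 = ∑ j, m j := by
  have h_le : Pi.single i 1 ≤ m := fun j => by
    obtain rfl | hj := eq_or_ne j i <;> simp [*, Nat.one_le_iff_ne_zero]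
  conv_rhs => rw [← tsub_add_cancel_of_le h_le]
  simp [Finset.sum_add_distrib]

variable (R) in
/-- The combinations of words of degree `m`. -/
noncomputable abbrev component (m : ι → ℕ) : Submodule R (List ι →₀ R) :=
  Finsupp.supported R R (wordsOf m)

theorem map_mem_component {F : (List ι →₀ R) →ₗ[R] (List ι →₀ R)}
    (hF : ∀ w c, F (Finsupp.single w c) ∈ Finsupp.supported R R {v | v.Perm w}) {m : ι → ℕ}
    {f : List ι →₀ R} (hf : f ∈ component R m) : F f ∈ component R m :=
  map_mem_of_mem_supported (s := wordsOf m) (fun w hw => Finsupp.supported_mono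
    (fun _ hv => (mem_wordsOf_iff_of_perm hv).2 hw) (hF w 1)) hf

/-- Injectivity of `Δ_{m-1,1}` on the component of degree `m`. -/
def InjectiveAt (Q : Matrix ι ι R) (m : ι → ℕ) : Prop :=
  ∀ f ∈ component R m, totalSkewDer Q f = 0 → f = 0

end Components

section RemoveHead

variable {ι R : Type*} [CommRing R]

variable (R) in
/-- The removal of the first letter of a word, if this letter is `i`; other words go to `0`. -/
noncomputable def removeHead (i : ι) : (List ι →₀ R) →ₗ[R] (List ι →₀ R) :=
  Finsupp.lcomapDomain (i :: ·) List.cons_injective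

theorem removeHead_apply (i : ι) (f : List ι →₀ R) (w : List ι) :
    removeHead R i f w = f (i :: w) := rfl

@[simp] theorem removeHead_nil (i : ι) (c : R) : removeHead R i (Finsupp.single [] c) = 0 := by
  ext w
  simp [removeHead_apply]

theorem removeHead_cons [DecidableEq ι] (i j : ι) (w : List ι) (c : R) :
    removeHead R i (Finsupp.single (j :: w) c) = if j = i then Finsupp.single w c else 0 := by
  ext v
  rw [removeHead_apply]
  split_ifs with h
  · simp [Finsupp.single_apply, h]
  · simp [h]

theorem eq_zero_of_removeHead_eq_zero {f : List ι →₀ R} (h_nil : f [] = 0)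
    (h : ∀ i, removeHead R i f = 0) : f = 0 := by
  ext w
  match w with
  | [] => exact h_nil
  | i :: w => rw [← removeHead_apply, h]; rfl

theorem insertSecond_apply [DecidableEq ι] (i l y : ι) (v : List ι) (f : List ι →₀ R) :
    insertSecond R i f (y :: l :: v) = if i = l then f (y :: v) else 0 := by
  induction f using Finsupp.induction_linear with
  | zero => simp
  | add f g hf hg => rw [map_add, Finsupp.add_apply, hf, hg]; split_ifs <;> simp
  | single w c =>
    match w with
    | [] => simp
    | z :: u => by_cases h : i = l <;> simp [h, Finsupp.single_apply]

theorem totalSkewDer_apply_nil (Q : Matrix ι ι R) (f : List ι →₀ R) :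
    totalSkewDer Q f [] = 0 := by
  induction f using Finsupp.induction_linear with
  | zero => simp
  | add f g hf hg => rw [map_add, Finsupp.add_apply, hf, hg, add_zero]
  | single w c =>
    obtain rfl | hw := eq_or_ne w []
    · simp
    · exact apply_eq_zero_of_mem_supported (totalSkewDer_single_mem_supported_perm Q w c)
        fun h : [].Perm w => hw (List.nil_perm.1 h)

theorem tailSkewDer_apply (Q : Matrix ι ι R) (y i : ι) (v : List ι) (f : List ι →₀ R) :
    tailSkewDer Q f (y :: i :: v) = totalSkewDer Q (removeHead R i f) (y :: v) := by
  classical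
  induction f using Finsupp.induction_linear with
  | zero => simp
  | add f g hf hg => rw [map_add, map_add, map_add, Finsupp.add_apply, hf, hg, Finsupp.add_apply]
  | single w c =>
    match w with
    | [] => simp
    | l :: w =>
      rw [tailSkewDer_cons, insertSecond_apply, removeHead_cons]
      split_ifs <;> simp

theorem totalSkewDer_removeHead_eq_zero {Q : Matrix ι ι R} {f : List ι →₀ R}
    (h : tailSkewDer Q f = 0) (i : ι) : totalSkewDer Q (removeHead R i f) = 0 := by
  ext w
  match w with
  | [] => exact totalSkewDer_apply_nil Q _
  | y :: v => rw [← tailSkewDer_apply, h]; rfl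

theorem removeHead_mem_component [DecidableEq ι] {m : ι → ℕ} {f : List ι →₀ R}
    (hf : f ∈ component R m) (i : ι) :
    removeHead R i f ∈ component R (m - Pi.single i 1) := by
  intro w hw
  refine (cons_mem_wordsOf.1 (hf ?_ : i :: w ∈ wordsOf m)).2
  rwa [Finset.mem_coe, Finsupp.mem_support_iff, removeHead_apply,
    ← Finsupp.mem_support_iff] at hw

theorem removeHead_eq_zero [DecidableEq ι] {m : ι → ℕ} {f : List ι →₀ R}
    (hf : f ∈ component R m) {i : ι} (hi : m i = 0) : removeHead R i f = 0 := by
  ext w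
  rw [removeHead_apply]
  exact apply_eq_zero_of_mem_supported hf fun h => (cons_mem_wordsOf.1 h).1 hi

theorem tailSkewDer_injective [Fintype ι] [DecidableEq ι] {Q : Matrix ι ι R} {m : ι → ℕ}
    (h : ∀ m', ∑ i, m' i + 1 = ∑ i, m i → InjectiveAt Q m') (hm : 0 < ∑ i, m i)
    {f : List ι →₀ R} (hf : f ∈ component R m) (h0 : tailSkewDer Q f = 0) : f = 0 := by
  refine eq_zero_of_removeHead_eq_zero
    (apply_eq_zero_of_mem_supported hf fun hw => ne_nil_of_mem_wordsOf hm hw rfl) fun i => ?_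
  by_cases hi : m i = 0
  · exact removeHead_eq_zero hf hi
  · exact h _ (sum_sub_single_add_one hi) _ (removeHead_mem_component hf i)
      (totalSkewDer_removeHead_eq_zero h0 i)

end RemoveHead

/-! ### `B(V) = T(V)` in terms of `Δ_{m-1,1}` -/

section Coordinates

variable {k : Type*} [Field k] {n : ℕ} {V : Type*} [AddCommGroup V] [Module k V]
  (x : Module.Basis (Fin n) k V) (Q : Matrix (Fin n) (Fin n) k)

theorem scaling_word (i : Fin n) (w : List (Fin n)) :
    scaling x Q i (word x w) = braidScalar Q i w • word x w := by
  induction w with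
  | nil => simp
  | cons l w ih => simp [word_cons, scaling_ι, ih, smul_smul, mul_comm]

/-- The combination of monomials `x_w` with given coefficients. -/
noncomputable def wordSum : (List (Fin n) →₀ k) ≃ₗ[k] TensorAlgebra k V :=
  (wordBasis x).repr.symm

@[simp] theorem wordSum_single (w : List (Fin n)) (c : k) :
    wordSum x (Finsupp.single w c) = c • word x w := by
  rw [wordSum, Module.Basis.repr_symm_single, wordBasis_apply]

theorem wordCoeff_wordSum (w : List (Fin n)) (f : List (Fin n) →₀ k) :
    wordCoeff x w (wordSum x f) = f w := by
  simp [wordCoeff, wordSum]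

theorem wordSum_removeHead_insertSecond (i j : Fin n) (f : List (Fin n) →₀ k) :
    wordSum x (removeHead k j (insertSecond k i f)) =
      TensorAlgebra.ι k (x i) * wordSum x (removeHead k j f) := by
  induction f using Finsupp.induction_linear with
  | zero => simp
  | add f g hf hg => simp only [map_add, mul_add, hf, hg]
  | single w c =>
    match w with
    | [] => simp
    | y :: v =>
      rw [insertSecond_cons, removeHead_cons, removeHead_cons]
      split_ifs <;> simp [word_cons]

theorem skewDer_wordSum (j : Fin n) (f : List (Fin n) →₀ k) :
    skewDer x Q j (wordSum x f) = wordSum x (removeHead k j (totalSkewDer Q f)) := by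
  induction f using Finsupp.induction_linear with
  | zero => simp
  | add f g hf hg => simp only [map_add, hf, hg]
  | single w c =>
    induction w with
    | nil => simp
    | cons i w ih =>
      rw [wordSum_single, map_smul] at ih
      rw [wordSum_single, map_smul, word_cons, skewDer_ι_mul, smul_add, ← mul_smul_comm, ih,
        totalSkewDer_cons, map_add, map_add, wordSum_removeHead_insertSecond, removeHead_cons]
      split_ifs
      · rw [wordSum_single, scaling_word, smul_smul]
      · rw [smul_zero, map_zero]

theorem totalSkewDer_eq_zero_iff (f : List (Fin n) →₀ k) :
    totalSkewDer Q f = 0 ↔ ∀ j, skewDer x Q j (wordSum x f) = 0 := by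
  simp only [skewDer_wordSum, LinearEquiv.map_eq_zero_iff]
  exact ⟨fun h j => by rw [h, map_zero],
    eq_zero_of_removeHead_eq_zero (totalSkewDer_apply_nil Q f)⟩

theorem nicholsIsFree_iff_totalSkewDer : NicholsIsFree x Q ↔
    ∀ f : List (Fin n) →₀ k, f [] = 0 → totalSkewDer Q f = 0 → f = 0 := by
  rw [nicholsIsFree_iff_radical_eq_bot, radical_eq_bot_iff, (wordSum x).surjective.forall]
  simp only [wordCoeff_wordSum, ← totalSkewDer_eq_zero_iff, LinearEquiv.map_eq_zero_iff]

end Coordinates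

section Graded

variable {R ι : Type*} [CommRing R] [DecidableEq ι]

open Classical in
theorem totalSkewDer_filter (Q : Matrix ι ι R) (m : ι → ℕ) (f : List ι →₀ R) :
    totalSkewDer Q (f.filter (· ∈ wordsOf m)) = (totalSkewDer Q f).filter (· ∈ wordsOf m) := by
  induction f using Finsupp.induction_linear with
  | zero => rw [map_zero, Finsupp.filter_zero, map_zero]
  | add f g hf hg => rw [Finsupp.filter_add, map_add, hf, hg, map_add, Finsupp.filter_add]
  | single w c =>
    have perm_of_ne_zero {v} (hv : totalSkewDer Q (Finsupp.single w c) v ≠ 0) : v.Perm w :=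
      totalSkewDer_single_mem_supported_perm Q w c (Finsupp.mem_support_iff.2 hv)
    by_cases hw : w ∈ wordsOf m
    · rw [Finsupp.filter_single_of_pos _ hw, eq_comm, Finsupp.filter_eq_self_iff]
      exact fun v hv => (mem_wordsOf_iff_of_perm (perm_of_ne_zero hv)).2 hw
    · rw [Finsupp.filter_single_of_neg _ hw, map_zero, eq_comm, Finsupp.filter_eq_zero_iff]
      intro v hv
      by_contra hne
      exact hw ((mem_wordsOf_iff_of_perm (perm_of_ne_zero hne)).1 hv)

theorem forall_injectiveAt_iff [Fintype ι] (Q : Matrix ι ι R) :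
    (∀ m, 0 < ∑ i, m i → InjectiveAt Q m) ↔
      ∀ f : List ι →₀ R, f [] = 0 → totalSkewDer Q f = 0 → f = 0 := by
  classical
  constructor
  · intro h f h0 hd
    ext w
    obtain rfl | hw := eq_or_ne w []
    · exact h0
    have hwm := mem_wordsOf_count w
    have hpos : 0 < ∑ i, w.count i := by
      rw [← length_of_mem_wordsOf hwm]
      exact List.length_pos_iff.2 hw
    have h_filter : f.filter (· ∈ wordsOf fun i => w.count i) = 0 := by
      refine h _ hpos _ (fun v hv => ?_) (by rw [totalSkewDer_filter, hd, Finsupp.filter_zero])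
      rw [Finset.mem_coe, Finsupp.support_filter, Finset.mem_filter] at hv
      exact hv.2
    rw [← Finsupp.filter_apply_pos (· ∈ wordsOf fun i => w.count i) f hwm, h_filter]
  · exact fun h m hm f hf hd =>
      h f (apply_eq_zero_of_mem_supported hf fun hw => ne_nil_of_mem_wordsOf hm hw rfl) hd

end Graded

theorem nicholsIsFree_iff_injectiveAt {k : Type*} [Field k] {n : ℕ} {V : Type*}
    [AddCommGroup V] [Module k V] (x : Module.Basis (Fin n) k V) (Q : Matrix (Fin n) (Fin n) k) :
    NicholsIsFree x Q ↔ ∀ m : Fin n → ℕ, 0 < totalDegree m → InjectiveAt Q m := by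
  rw [nicholsIsFree_iff_totalSkewDer, ← forall_injectiveAt_iff]
  rfl

/-! ### Dimensions of spaces of fixed vectors -/

section Orbits

open Finset

variable {α : Type*} {σ : Equiv.Perm α} {N : ℕ}

/- The witness is `w ↦ ⌊(∑ s, s κ(σ ^ s w)) / N⌋`: the numerator grows by exactly `N κ(w)` when `w`
is replaced by `σ w`. -/
theorem exists_add_eq_of_sum_range_pow_eq_zero (hN : 0 < N) (hσ : σ ^ N = 1) {κ : α → ℤ}
    (hκ : ∀ w, ∑ s ∈ range N, κ ((σ ^ s) w) = 0) :
    ∃ φ : α → ℤ, ∀ w, φ (σ w) = κ w + φ w := by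
  let F : α → ℤ := fun w => ∑ s ∈ range N, (s : ℤ) * κ ((σ ^ s) w)
  have apply_add : ∀ s w, κ ((σ ^ s) (σ w)) = κ ((σ ^ (s + 1)) w) := fun s w => by
    rw [pow_succ, Equiv.Perm.mul_apply]
  have hF : ∀ w, F (σ w) = F w + N * κ w := by
    intro w
    have shifted := hκ (σ w)
    have telescope := (sum_range_succ (fun s => (s : ℤ) * κ ((σ ^ s) w)) N).symm.trans
      (sum_range_succ' _ N)
    simp only [Nat.cast_add, Nat.cast_one, add_mul, one_mul, sum_add_distrib, Nat.cast_zero,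
      zero_mul, add_zero, hσ, Equiv.Perm.one_apply] at telescope
    simp only [apply_add] at shifted
    simp only [F, apply_add, telescope, shifted, add_zero]
  refine ⟨fun w => F w / N, fun w => ?_⟩
  beta_reduce
  rw [hF, Int.add_mul_ediv_left _ _ (Int.natCast_ne_zero.2 hN.ne'), add_comm]

theorem mul_card_quotient_sameCycle [Finite α] (hN : 0 < N) (hσ : σ ^ N = 1) :
    N * Nat.card (Quotient (Equiv.Perm.SameCycle.setoid σ)) =
      ∑ s ∈ range N, {w | (σ ^ s) w = w}.ncard := by
  classical
  have := Fintype.ofFinite α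
  have := NeZero.of_pos hN
  let ρ : ZMod N →+ Additive (Equiv.Perm α) :=
    ZMod.lift N ⟨zmultiplesHom _ (Additive.ofMul σ), by simp [← ofMul_pow, hσ]⟩
  have hρ : ∀ z : ℤ, (ρ z).toMul = σ ^ z := fun z => by simp [ρ]
  let _ : MulAction (Multiplicative (ZMod N)) α :=
    MulAction.compHom α (AddMonoidHom.toMultiplicativeLeft ρ)
  have smul_intCast : ∀ (z : ℤ) (w : α),
      Multiplicative.ofAdd (z : ZMod N) • w = (σ ^ z) w := fun z w =>
    congrArg (· w) (hρ z)
  have orbitRel_eq : MulAction.orbitRel (Multiplicative (ZMod N)) α =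
      Equiv.Perm.SameCycle.setoid σ := by
    ext a b
    rw [MulAction.orbitRel_apply, Equiv.Perm.SameCycle.setoid]
    refine Iff.trans ⟨?_, ?_⟩ (Equiv.Perm.sameCycle_comm (f := σ) (x := b) (y := a))
    · rintro ⟨g, rfl⟩
      obtain ⟨z, hz⟩ := ZMod.intCast_surjective g.toAdd
      exact ⟨z, by rw [← smul_intCast, hz]; rfl⟩
    · rintro ⟨z, rfl⟩
      exact ⟨_, smul_intCast z b⟩
  have burnside := MulAction.sum_card_fixedBy_eq_card_orbits_mul_card_group
    (Multiplicative (ZMod N)) α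
  rw [Fintype.card_multiplicative, ZMod.card, ← Nat.card_eq_fintype_card, mul_comm] at burnside
  rw [← orbitRel_eq, ← burnside]
  refine sum_nbij' (fun g => ZMod.val g.toAdd) (fun s => Multiplicative.ofAdd (s : ZMod N))
    (fun g _ => mem_range.2 (ZMod.val_lt _)) (fun _ _ => mem_univ _)
    (fun g _ => congrArg Multiplicative.ofAdd (ZMod.natCast_zmod_val _))
    (fun s hs => ZMod.val_cast_of_lt (mem_range.1 hs)) fun g _ => ?_
  rw [← Nat.card_eq_fintype_card, ← Nat.card_coe_set_eq]
  have smul_eq : ∀ w : α, g • w = (σ ^ ZMod.val g.toAdd) w := fun w => by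
    rw [← zpow_natCast, ← smul_intCast, Int.cast_natCast, ZMod.natCast_zmod_val, ofAdd_toAdd]
  refine Nat.card_congr (Equiv.subtypeEquivRight fun w => ?_)
  rw [MulAction.mem_fixedBy, smul_eq]
  rfl

/-- The functions which are constant on the orbits of a permutation. -/
def invariants (k : Type*) [Field k] (σ : Equiv.Perm α) : Submodule k (α → k) :=
  LinearMap.eqLocus (LinearMap.funLeft k k σ) LinearMap.id

theorem mem_invariants {k : Type*} [Field k] {f : α → k} :
    f ∈ invariants k σ ↔ ∀ w, f (σ w) = f w :=
  funext_iff

theorem finrank_invariants [Finite α] (k : Type*) [Field k] (σ : Equiv.Perm α) :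
    Module.finrank k (invariants k σ) =
      Nat.card (Quotient (Equiv.Perm.SameCycle.setoid σ)) := by
  classical
  have := Fintype.ofFinite α
  let mk : α → Quotient (Equiv.Perm.SameCycle.setoid σ) := Quotient.mk _
  have range_eq : LinearMap.range (LinearMap.funLeft k k mk) = invariants k σ := by
    ext f
    rw [mem_invariants]
    constructor
    · rintro ⟨g, rfl⟩ w
      exact congrArg g (Quotient.sound (Equiv.Perm.sameCycle_apply_left.2 .rfl))
    · intro hf
      refine ⟨Quotient.lift f ?_, rfl⟩
      intro a b hab
      obtain ⟨r, rfl⟩ := Equiv.Perm.SameCycle.exists_nat_pow_eq hab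
      have h := Function.Semiconj.iterate_right (gb := id) hf r a
      rw [Function.iterate_id, id, Equiv.Perm.iterate_eq_pow] at h
      exact h.symm
  rw [← range_eq, LinearMap.finrank_range_of_inj
    (LinearMap.funLeft_injective_of_surjective k k mk Quotient.mk_surjective),
    Module.finrank_fintype_fun_eq_card, Nat.card_eq_fintype_card]

end Orbits

section FixedSpace

open Finset

variable {k : Type*} [Field k] {q : k}

theorem zpow_eq_one_iff_of_not_root (hq : ∀ N : ℕ, 0 < N → q ^ N ≠ 1) (a : ℤ) :
    q ^ a = 1 ↔ a = 0 := by
  refine ⟨fun h => ?_, fun h => by simp [h]⟩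
  by_contra hne
  refine hq a.natAbs (Int.natAbs_pos.2 hne) ?_
  rcases Int.natAbs_eq a with e | e
  · rwa [e, zpow_natCast] at h
  · rwa [e, zpow_neg, zpow_natCast, inv_eq_one] at h

variable {X : Type*} {s : Set X} {σ : Equiv.Perm X} {N : ℕ} {κ : X → ℤ}
  {F : (X →₀ k) →ₗ[k] (X →₀ k)}

theorem pow_apply_single_of_apply_single (hq0 : q ≠ 0) (hσ : ∀ w, σ w ∈ s ↔ w ∈ s)
    (hF : ∀ w ∈ s, F (Finsupp.single w 1) = Finsupp.single (σ w) (q ^ κ w)) (t : ℕ) {w : X}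
    (hw : w ∈ s) : (F ^ t) (Finsupp.single w 1) =
      Finsupp.single ((σ ^ t) w) (q ^ ∑ r ∈ range t, κ ((σ ^ r) w)) := by
  induction t generalizing w with
  | zero => simp
  | succ t ih =>
    rw [pow_succ, Module.End.mul_apply, hF w hw, ← Finsupp.smul_single_one, map_smul,
      ih ((hσ w).2 hw), Finsupp.smul_single, smul_eq_mul, sum_range_succ', zpow_add₀ hq0, mul_comm]
    simp only [pow_succ, Equiv.Perm.mul_apply, pow_zero, Equiv.Perm.one_apply]

theorem apply_perm_of_apply_single
    (hF : ∀ w ∈ s, F (Finsupp.single w 1) = Finsupp.single (σ w) (q ^ κ w)) {f : X →₀ k}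
    (hf : f ∈ Finsupp.supported k k s) (w : X) : F f (σ w) = q ^ κ w * f w := by
  classical
  refine eqOn_supported (F := Finsupp.lapply (σ w) ∘ₗ F) (G := q ^ κ w • Finsupp.lapply w)
    (fun u hu => ?_) hf
  rw [LinearMap.comp_apply, hF u hu, LinearMap.smul_apply, Finsupp.lapply_apply,
    Finsupp.lapply_apply, Finsupp.single_apply, Finsupp.single_apply, smul_eq_mul, mul_ite,
    mul_one, mul_zero]
  simp only [σ.injective.eq_iff]
  split_ifs with h
  · rw [h]
  · rfl

theorem apply_eq_self_iff_of_apply_single (hσ : ∀ w, σ w ∈ s ↔ w ∈ s)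
    (hF : ∀ w ∈ s, F (Finsupp.single w 1) = Finsupp.single (σ w) (q ^ κ w)) {f : X →₀ k}
    (hf : f ∈ Finsupp.supported k k s) :
    F f = f ↔ ∀ w ∈ s, f (σ w) = q ^ κ w * f w := by
  refine ⟨fun h w _ => ?_, fun h => ?_⟩
  · rw [← apply_perm_of_apply_single hF hf, h]
  · ext u
    obtain ⟨w, rfl⟩ := σ.surjective u
    rw [apply_perm_of_apply_single hF hf]
    by_cases hw : w ∈ s
    · exact (h w hw).symm
    · rw [apply_eq_zero_of_mem_supported hf hw,
        apply_eq_zero_of_mem_supported hf (mt (hσ w).1 hw), mul_zero]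

theorem finrank_supported_inf_ker_id_sub [Finite s] (hq0 : q ≠ 0)
    (hσ : ∀ w, σ w ∈ s ↔ w ∈ s)
    (hF : ∀ w ∈ s, F (Finsupp.single w 1) = Finsupp.single (σ w) (q ^ κ w)) {φ : s → ℤ}
    (hφ : ∀ w, φ (σ.subtypePerm hσ w) = κ w + φ w) :
    Module.finrank k ↥(Finsupp.supported k k s ⊓ LinearMap.ker (LinearMap.id - F)) =
      Module.finrank k (invariants k (σ.subtypePerm hσ)) := by
  let untwist : Finsupp.supported k k s ≃ₗ[k] (s → k) :=
    Finsupp.supportedEquivFinsupp s ≪≫ₗ Finsupp.linearEquivFunOnFinite k k s ≪≫ₗ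
      LinearEquiv.piCongrRight fun w =>
        LinearEquiv.smulOfNeZero k k (q ^ (-φ w)) (zpow_ne_zero _ hq0)
  have untwist_apply : ∀ (v : Finsupp.supported k k s) (w : s),
      untwist v w = q ^ (-φ w) * v.1 w.1 := fun _ _ => rfl
  have fixed_iff : ∀ v : Finsupp.supported k k s,
      v.1 ∈ LinearMap.ker (LinearMap.id - F) ↔ untwist v ∈ invariants k (σ.subtypePerm hσ) := by
    intro v
    rw [LinearMap.mem_ker, LinearMap.sub_apply, sub_eq_zero, LinearMap.id_apply, eq_comm,
      apply_eq_self_iff_of_apply_single hσ hF v.2, mem_invariants, Subtype.forall]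
    refine forall₂_congr fun w hw => ?_
    rw [untwist_apply, untwist_apply, hφ, neg_add, zpow_add₀ hq0, zpow_neg q (κ _)]
    simp only [Equiv.Perm.subtypePerm_apply]
    field_simp
  have map_eq : ((Finsupp.supported k k s ⊓ LinearMap.ker (LinearMap.id - F)).submoduleOf
      (Finsupp.supported k k s)).map untwist.toLinearMap = invariants k (σ.subtypePerm hσ) := by
    ext g
    obtain ⟨v, rfl⟩ := untwist.surjective g
    rw [← fixed_iff]
    refine (Submodule.mem_map_equiv _).trans ?_
    rw [untwist.symm_apply_apply]
    exact and_iff_right v.2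
  rw [← map_eq, LinearEquiv.finrank_map_eq untwist,
    (Submodule.submoduleOfEquivOfLe inf_le_left).finrank_eq]

theorem mul_finrank_supported_inf_ker_id_sub [Finite s] (hq0 : q ≠ 0)
    (hq : ∀ N : ℕ, 0 < N → q ^ N ≠ 1) (hN : 0 < N) (hσ : ∀ w, σ w ∈ s ↔ w ∈ s)
    (hσN : ∀ w ∈ s, (σ ^ N) w = w)
    (hF : ∀ w ∈ s, F (Finsupp.single w 1) = Finsupp.single (σ w) (q ^ κ w))
    (hFN : ∀ w ∈ s, (F ^ N) (Finsupp.single w 1) = Finsupp.single w 1) :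
    N * Module.finrank k ↥(Finsupp.supported k k s ⊓ LinearMap.ker (LinearMap.id - F)) =
      ∑ t ∈ range N, {w ∈ s | (σ ^ t) w = w}.ncard := by
  have pow_apply : ∀ (t : ℕ) (w : s), (((σ.subtypePerm hσ) ^ t) w : X) = (σ ^ t) w := fun t w => by
    rw [Equiv.Perm.subtypePerm_pow]; rfl
  have pow_eq_one : (σ.subtypePerm hσ) ^ N = 1 :=
    Equiv.ext fun w => Subtype.ext ((pow_apply N w).trans (hσN w w.2))
  have sum_eq_zero : ∀ w : s, ∑ t ∈ range N, κ (((σ.subtypePerm hσ) ^ t) w) = 0 := by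
    intro w
    have h := (pow_apply_single_of_apply_single hq0 hσ hF N w.2).symm.trans (hFN w w.2)
    rw [hσN w w.2] at h
    simpa only [pow_apply] using
      (zpow_eq_one_iff_of_not_root hq _).1 (Finsupp.single_injective _ h)
  obtain ⟨φ, hφ⟩ := exists_add_eq_of_sum_range_pow_eq_zero hN pow_eq_one
    (κ := fun w : s => κ w) sum_eq_zero
  rw [finrank_supported_inf_ker_id_sub hq0 hσ hF hφ, finrank_invariants,
    mul_card_quotient_sameCycle hN pow_eq_one]
  refine sum_congr rfl fun t _ => ?_
  rw [← Set.ncard_image_of_injective _ Subtype.val_injective]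
  congr 1
  ext w
  simp only [Set.mem_image, Set.mem_ofPred_eq, Subtype.exists, Subtype.ext_iff, pow_apply]
  simp [and_comm]

end FixedSpace

section Rotations

open Finset

variable {ι : Type*}

instance [Finite ι] [DecidableEq ι] (m : ι → ℕ) : Finite (wordsOf m) :=
  have := Fintype.ofFinite ι
  (List.finite_length_eq ι (∑ i, m i)).subset fun _ => length_of_mem_wordsOf

instance {k : Type*} [Field k] [Finite ι] [DecidableEq ι] (m : ι → ℕ) :
    FiniteDimensional k (component k m) :=
  Module.Finite.equiv (Finsupp.supportedEquivFinsupp (R := k) (M := k) (wordsOf m)).symm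

/-- Rotation of words by one letter, as a permutation. -/
def rotatePerm (ι : Type*) : Equiv.Perm (List ι) where
  toFun w := w.rotate 1
  invFun w := w.rotate (w.length - 1)
  left_inv w := by
    rcases w.eq_nil_or_concat with rfl | ⟨u, i, rfl⟩
    · rfl
    · beta_reduce
      rw [List.rotate_rotate, List.length_rotate, Nat.add_sub_cancel' (by simp), List.rotate_length]
  right_inv w := by
    rcases w.eq_nil_or_concat with rfl | ⟨u, i, rfl⟩
    · rfl
    · beta_reduce
      rw [List.rotate_rotate, Nat.sub_add_cancel (by simp), List.rotate_length]

theorem rotatePerm_cons (i : ι) (w : List ι) : rotatePerm ι (i :: w) = w ++ [i] := by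
  simp [rotatePerm]

theorem rotatePerm_pow_apply (t : ℕ) (w : List ι) : (rotatePerm ι ^ t) w = w.rotate t := by
  induction t with
  | zero => simp
  | succ t ih =>
    rw [pow_succ', Equiv.Perm.mul_apply, ih]
    exact List.rotate_rotate w t 1

/-- Rotation of the tail of a word by one letter, as a permutation. -/
def tailRotatePerm (ι : Type*) : Equiv.Perm (List ι) where
  toFun
    | [] => []
    | y :: v => y :: rotatePerm ι v
  invFun
    | [] => []
    | y :: v => y :: (rotatePerm ι).symm v
  left_inv
    | [] => rfl
    | y :: v => congrArg (y :: ·) ((rotatePerm ι).symm_apply_apply v)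
  right_inv
    | [] => rfl
    | y :: v => congrArg (y :: ·) ((rotatePerm ι).apply_symm_apply v)

theorem tailRotatePerm_cons (y : ι) (v : List ι) :
    tailRotatePerm ι (y :: v) = y :: rotatePerm ι v := rfl

theorem tailRotatePerm_pow_cons (t : ℕ) (y : ι) (v : List ι) :
    (tailRotatePerm ι ^ t) (y :: v) = y :: v.rotate t := by
  induction t with
  | zero => simp
  | succ t ih =>
    rw [pow_succ', Equiv.Perm.mul_apply, ih, ← rotatePerm_pow_apply, ← rotatePerm_pow_apply,
      pow_succ', Equiv.Perm.mul_apply, tailRotatePerm_cons]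

theorem rotatePerm_mem_wordsOf_iff [DecidableEq ι] {m : ι → ℕ} (w : List ι) :
    rotatePerm ι w ∈ wordsOf m ↔ w ∈ wordsOf m :=
  mem_wordsOf_iff_of_perm (List.rotate_perm w 1)

theorem tailRotatePerm_mem_wordsOf_iff [DecidableEq ι] {m : ι → ℕ} (w : List ι) :
    tailRotatePerm ι w ∈ wordsOf m ↔ w ∈ wordsOf m :=
  match w with
  | [] => Iff.rfl
  | y :: v => mem_wordsOf_iff_of_perm ((List.rotate_perm v 1).cons y)

end Rotations

section PowerMatrix

open Finset
open scoped Matrix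

variable {k : Type*} [Field k] {q : k} {n : ℕ}

theorem transpose_powerMatrix (a : Matrix (Fin n) (Fin n) ℤ) :
    (powerMatrix q a)ᵀ = powerMatrix q aᵀ := rfl

theorem braidScalar_powerMatrix (hq0 : q ≠ 0) (a : Matrix (Fin n) (Fin n) ℤ) (i : Fin n)
    (w : List (Fin n)) : braidScalar (powerMatrix q a) i w = q ^ (w.map (a i)).sum := by
  induction w with
  | nil => simp
  | cons l w ih =>
    rw [braidScalar_cons, ih, List.map_cons, List.sum_cons, zpow_add₀ hq0]
    rfl

theorem sum_map_eq_sum_count {ι : Type*} [Fintype ι] [DecidableEq ι] (b : ι → ℤ) (w : List ι) :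
    (w.map b).sum = ∑ l, b l * w.count l := by
  simp only [sum_list_map_count, nsmul_eq_mul, mul_comm]
  exact sum_subset (subset_univ _) fun l _ hl => by
    rw [List.count_eq_zero_of_not_mem (mt List.mem_toFinset.2 hl), Nat.cast_zero, mul_zero]

theorem monodromy_powerMatrix_count (hq0 : q ≠ 0) (a : Matrix (Fin n) (Fin n) ℤ)
    (w : List (Fin n)) : monodromy (powerMatrix q a) w =
      q ^ (quadForm a (fun i => w.count i) - linForm a (fun i => w.count i)) := by
  induction w with
  | nil => simp [monodromy, quadForm, linForm]
  | cons i w ih =>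
    rw [monodromy, ih, transpose_powerMatrix, braidScalar_powerMatrix hq0,
      braidScalar_powerMatrix hq0, ← zpow_add₀ hq0, ← zpow_add₀ hq0, sum_map_eq_sum_count,
      sum_map_eq_sum_count]
    congr 1
    have count_cons : ∀ l, (((i :: w).count l : ℕ) : ℤ) = w.count l + if i = l then 1 else 0 := by
      simp [List.count_cons]
    simp only [quadForm, linForm, count_cons, mul_add, add_mul, sum_add_distrib, mul_ite, ite_mul,
      mul_one, mul_zero, zero_mul, sum_ite_eq, mem_univ, if_true, Matrix.transpose_apply]
    rw [sum_comm (f := fun x y => if i = x then _ else _)]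
    simp only [sum_ite_eq, mem_univ, if_true]
    ring

theorem monodromy_powerMatrix (hq0 : q ≠ 0) (a : Matrix (Fin n) (Fin n) ℤ) {m : Fin n → ℕ}
    {w : List (Fin n)} (hw : w ∈ wordsOf m) :
    monodromy (powerMatrix q a) w = q ^ (quadForm a m - linForm a m) := by
  rw [monodromy_powerMatrix_count hq0, funext hw]

theorem mul_finrank_ker_id_sub_braidRot (hq0 : q ≠ 0) (hq : ∀ N : ℕ, 0 < N → q ^ N ≠ 1)
    {a : Matrix (Fin n) (Fin n) ℤ} {m : Fin n → ℕ} (hm : 0 < totalDegree m)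
    (hKm : quadForm a m = linForm a m) :
    totalDegree m * Module.finrank k
      ↥(component k m ⊓ LinearMap.ker (LinearMap.id - braidRot (powerMatrix q a))) =
      ∑ t ∈ range (totalDegree m), {w ∈ wordsOf m | w.rotate t = w}.ncard := by
  have length_eq : ∀ w ∈ wordsOf m, w.length = totalDegree m := fun _ => length_of_mem_wordsOf
  have h := mul_finrank_supported_inf_ker_id_sub (F := braidRot (powerMatrix q a))
    (κ := fun
      | [] => 0
      | i :: w => (w.map (a i)).sum)
    hq0 hq hm (rotatePerm_mem_wordsOf_iff (m := m)) (fun w hw => ?_) (fun w hw => ?_)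
    (fun w hw => ?_)
  · simpa only [rotatePerm_pow_apply] using h
  · rw [rotatePerm_pow_apply, ← length_eq w hw, List.rotate_length]
  · match w, hw with
    | [], hw => exact absurd rfl (ne_nil_of_mem_wordsOf hm hw)
    | i :: w, _ => rw [braidRot_cons, braidScalar_powerMatrix hq0, one_mul, rotatePerm_cons]
  · rw [← length_eq w hw, braidRot_pow_length, monodromy_powerMatrix hq0 a hw, hKm, sub_self,
      zpow_zero, one_mul]

theorem mul_finrank_ker_id_sub_tailBraidRot (hq0 : q ≠ 0) (hq : ∀ N : ℕ, 0 < N → q ^ N ≠ 1)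
    {a : Matrix (Fin n) (Fin n) ℤ} {m : Fin n → ℕ} {N : ℕ} (hN : 0 < N)
    (hm : totalDegree m = N + 1) (hKm : quadForm a m = linForm a m) :
    N * Module.finrank k
      ↥(component k m ⊓ LinearMap.ker (LinearMap.id - tailBraidRot (powerMatrix q a))) =
      ∑ t ∈ range N, {w ∈ wordsOf m | (tailRotatePerm (Fin n) ^ t) w = w}.ncard := by
  have length_tail : ∀ y v, y :: v ∈ wordsOf m → v.length = N := fun y v hw =>
    Nat.succ_injective ((length_of_mem_wordsOf hw).trans hm)
  have not_nil : [] ∉ wordsOf m := fun hw =>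
    absurd rfl (ne_nil_of_mem_wordsOf (N.succ_pos.trans_eq hm.symm) hw)
  refine mul_finrank_supported_inf_ker_id_sub (F := tailBraidRot (powerMatrix q a))
    (κ := fun
      | [] => 0
      | [_] => 0
      | y :: i :: w => (w.map (a i)).sum + (a i y + a y i))
    hq0 hq hN tailRotatePerm_mem_wordsOf_iff (fun w hw => ?_) (fun w hw => ?_) (fun w hw => ?_)
  · match w, hw with
    | [], hw => exact absurd hw not_nil
    | y :: v, hw => rw [tailRotatePerm_pow_cons, ← length_tail y v hw, List.rotate_length]
  · match w, hw with
    | [], hw => exact absurd hw not_nil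
    | [y], hw => exact absurd (length_tail y [] hw) hN.ne
    | y :: i :: w, _ =>
      rw [tailBraidRot_cons_cons, braidScalar_powerMatrix hq0, one_mul, zpow_add₀ hq0,
        zpow_add₀ hq0, tailRotatePerm_cons, rotatePerm_cons]
      rfl
  · match w, hw with
    | [], hw => exact absurd hw not_nil
    | y :: v, hw =>
      rw [← length_tail y v hw, tailBraidRot_pow_length, monodromy_powerMatrix hq0 a hw, hKm,
        sub_self, zpow_zero, one_mul]

end PowerMatrix

/-! ### Injectivity of `Δ_{m-1,1}` and deformation over the dual numbers -/

section ChangeOfScalars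

variable {ι S R : Type*} [CommRing S] [CommRing R]

/-- Application of an additive map to the coefficients. -/
noncomputable def mapCoeff (φ : S →+ R) : (List ι →₀ S) →+ (List ι →₀ R) :=
  Finsupp.mapRange.addMonoidHom φ

@[simp] theorem mapCoeff_apply (φ : S →+ R) (f : List ι →₀ S) (w : List ι) :
    mapCoeff φ f w = φ (f w) :=
  rfl

@[simp] theorem mapCoeff_single (φ : S →+ R) (w : List ι) (c : S) :
    mapCoeff φ (Finsupp.single w c) = Finsupp.single w (φ c) := by
  simp [mapCoeff]

theorem mapCoeff_mem_component [DecidableEq ι] (φ : S →+ R) {m : ι → ℕ} {f : List ι →₀ S}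
    (hf : f ∈ component S m) : mapCoeff φ f ∈ component R m := by
  refine (Finsupp.mem_supported' R _).2 fun w hw => ?_
  rw [mapCoeff_apply, apply_eq_zero_of_mem_supported hf hw, map_zero]

theorem mapCoeff_insertSecond (φ : S →+ R) (i : ι) (f : List ι →₀ S) :
    mapCoeff φ (insertSecond S i f) = insertSecond R i (mapCoeff φ f) := by
  induction f using Finsupp.induction_linear with
  | zero => simp
  | add f g hf hg => simp only [map_add, hf, hg]
  | single w c =>
    match w with
    | [] => simp
    | y :: v => simp

variable {Q : Matrix ι ι S} {Q' : Matrix ι ι R} {φ : S →+ R}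

theorem map_mul_braidScalar (hφ : ∀ i j c, φ (c * Q i j) = φ c * Q' i j) (i : ι) (w : List ι)
    (c : S) : φ (c * braidScalar Q i w) = φ c * braidScalar Q' i w := by
  induction w generalizing c with
  | nil => simp
  | cons l w ih => rw [braidScalar_cons, braidScalar_cons, ← mul_assoc, ih, hφ, mul_assoc]

theorem mapCoeff_totalSkewDer (hφ : ∀ i j c, φ (c * Q i j) = φ c * Q' i j) (f : List ι →₀ S) :
    mapCoeff φ (totalSkewDer Q f) = totalSkewDer Q' (mapCoeff φ f) := by
  induction f using Finsupp.induction_linear with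
  | zero => simp
  | add f g hf hg => simp only [map_add, hf, hg]
  | single w c =>
    induction w with
    | nil => simp
    | cons i w ih =>
      rw [totalSkewDer_cons, map_add, mapCoeff_insertSecond, ih, mapCoeff_single, mapCoeff_single,
        mapCoeff_single, totalSkewDer_cons, map_mul_braidScalar hφ]

theorem mapCoeff_tailSkewDer (hφ : ∀ i j c, φ (c * Q i j) = φ c * Q' i j) (f : List ι →₀ S) :
    mapCoeff φ (tailSkewDer Q f) = tailSkewDer Q' (mapCoeff φ f) := by
  induction f using Finsupp.induction_linear with
  | zero => simp
  | add f g hf hg => simp only [map_add, hf, hg]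
  | single w c =>
    match w with
    | [] => simp
    | i :: w =>
      rw [tailSkewDer_cons, mapCoeff_insertSecond, mapCoeff_totalSkewDer hφ, mapCoeff_single,
        mapCoeff_single, tailSkewDer_cons]

theorem mapCoeff_braidRot (hφ : ∀ i j c, φ (c * Q i j) = φ c * Q' i j) (f : List ι →₀ S) :
    mapCoeff φ (braidRot Q f) = braidRot Q' (mapCoeff φ f) := by
  induction f using Finsupp.induction_linear with
  | zero => simp
  | add f g hf hg => simp only [map_add, hf, hg]
  | single w c =>
    match w with
    | [] => simp
    | i :: w =>
      rw [braidRot_cons, mapCoeff_single, mapCoeff_single, braidRot_cons, map_mul_braidScalar hφ]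

end ChangeOfScalars

section Monodromy

variable {ι S R : Type*} [CommRing S] [CommRing R]

open scoped Matrix

theorem braidScalar_map (φ : S →+* R) (Q : Matrix ι ι S) (i : ι) (w : List ι) :
    braidScalar (Q.map φ) i w = φ (braidScalar Q i w) := by
  rw [braidScalar, braidScalar, map_list_prod, List.map_map]
  rfl

theorem monodromy_map (φ : S →+* R) (Q : Matrix ι ι S) (w : List ι) :
    monodromy (Q.map φ) w = φ (monodromy Q w) := by
  induction w with
  | nil => simp [monodromy]
  | cons i w ih =>
    rw [monodromy, monodromy, ih, ← Matrix.transpose_map, braidScalar_map, braidScalar_map,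
      map_mul, map_mul]

variable [DecidableEq ι]

/-- The matrix `Q` with the diagonal entry `q_{ii}` multiplied by `t`. -/
def scaleDiagEntry (Q : Matrix ι ι R) (i : ι) (t : R) : Matrix ι ι R :=
  Matrix.of fun j l => if j = i ∧ l = i then t * Q j l else Q j l

theorem scaleDiagEntry_apply (Q : Matrix ι ι R) (i : ι) (t : R) (j l : ι) :
    scaleDiagEntry Q i t j l = if j = i ∧ l = i then t * Q j l else Q j l := rfl

theorem transpose_scaleDiagEntry (Q : Matrix ι ι R) (i : ι) (t : R) :
    (scaleDiagEntry Q i t)ᵀ = scaleDiagEntry Qᵀ i t := by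
  ext j l
  simp only [Matrix.transpose_apply, scaleDiagEntry_apply, and_comm]

theorem braidScalar_scaleDiagEntry (Q : Matrix ι ι R) (i : ι) (t : R) (j : ι) (w : List ι) :
    braidScalar (scaleDiagEntry Q i t) j w =
      (if j = i then t ^ w.count i else 1) * braidScalar Q j w := by
  induction w with
  | nil => simp
  | cons l w ih =>
    rw [braidScalar_cons, braidScalar_cons, ih, List.count_cons, scaleDiagEntry_apply]
    by_cases hj : j = i <;> by_cases hl : l = i <;> simp [hj, hl] <;> ring

theorem monodromy_scaleDiagEntry (Q : Matrix ι ι R) (i : ι) (t : R) (w : List ι) :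
    monodromy (scaleDiagEntry Q i t) w =
      t ^ (w.count i * (w.count i - 1)) * monodromy Q w := by
  induction w with
  | nil => simp [monodromy]
  | cons j w ih =>
    rw [monodromy, monodromy, ih, transpose_scaleDiagEntry, braidScalar_scaleDiagEntry,
      braidScalar_scaleDiagEntry]
    by_cases hj : j = i
    · have exponent : ∀ c : ℕ, (c + 1) * (c + 1 - 1) = c + c + c * (c - 1) := by
        rintro (_ | c)
        · rfl
        · rw [Nat.add_sub_cancel, Nat.add_sub_cancel]; ring
      rw [hj, List.count_cons_self, exponent, pow_add, pow_add, if_pos rfl]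
      ring
    · rw [List.count_cons_of_ne hj, if_neg hj, one_mul, one_mul]
      ring

end Monodromy

section Injectivity

theorem forall_apply_eq_zero_iff_surjOn {k V : Type*} [Field k] [AddCommGroup V] [Module k V]
    {p : Submodule k V} [FiniteDimensional k p] {F : V →ₗ[k] V} (hF : ∀ f ∈ p, F f ∈ p) :
    (∀ f ∈ p, F f = 0 → f = 0) ↔ Set.SurjOn F p p := by
  rw [← LinearMap.injOn_iff_surjOn hF, ← LinearMap.disjoint_ker_iff_injOn, LinearMap.disjoint_ker]

theorem mem_ker_tailBraidRot_tailSkewDer_iff {ι k : Type*} [Field k] {Q : Matrix ι ι k}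
    {f : List ι →₀ k} :
    f ∈ LinearMap.ker ((LinearMap.id - tailBraidRot Q) ∘ₗ tailSkewDer Q) ↔
      totalSkewDer Q (f - braidRot Q f) = 0 := by
  rw [totalSkewDer_sub_braidRot]
  exact LinearMap.mem_ker

theorem ker_id_sub_braidRot_le {ι k : Type*} [Field k] [DecidableEq ι] (m : ι → ℕ)
    (Q : Matrix ι ι k) :
    component k m ⊓ LinearMap.ker (LinearMap.id - braidRot Q) ≤
      component k m ⊓ LinearMap.ker ((LinearMap.id - tailBraidRot Q) ∘ₗ tailSkewDer Q) := by
  refine inf_le_inf_left _ fun f hf => mem_ker_tailBraidRot_tailSkewDer_iff.2 ?_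
  exact (congrArg _ (LinearMap.mem_ker.1 hf)).trans (map_zero _)

variable {ι : Type*} [Fintype ι] [DecidableEq ι] {m : ι → ℕ}

theorem tailBraidRot_pow_of_mem_component {R : Type*} [CommRing R] {Q : Matrix ι ι R} {N : ℕ}
    (hm : ∑ i, m i = N + 1) {z : R} (hz : ∀ w ∈ wordsOf m, monodromy Q w = z)
    {f : List ι →₀ R} (hf : f ∈ component R m) : (tailBraidRot Q ^ N) f = z • f := by
  refine eqOn_supported (F := tailBraidRot Q ^ N) (G := z • LinearMap.id) (fun w hw => ?_) hf
  match w, hw with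
  | [], hw => exact absurd rfl (ne_nil_of_mem_wordsOf (hm ▸ N.succ_pos) hw)
  | y :: v, hw =>
    have length_eq : v.length = N := Nat.succ_injective ((length_of_mem_wordsOf hw).trans hm)
    rw [← length_eq, tailBraidRot_pow_length, hz _ hw]
    simp

variable {k : Type*} [Field k] {Q : Matrix ι ι k}

theorem surjOn_tailSkewDer (hlow : ∀ m', ∑ i, m' i + 1 = ∑ i, m i → InjectiveAt Q m')
    (hm : 0 < ∑ i, m i) :
    Set.SurjOn (tailSkewDer Q) (component k m) (component k m) :=
  (forall_apply_eq_zero_iff_surjOn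
    fun _ => map_mem_component (tailSkewDer_single_mem_supported_perm Q)).1
    fun _ => tailSkewDer_injective hlow hm

theorem injectiveAt_of_monodromy_ne_one
    (hlow : ∀ m', ∑ i, m' i + 1 = ∑ i, m i → InjectiveAt Q m') (hm : 0 < ∑ i, m i) {z : k}
    (hz : ∀ w ∈ wordsOf m, monodromy Q w = z) (hz1 : z ≠ 1) : InjectiveAt Q m := by
  obtain ⟨N, hN⟩ := Nat.exists_eq_add_of_lt hm
  rw [zero_add] at hN
  have eq_zero_of_fixed : ∀ f ∈ component k m, tailBraidRot Q f = f → f = 0 := by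
    intro f hf hfix
    have h := tailBraidRot_pow_of_mem_component hN hz hf
    rw [Module.End.pow_apply, Function.iterate_fixed hfix] at h
    by_contra hne
    exact hz1 (smul_left_injective k hne (h.symm.trans (one_smul k f).symm))
  have composite_injective : ∀ f ∈ component k m,
      totalSkewDer Q (f - braidRot Q f) = 0 → f = 0 := by
    intro f hf h
    rw [totalSkewDer_sub_braidRot, sub_eq_zero, eq_comm] at h
    exact tailSkewDer_injective hlow hm hf
      (eq_zero_of_fixed _ (map_mem_component (tailSkewDer_single_mem_supported_perm Q) hf) h)
  have surj : Set.SurjOn (LinearMap.id - braidRot Q : (List ι →₀ k) →ₗ[k] (List ι →₀ k))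
      (component k m) (component k m) := by
    refine (forall_apply_eq_zero_iff_surjOn fun f hf =>
      sub_mem hf (map_mem_component (braidRot_single_mem_supported_perm Q) hf)).1
      fun f hf h => composite_injective f hf ?_
    rw [show f - braidRot Q f = 0 from h, map_zero]
  intro f hf h0
  obtain ⟨g, hg, rfl⟩ := surj hf
  rw [composite_injective g hg h0, map_zero]

theorem finrank_ker_tailBraidRot_tailSkewDer
    (hlow : ∀ m', ∑ i, m' i + 1 = ∑ i, m i → InjectiveAt Q m') (hm : 0 < ∑ i, m i) :
    Module.finrank k
        ↥(component k m ⊓ LinearMap.ker ((LinearMap.id - tailBraidRot Q) ∘ₗ tailSkewDer Q)) =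
      Module.finrank k ↥(component k m ⊓ LinearMap.ker (LinearMap.id - tailBraidRot Q)) := by
  have maps_to : ∀ f ∈ component k m ⊓
      LinearMap.ker ((LinearMap.id - tailBraidRot Q) ∘ₗ tailSkewDer Q),
      tailSkewDer Q f ∈ component k m ⊓ LinearMap.ker (LinearMap.id - tailBraidRot Q) :=
    fun f hf => ⟨map_mem_component (tailSkewDer_single_mem_supported_perm Q) hf.1, hf.2⟩
  refine (LinearEquiv.ofBijective ((tailSkewDer Q).restrict maps_to) ⟨?_, ?_⟩).finrank_eq
  · rw [injective_iff_map_eq_zero]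
    rintro ⟨f, hf⟩ h
    exact Subtype.ext (tailSkewDer_injective hlow hm hf.1 (congrArg Subtype.val h))
  · rintro ⟨g, hg⟩
    obtain ⟨f, hf, rfl⟩ := surjOn_tailSkewDer hlow hm hg.1
    exact ⟨⟨f, hf, hg.2⟩, rfl⟩

theorem finrank_ker_eq_of_injectiveAt
    (hlow : ∀ m', ∑ i, m' i + 1 = ∑ i, m i → InjectiveAt Q m') (hm : 0 < ∑ i, m i)
    (hinj : InjectiveAt Q m) :
    Module.finrank k ↥(component k m ⊓ LinearMap.ker (LinearMap.id - braidRot Q)) =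
      Module.finrank k ↥(component k m ⊓ LinearMap.ker (LinearMap.id - tailBraidRot Q)) := by
  rw [← finrank_ker_tailBraidRot_tailSkewDer hlow hm]
  suffices h : component k m ⊓ LinearMap.ker (LinearMap.id - braidRot Q) =
      component k m ⊓ LinearMap.ker ((LinearMap.id - tailBraidRot Q) ∘ₗ tailSkewDer Q) by rw [h]
  refine le_antisymm (ker_id_sub_braidRot_le m Q) fun f hf => ⟨hf.1, ?_⟩
  exact hinj _ (sub_mem hf.1 (map_mem_component (braidRot_single_mem_supported_perm Q) hf.1))
    (mem_ker_tailBraidRot_tailSkewDer_iff.1 hf.2)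

end Injectivity

section DualNumbers

variable {ι R : Type*} [CommRing R]

/-- The constant terms of the coefficients, `a + b ε ↦ a`. -/
noncomputable def fstCoeff : (List ι →₀ DualNumber R) →+ (List ι →₀ R) :=
  mapCoeff (TrivSqZeroExt.fstHom R R R : DualNumber R →+ R)

/-- The `ε`-parts of the coefficients, `a + b ε ↦ b`. -/
noncomputable def sndCoeff : (List ι →₀ DualNumber R) →+ (List ι →₀ R) :=
  mapCoeff (TrivSqZeroExt.sndHom R R : DualNumber R →+ R)

/-- Extension of scalars to the dual numbers, `a ↦ a`. -/
noncomputable def inlCoeff : (List ι →₀ R) →+ (List ι →₀ DualNumber R) :=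
  mapCoeff (TrivSqZeroExt.inlHom R R : R →+ DualNumber R)

/-- Extension of scalars to the dual numbers followed by multiplication by `ε`, `b ↦ b ε`. -/
noncomputable def inrCoeff : (List ι →₀ R) →+ (List ι →₀ DualNumber R) :=
  mapCoeff (TrivSqZeroExt.inrHom R R : R →+ DualNumber R)

theorem sndCoeff_apply (f : List ι →₀ DualNumber R) (w : List ι) : sndCoeff f w = (f w).snd := rfl

theorem inlCoeff_apply (f : List ι →₀ R) (w : List ι) :
    inlCoeff f w = TrivSqZeroExt.inl (f w) := rfl

theorem inrCoeff_apply (f : List ι →₀ R) (w : List ι) :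
    inrCoeff f w = TrivSqZeroExt.inr (f w) := rfl

theorem fstCoeff_inlCoeff (f : List ι →₀ R) : fstCoeff (inlCoeff f) = f :=
  Finsupp.ext fun w => TrivSqZeroExt.fst_inl R (f w)

theorem fstCoeff_inrCoeff (f : List ι →₀ R) : fstCoeff (inrCoeff f) = 0 :=
  Finsupp.ext fun w => TrivSqZeroExt.fst_inr R (f w)

theorem sndCoeff_inrCoeff (f : List ι →₀ R) : sndCoeff (inrCoeff f) = f :=
  Finsupp.ext fun w => TrivSqZeroExt.snd_inr R (f w)

theorem inrCoeff_sndCoeff_of_fstCoeff_eq_zero {f : List ι →₀ DualNumber R} (hf : fstCoeff f = 0) :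
    inrCoeff (sndCoeff f) = f := by
  ext1 w
  have fst_eq : (f w).fst = 0 := DFunLike.congr_fun hf w
  rw [inrCoeff_apply, sndCoeff_apply]
  exact TrivSqZeroExt.ext fst_eq.symm rfl

variable {Q : Matrix ι ι R} {Q' : Matrix ι ι (DualNumber R)}

theorem fst_mul_deformation (hQ : ∀ i j, (Q' i j).fst = Q i j) (i j : ι) (c : DualNumber R) :
    (TrivSqZeroExt.fstHom R R R : DualNumber R →+ R) (c * Q' i j) =
      (TrivSqZeroExt.fstHom R R R : DualNumber R →+ R) c * Q i j := by
  rw [← hQ]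
  exact TrivSqZeroExt.fst_mul _ _

theorem inr_mul_deformation (hQ : ∀ i j, (Q' i j).fst = Q i j) (i j : ι) (c : R) :
    (TrivSqZeroExt.inrHom R R : R →+ DualNumber R) (c * Q i j) =
      (TrivSqZeroExt.inrHom R R : R →+ DualNumber R) c * Q' i j := by
  ext <;> simp [hQ, mul_comm]

variable [DecidableEq ι] {k : Type*} [Field k] {m : ι → ℕ}

theorem surjOn_tailSkewDer_deformation {Q : Matrix ι ι k} {Q' : Matrix ι ι (DualNumber k)}
    (hQ : ∀ i j, (Q' i j).fst = Q i j)
    (hsurj : Set.SurjOn (tailSkewDer Q) (component k m) (component k m)) :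
    Set.SurjOn (tailSkewDer Q') (component (DualNumber k) m) (component (DualNumber k) m) := by
  intro g hg
  have map_tailSkewDer_fst : ∀ f, fstCoeff (tailSkewDer Q' f) = tailSkewDer Q (fstCoeff f) :=
    mapCoeff_tailSkewDer (fst_mul_deformation hQ)
  have map_tailSkewDer_inr : ∀ f, inrCoeff (tailSkewDer Q f) = tailSkewDer Q' (inrCoeff f) :=
    mapCoeff_tailSkewDer (inr_mul_deformation hQ)
  have fst_mem : fstCoeff g ∈ component k m := mapCoeff_mem_component _ hg
  obtain ⟨a, ha, hag⟩ := hsurj fst_mem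
  have inl_mem : inlCoeff a ∈ component (DualNumber k) m := mapCoeff_mem_component _ ha
  have remainder_mem : g - tailSkewDer Q' (inlCoeff a) ∈ component (DualNumber k) m :=
    sub_mem hg (map_mem_component (tailSkewDer_single_mem_supported_perm Q') inl_mem)
  have snd_mem : sndCoeff (g - tailSkewDer Q' (inlCoeff a)) ∈ component k m :=
    mapCoeff_mem_component _ remainder_mem
  obtain ⟨b, hb, hbg⟩ := hsurj snd_mem
  have fst_remainder : fstCoeff (g - tailSkewDer Q' (inlCoeff a)) = 0 := by
    rw [map_sub, map_tailSkewDer_fst, fstCoeff_inlCoeff, hag, sub_self]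
  refine ⟨inlCoeff a + inrCoeff b, add_mem inl_mem (mapCoeff_mem_component _ hb), ?_⟩
  rw [map_add, ← map_tailSkewDer_inr, hbg, inrCoeff_sndCoeff_of_fstCoeff_eq_zero fst_remainder,
    add_sub_cancel]

variable [Fintype ι]

theorem exists_sub_tailBraidRot_eq_inrCoeff {Q' : Matrix ι ι (DualNumber k)} (hm : 0 < ∑ i, m i)
    {z : DualNumber k} (hz : ∀ w ∈ wordsOf m, monodromy Q' w = z) (hfst : z.fst = 1)
    (hsnd : z.snd ≠ 0) {f : List ι →₀ k} (hf : f ∈ component k m) :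
    ∃ u ∈ component (DualNumber k) m, u - tailBraidRot Q' u = inrCoeff f := by
  obtain ⟨N, hN⟩ := Nat.exists_eq_add_of_lt hm
  rw [zero_add] at hN
  set v : List ι →₀ DualNumber k := inlCoeff (-z.snd⁻¹ • f) with v_def
  have v_mem : v ∈ component (DualNumber k) m :=
    mapCoeff_mem_component _ (Submodule.smul_mem _ _ hf)
  have pow_mem : ∀ s, (tailBraidRot Q' ^ s) v ∈ component (DualNumber k) m := by
    intro s
    induction s with
    | zero => exact v_mem
    | succ s ih =>
      rw [pow_succ', Module.End.mul_apply]
      exact map_mem_component (tailBraidRot_single_mem_supported_perm Q') ih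
  have one_sub_smul : v - z • v = inrCoeff f := by
    ext1 w
    rw [Finsupp.sub_apply, Finsupp.smul_apply, v_def, inlCoeff_apply, inrCoeff_apply,
      Finsupp.smul_apply]
    ext
    · simp [hfst]
    · simp [hsnd]
  refine ⟨(∑ s ∈ Finset.range N, tailBraidRot Q' ^ s) v, ?_, ?_⟩
  · rw [LinearMap.sum_apply]
    exact Submodule.sum_mem _ fun s _ => pow_mem s
  · have telescoping := congrArg (fun F => F v) (mul_neg_geom_sum (tailBraidRot Q') N)
    simp only [Module.End.mul_apply, LinearMap.sub_apply, Module.End.one_apply] at telescoping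
    rw [tailBraidRot_pow_of_mem_component hN hz v_mem, one_sub_smul] at telescoping
    exact telescoping

/-- A solution `f` of `Δ(f - rot f) = w ε` over the dual numbers is, modulo `ε`, fixed by the
rotation, so that `f - rot f` is a multiple of `ε` and yields a preimage of `w`. -/
theorem injectiveAt_of_deformation {Q : Matrix ι ι k} {Q' : Matrix ι ι (DualNumber k)}
    (hlow : ∀ m', ∑ i, m' i + 1 = ∑ i, m i → InjectiveAt Q m') (hm : 0 < ∑ i, m i)
    (heq : Module.finrank k ↥(component k m ⊓ LinearMap.ker (LinearMap.id - braidRot Q)) =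
      Module.finrank k ↥(component k m ⊓ LinearMap.ker (LinearMap.id - tailBraidRot Q)))
    (hQ : ∀ i j, (Q' i j).fst = Q i j) {z : DualNumber k}
    (hz : ∀ w ∈ wordsOf m, monodromy Q' w = z) (hfst : z.fst = 1) (hsnd : z.snd ≠ 0) :
    InjectiveAt Q m := by
  have ker_eq := Submodule.eq_of_le_of_finrank_eq (ker_id_sub_braidRot_le m Q)
    (heq.trans (finrank_ker_tailBraidRot_tailSkewDer hlow hm).symm)
  have map_totalSkewDer_fst : ∀ g, fstCoeff (totalSkewDer Q' g) = totalSkewDer Q (fstCoeff g) :=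
    mapCoeff_totalSkewDer (fst_mul_deformation hQ)
  have map_braidRot_fst : ∀ g, fstCoeff (braidRot Q' g) = braidRot Q (fstCoeff g) :=
    mapCoeff_braidRot (fst_mul_deformation hQ)
  have map_totalSkewDer_inr : ∀ g, inrCoeff (totalSkewDer Q g) = totalSkewDer Q' (inrCoeff g) :=
    mapCoeff_totalSkewDer (inr_mul_deformation hQ)
  refine (forall_apply_eq_zero_iff_surjOn fun _ =>
    map_mem_component (totalSkewDer_single_mem_supported_perm Q)).2 fun w hw => ?_
  obtain ⟨u, hu, hu_w⟩ := exists_sub_tailBraidRot_eq_inrCoeff hm hz hfst hsnd hw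
  obtain ⟨f, hf, rfl⟩ := surjOn_tailSkewDer_deformation hQ (surjOn_tailSkewDer hlow hm) hu
  rw [← totalSkewDer_sub_braidRot] at hu_w
  have fst_mem : fstCoeff f ∈
      component k m ⊓ LinearMap.ker ((LinearMap.id - tailBraidRot Q) ∘ₗ tailSkewDer Q) := by
    refine ⟨mapCoeff_mem_component _ hf, mem_ker_tailBraidRot_tailSkewDer_iff.2 ?_⟩
    rw [← map_braidRot_fst, ← map_sub, ← map_totalSkewDer_fst, hu_w, fstCoeff_inrCoeff]
  rw [← ker_eq] at fst_mem
  have fst_eq_zero : fstCoeff (f - braidRot Q' f) = 0 := by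
    rw [map_sub, map_braidRot_fst]
    exact LinearMap.mem_ker.1 fst_mem.2
  refine ⟨sndCoeff (f - braidRot Q' f), mapCoeff_mem_component _
    (sub_mem hf (map_mem_component (braidRot_single_mem_supported_perm Q') hf)), ?_⟩
  rw [← sndCoeff_inrCoeff (totalSkewDer Q _), map_totalSkewDer_inr,
    inrCoeff_sndCoeff_of_fstCoeff_eq_zero fst_eq_zero, hu_w, sndCoeff_inrCoeff]

theorem injectiveAt_of_finrank_eq {Q : Matrix ι ι k}
    (hlow : ∀ m', ∑ i, m' i + 1 = ∑ i, m i → InjectiveAt Q m') (hm : 0 < ∑ i, m i)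
    (hz : ∀ w ∈ wordsOf m, monodromy Q w = 1)
    (heq : Module.finrank k ↥(component k m ⊓ LinearMap.ker (LinearMap.id - braidRot Q)) =
      Module.finrank k ↥(component k m ⊓ LinearMap.ker (LinearMap.id - tailBraidRot Q)))
    (i : ι) (hi : ((m i * (m i - 1) : ℕ) : k) ≠ 0) : InjectiveAt Q m := by
  refine injectiveAt_of_deformation
    (Q' := scaleDiagEntry (Q.map (TrivSqZeroExt.inlHom k k)) i (1 + DualNumber.eps))
    (z := (1 + DualNumber.eps) ^ (m i * (m i - 1))) hlow hm heq (fun j l => ?_)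
    (fun w hw => ?_) ?_ ?_
  · rw [scaleDiagEntry_apply]
    split_ifs <;> simp
  · rw [monodromy_scaleDiagEntry, monodromy_map, hz w hw, map_one, mul_one, mem_wordsOf.1 hw i]
  · simp [TrivSqZeroExt.fst_pow]
  · simpa [TrivSqZeroExt.snd_pow] using hi

end DualNumbers

section SingleLetter

variable {ι k : Type*} [Field k]

theorem totalSkewDer_replicate (Q : Matrix ι ι k) (i : ι) (r : ℕ) (c : k) :
    totalSkewDer Q (Finsupp.single (List.replicate r i) c) =
      Finsupp.single (List.replicate r i) (c * qNumber r (Q i i)) := by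
  induction r with
  | zero => simp [qNumber]
  | succ r ih =>
    have braidScalar_eq : braidScalar Q i (List.replicate r i) = Q i i ^ r := by
      simp [braidScalar]
    have qNumber_succ : qNumber (r + 1) (Q i i) = qNumber r (Q i i) + Q i i ^ r :=
      Finset.sum_range_succ _ _
    rw [List.replicate_succ, totalSkewDer_cons, ih, braidScalar_eq, qNumber_succ, mul_add,
      Finsupp.single_add]
    match r with
    | 0 => simp [qNumber]
    | r + 1 => rw [List.replicate_succ, insertSecond_cons]

theorem wordsOf_single [DecidableEq ι] (i : ι) (r : ℕ) :
    wordsOf (Pi.single i r) = {List.replicate r i} := by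
  ext w
  rw [Set.mem_singleton_iff]
  constructor
  · intro hw
    have eq_of_mem : ∀ j ∈ w, j = i := by
      intro j hj
      by_contra hne
      have count_eq := mem_wordsOf.1 hw j
      rw [Pi.single_eq_of_ne hne, List.count_eq_zero] at count_eq
      exact count_eq hj
    have count_eq := mem_wordsOf.1 hw i
    rw [Pi.single_eq_same, List.count_eq_length.2 fun j hj => (eq_of_mem j hj).symm] at count_eq
    exact List.eq_replicate_iff.2 ⟨count_eq, eq_of_mem⟩
  · rintro rfl
    refine mem_wordsOf.2 fun j => ?_
    rw [List.count_replicate, Pi.single_apply]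
    simp only [beq_iff_eq, eq_comm (a := i)]

theorem injectiveAt_single_iff [DecidableEq ι] {Q : Matrix ι ι k} (i : ι) (r : ℕ) :
    InjectiveAt Q (Pi.single i r) ↔ qNumber r (Q i i) ≠ 0 := by
  constructor
  · intro hinj h0
    have mem : Finsupp.single (List.replicate r i) (1 : k) ∈ component k (Pi.single i r) :=
      Finsupp.single_mem_supported k _ (by rw [wordsOf_single]; rfl)
    have eq_zero := hinj _ mem (by rw [totalSkewDer_replicate, h0, mul_zero, Finsupp.single_zero])
    exact one_ne_zero (Finsupp.single_eq_zero.1 eq_zero)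
  · intro h f hf h0
    rw [component, wordsOf_single, Finsupp.mem_supported, ← Finset.coe_singleton,
      Finset.coe_subset, Finsupp.support_subset_singleton] at hf
    rw [hf, totalSkewDer_replicate, Finsupp.single_eq_zero] at h0
    rw [hf, (mul_eq_zero.1 h0).resolve_right h, Finsupp.single_zero]

end SingleLetter

/-! ### Counting words and their rotations -/

section CountWords

open Finset

variable {ι : Type*} [Fintype ι] [DecidableEq ι] {m : ι → ℕ}

theorem ncard_wordsOf_eq_sum_cons (hm : 0 < ∑ i, m i) :
    (wordsOf m).ncard = ∑ j, {v | j :: v ∈ wordsOf m}.ncard := by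
  have finite_cons : ∀ j, {v | j :: v ∈ wordsOf m}.Finite := fun j =>
    (Set.toFinite (wordsOf m)).preimage fun _ _ _ _ h => List.tail_eq_of_cons_eq h
  have disjoint_cons : Pairwise (Function.onFun Disjoint
      fun j => List.cons j '' {v | j :: v ∈ wordsOf m}) := by
    intro j j' hne
    refine Set.disjoint_left.2 ?_
    rintro _ ⟨v, -, rfl⟩ ⟨v', -, h⟩
    exact hne (List.head_eq_of_cons_eq h).symm
  have eq_iUnion : wordsOf m = ⋃ j, List.cons j '' {v | j :: v ∈ wordsOf m} := by
    ext w
    rw [Set.mem_iUnion]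
    constructor
    · intro hw
      match w, hw with
      | [], hw => exact absurd rfl (ne_nil_of_mem_wordsOf hm hw)
      | j :: v, hw => exact ⟨j, v, hw, rfl⟩
    · rintro ⟨j, v, hv, rfl⟩
      exact hv
  conv_lhs => rw [eq_iUnion]
  rw [Set.ncard_iUnion_of_finite (fun j => (finite_cons j).image _) disjoint_cons,
    finsum_eq_sum_of_fintype]
  exact sum_congr rfl fun j _ => Set.ncard_image_of_injective _ List.cons_injective

theorem prod_factorial_sub_single {j : ι} (hj : m j ≠ 0) :
    m j * ∏ i, ((m - Pi.single j 1 : ι → ℕ) i).factorial = ∏ i, (m i).factorial := by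
  rw [← mul_prod_erase _ _ (mem_univ j), ← mul_prod_erase univ (fun i => (m i).factorial)
    (mem_univ j), ← mul_assoc, Pi.sub_apply, Pi.single_eq_same, Nat.mul_factorial_pred hj]
  congr 1
  refine prod_congr rfl fun i hi => ?_
  rw [Pi.sub_apply, Pi.single_eq_of_ne (ne_of_mem_erase hi), Nat.sub_zero]

theorem prod_factorial_mul_ncard_wordsOf (m : ι → ℕ) :
    (∏ i, (m i).factorial) * (wordsOf m).ncard = (∑ i, m i).factorial := by
  induction hL : ∑ i, m i generalizing m with
  | zero =>
    obtain rfl : m = 0 := funext fun i => sum_eq_zero_iff.1 hL i (mem_univ i)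
    have wordsOf_zero : wordsOf (0 : ι → ℕ) = {[]} := by
      refine Set.eq_singleton_iff_unique_mem.2 ⟨mem_wordsOf.2 fun i => List.count_nil, ?_⟩
      exact fun w hw => List.length_eq_zero_iff.1 ((length_of_mem_wordsOf hw).trans hL)
    simp [wordsOf_zero]
  | succ L ih =>
    have cons_count : ∀ j, (∏ i, (m i).factorial) * {v | j :: v ∈ wordsOf m}.ncard =
        m j * L.factorial := by
      intro j
      by_cases hj : m j = 0
      · simp [cons_mem_wordsOf, hj]
      · have cons_eq : {v | j :: v ∈ wordsOf m} = wordsOf (m - Pi.single j 1) :=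
          Set.ext fun v => cons_mem_wordsOf.trans (and_iff_right hj)
        rw [cons_eq, ← prod_factorial_sub_single hj, mul_assoc,
          ih _ (Nat.succ_injective ((sum_sub_single_add_one hj).trans hL))]
    rw [ncard_wordsOf_eq_sum_cons (hL ▸ L.succ_pos), mul_sum, sum_congr rfl fun j _ => cons_count j,
      ← sum_mul, Nat.factorial_succ, hL]

theorem ncard_wordsOf (m : ι → ℕ) : (wordsOf m).ncard = Nat.multinomial univ m :=
  Nat.eq_of_mul_eq_mul_left (prod_pos fun i _ => Nat.factorial_pos (m i))
    ((prod_factorial_mul_ncard_wordsOf m).trans (Nat.multinomial_spec univ m).symm)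

end CountWords

section Periodic

variable {α : Type*}

theorem rotate_gcd_length {w : List α} {s : ℕ} (h : w.rotate s = w) :
    w.rotate (s.gcd w.length) = w := by
  have rotate_mul : ∀ a, w.rotate (s * a) = w := by
    intro a
    induction a with
    | zero => simp
    | succ a ih => rw [Nat.mul_succ, ← List.rotate_rotate, ih, h]
  by_cases hlt : s.gcd w.length < w.length
  · obtain ⟨a, ha⟩ := Nat.exists_mul_mod_eq_gcd hlt
    rw [← ha.2, List.rotate_mod, rotate_mul]
  · obtain hnil | hpos := Nat.eq_zero_or_pos w.length
    · rw [List.length_eq_zero_iff.1 hnil, List.rotate_nil]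
    · rw [Nat.le_antisymm (Nat.gcd_le_right s hpos) (not_lt.1 hlt), List.rotate_length]

theorem flatten_replicate_append_self (u : List α) (d : ℕ) :
    (List.replicate d u).flatten ++ u = u ++ (List.replicate d u).flatten := by
  induction d with
  | zero => simp
  | succ d ih => rw [List.replicate_succ, List.flatten_cons, List.append_assoc, ih]

theorem eq_flatten_replicate_of_append_comm {u v : List α} {d : ℕ}
    (h : u ++ v = v ++ u) (hl : v.length = d * u.length) : v = (List.replicate d u).flatten := by
  induction d generalizing v with
  | zero => simpa using hl
  | succ d ih =>
    have length_le : u.length ≤ v.length := hl ▸ Nat.le_mul_of_pos_left _ d.succ_pos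
    obtain ⟨v', rfl⟩ : u <+: v :=
      List.prefix_of_prefix_length_le (List.prefix_append u v) (h ▸ List.prefix_append v u)
        length_le
    rw [List.append_assoc, List.append_cancel_left_eq] at h
    rw [List.length_append, Nat.succ_mul, Nat.add_comm, Nat.add_right_cancel_iff] at hl
    rw [List.replicate_succ, List.flatten_cons, ← ih h hl]

theorem eq_flatten_replicate_take {w : List α} {c d : ℕ} (hd : 0 < d)
    (hl : w.length = d * c) (h : w.rotate c = w) : w = (List.replicate d (w.take c)).flatten := by
  obtain ⟨d, rfl⟩ := Nat.exists_eq_succ_of_ne_zero hd.ne'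
  have length_take : (w.take c).length = c := by
    rw [List.length_take, hl]
    exact min_eq_left (Nat.le_mul_of_pos_left _ d.succ_pos)
  have drop_append_take : w = w.drop c ++ w.take c := by
    have rotate_eq := List.rotate_append_length_eq (w.take c) (w.drop c)
    rwa [length_take, List.take_append_drop, h] at rotate_eq
  have drop_eq : w.drop c = (List.replicate d (w.take c)).flatten := by
    refine eq_flatten_replicate_of_append_comm ?_ ?_
    · rw [List.take_append_drop, ← drop_append_take]
    · rw [length_take, List.length_drop, hl, Nat.succ_mul, Nat.add_sub_cancel]
  rw [List.replicate_succ, List.flatten_cons, ← drop_eq, List.take_append_drop]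

theorem rotate_flatten_replicate (u : List α) (d t : ℕ) :
    (List.replicate d u).flatten.rotate (u.length * t) = (List.replicate d u).flatten := by
  have rotate_length : (List.replicate d u).flatten.rotate u.length =
      (List.replicate d u).flatten := by
    cases d with
    | zero => simp
    | succ d =>
      rw [List.replicate_succ, List.flatten_cons, List.rotate_append_length_eq,
        flatten_replicate_append_self]
  induction t with
  | zero => simp
  | succ t ih => rw [Nat.mul_succ, ← List.rotate_rotate, ih, rotate_length]

theorem count_flatten_replicate [DecidableEq α] (u : List α) (d : ℕ) (i : α) :
    (List.replicate d u).flatten.count i = d * u.count i := by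
  rw [List.count_flatten, List.map_replicate, List.sum_replicate, smul_eq_mul]

end Periodic

section CountRotations

open Finset

theorem sum_smul_apply {ι : Type*} [Fintype ι] (d : ℕ) (b : ι → ℕ) :
    ∑ i, (d • b) i = d * ∑ i, b i := by
  simp [mul_sum]

theorem ncard_le_sum_tailRotate_fixed {ι : Type*} [Finite ι] [DecidableEq ι]
    {m : ι → ℕ} {N : ℕ} (hN : 0 < N) :
    (wordsOf m).ncard ≤
      ∑ s ∈ range N, {w ∈ wordsOf m | (tailRotatePerm ι ^ s) w = w}.ncard := by
  have fixed_zero : {w ∈ wordsOf m | (tailRotatePerm ι ^ 0) w = w} = wordsOf m :=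
    Set.ext fun _ => and_iff_left rfl
  conv_lhs => rw [← fixed_zero]
  exact single_le_sum (f := fun s => {w ∈ wordsOf m | (tailRotatePerm ι ^ s) w = w}.ncard)
    (fun _ _ => Nat.zero_le _) (mem_range.2 hN)

variable {ι : Type*} [Fintype ι] [DecidableEq ι] {m b : ι → ℕ}

theorem dvd_of_rotate_eq {s : ℕ} {w : List ι} (hw : w ∈ wordsOf m) (hm : 0 < ∑ i, m i)
    (h : w.rotate s = w) (i : ι) : (∑ i, m i) / s.gcd (∑ i, m i) ∣ m i := by
  have length_eq := length_of_mem_wordsOf hw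
  have rotate_gcd := rotate_gcd_length h
  rw [length_eq] at rotate_gcd
  have gcd_dvd : s.gcd (∑ i, m i) ∣ ∑ i, m i := Nat.gcd_dvd_right _ _
  have periodic := eq_flatten_replicate_take
    (Nat.div_pos (Nat.le_of_dvd hm gcd_dvd) (Nat.gcd_pos_of_pos_right _ hm))
    (length_eq.trans (Nat.div_mul_cancel gcd_dvd).symm) rotate_gcd
  rw [← mem_wordsOf.1 hw i, periodic, count_flatten_replicate]
  exact dvd_mul_right _ _

theorem ncard_rotate_fixed {d s : ℕ} (hd : 0 < d) (hs : s.gcd (∑ i, (d • b) i) = ∑ i, b i) :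
    {w ∈ wordsOf (d • b) | w.rotate s = w}.ncard = (wordsOf b).ncard := by
  symm
  refine Set.ncard_congr (fun u _ => (List.replicate d u).flatten) ?_ ?_ ?_
  · intro u hu
    refine ⟨mem_wordsOf.2 fun i => ?_, ?_⟩
    · rw [count_flatten_replicate, mem_wordsOf.1 hu i]
      rfl
    · obtain ⟨t, rfl⟩ : ∑ i, b i ∣ s := hs ▸ Nat.gcd_dvd_left _ _
      rw [← length_of_mem_wordsOf hu]
      exact rotate_flatten_replicate u d t
  · intro u v hu hv h
    obtain ⟨d, rfl⟩ := Nat.exists_eq_succ_of_ne_zero hd.ne'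
    rw [List.replicate_succ, List.replicate_succ, List.flatten_cons, List.flatten_cons] at h
    exact (List.append_inj h
      ((length_of_mem_wordsOf hu).trans (length_of_mem_wordsOf hv).symm)).1
  · rintro w ⟨hw, hr⟩
    have length_eq := length_of_mem_wordsOf hw
    have rotate_gcd := rotate_gcd_length hr
    rw [length_eq, hs] at rotate_gcd
    have periodic :=
      eq_flatten_replicate_take hd (length_eq.trans (sum_smul_apply d b)) rotate_gcd
    refine ⟨w.take (∑ i, b i), mem_wordsOf.2 fun i => ?_, periodic.symm⟩
    have count_eq := mem_wordsOf.1 hw i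
    rw [periodic, count_flatten_replicate] at count_eq
    exact Nat.eq_of_mul_eq_mul_left hd count_eq

theorem sum_dvd_of_rotate_eq {g s : ℕ} (hg : 0 < g) (hb : 0 < ∑ i, b i) (hcop : univ.gcd b = 1)
    {w : List ι} (hw : w ∈ wordsOf (g • b)) (h : w.rotate s = w) : ∑ i, b i ∣ s := by
  have sum_eq := sum_smul_apply g b
  have sum_pos : 0 < ∑ i, (g • b) i := sum_eq ▸ Nat.mul_pos hg hb
  have period_dvd := dvd_of_rotate_eq hw sum_pos h
  obtain ⟨d, hd⟩ : s.gcd (∑ i, (g • b) i) ∣ ∑ i, (g • b) i := Nat.gcd_dvd_right _ _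
  set c := s.gcd (∑ i, (g • b) i) with c_def
  have c_pos : 0 < c := Nat.gcd_pos_of_pos_right _ sum_pos
  rw [hd, Nat.mul_div_cancel_left _ c_pos] at period_dvd
  obtain ⟨e, rfl⟩ : d ∣ g := by
    have dvd_gcd : d ∣ univ.gcd fun i => g * b i := Finset.dvd_gcd fun i _ => period_dvd i
    rwa [Finset.gcd_mul_left, hcop, mul_one, normalize_eq] at dvd_gcd
  have c_eq : c = (∑ i, b i) * e := by
    refine Nat.eq_of_mul_eq_mul_right (Nat.pos_of_mul_pos_right hg) (hd.symm.trans ?_)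
    rw [sum_eq]
    ring
  exact (Dvd.intro _ c_eq.symm).trans (Nat.gcd_dvd_left _ _)

theorem sum_ncard_rotate_fixed {g : ℕ} (hg : 0 < g) (hb : 0 < ∑ i, b i)
    (hcop : univ.gcd b = 1) :
    ∑ s ∈ range (∑ i, (g • b) i), {w ∈ wordsOf (g • b) | w.rotate s = w}.ncard =
      ∑ j ∈ range g, (wordsOf (j.gcd g • b)).ncard := by
  have sum_eq := sum_smul_apply g b
  symm
  refine sum_of_injOn (fun j => (∑ i, b i) * j)
    (fun x _ y _ h => Nat.eq_of_mul_eq_mul_left hb h) ?_ ?_ ?_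
  · intro j hj
    rw [mem_coe, mem_range] at hj ⊢
    rw [sum_eq, mul_comm g]
    exact Nat.mul_lt_mul_of_pos_left hj hb
  · intro s hs not_mem_image
    rw [Set.ncard_eq_zero ((Set.toFinite (wordsOf (g • b))).subset fun w hw => hw.1),
      Set.eq_empty_iff_forall_notMem]
    rintro w ⟨hw, hr⟩
    obtain ⟨j, rfl⟩ := sum_dvd_of_rotate_eq hg hb hcop hw hr
    rw [mem_range, sum_eq, mul_comm g] at hs
    exact not_mem_image ⟨j, mem_coe.2 (mem_range.2 (Nat.lt_of_mul_lt_mul_left hs)), rfl⟩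
  · intro j _
    obtain ⟨d, hd⟩ := Nat.gcd_dvd_right j g
    have d_pos : 0 < d := Nat.pos_of_ne_zero fun h => hg.ne' (by rw [hd, h, mul_zero])
    have smul_eq : g • b = d • (j.gcd g • b) := by
      conv_lhs => rw [hd, mul_comm, mul_smul]
    rw [smul_eq]
    refine (ncard_rotate_fixed d_pos ?_).symm
    rw [← smul_eq, sum_eq, sum_smul_apply, mul_comm g, Nat.gcd_mul_left, mul_comm]

theorem sum_ncard_tailRotate_fixed {N : ℕ} (hN : 0 < N) (hm : ∑ i, m i = N + 1)
    (hcop : ∀ y, m y ≠ 0 → univ.gcd (m - Pi.single y 1 : ι → ℕ) = 1) :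
    ∑ s ∈ range N, {w ∈ wordsOf m | (tailRotatePerm ι ^ s) w = w}.ncard =
      (wordsOf m).ncard := by
  have fixed_zero : {w ∈ wordsOf m | (tailRotatePerm ι ^ 0) w = w} = wordsOf m :=
    Set.ext fun _ => and_iff_left rfl
  rw [sum_eq_single_of_mem 0 (mem_range.2 hN), fixed_zero]
  intro s hs hs0
  rw [Set.ncard_eq_zero ((Set.toFinite (wordsOf m)).subset fun w hw => hw.1),
    Set.eq_empty_iff_forall_notMem]
  rintro w ⟨hw, hr⟩
  match w, hw, hr with
  | [], hw, _ => exact ne_nil_of_mem_wordsOf (hm ▸ N.succ_pos) hw rfl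
  | y :: v, hw, hr =>
    obtain ⟨hy, hv⟩ := cons_mem_wordsOf.1 hw
    have sum_eq : ∑ i, (m - Pi.single y 1 : ι → ℕ) i = N :=
      Nat.succ_injective ((sum_sub_single_add_one hy).trans hm)
    rw [tailRotatePerm_pow_cons, List.cons.injEq] at hr
    have period_eq_one := Nat.dvd_one.1 (hcop y hy ▸ Finset.dvd_gcd fun i _ =>
      dvd_of_rotate_eq hv (sum_eq ▸ hN) hr.2 i)
    rw [sum_eq, Nat.div_eq_iff_eq_mul_left (Nat.gcd_pos_of_pos_right _ hN)
      (Nat.gcd_dvd_right _ _), one_mul] at period_eq_one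
    exact absurd (mem_range.1 hs) (not_lt.2
      (period_eq_one.le.trans (Nat.gcd_le_left N (Nat.pos_of_ne_zero hs0))))

end CountRotations

/-! ### Growth of multinomial coefficients -/

section Growth

open Finset

theorem add_le_choose {u v : ℕ} (hu : 1 ≤ u) (hv : 1 ≤ v) : u + v ≤ (u + v).choose u := by
  induction u, hu using Nat.le_induction with
  | base => rw [Nat.choose_one_right]
  | succ u _ ih =>
    have h1 : u + 1 + v = (u + v) + 1 := by ring
    have h2 : 0 < (u + v).choose (u + 1) := Nat.choose_pos (by omega)
    rw [h1, Nat.choose_succ_succ, Nat.succ_eq_add_one]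
    omega

theorem three_terms_le_choose {u v t : ℕ} (hu : 1 ≤ u) (ht : 1 ≤ t) :
    (u + v).choose u * (t * (u + v)).choose (t * u) +
      (u + v).choose (u - 1) * (t * (u + v)).choose (t * u + 1) +
      (u + v).choose (u + 1) * (t * (u + v)).choose (t * u - 1) ≤
      ((t + 1) * (u + v)).choose ((t + 1) * u) := by
  have htu : 1 ≤ t * u := Nat.mul_pos ht hu
  have h1 : (t + 1) * (u + v) = (u + v) + t * (u + v) := by ring
  have h2 : (t + 1) * u = u + t * u := by ring
  rw [h1, h2, Nat.add_choose_eq (u + v) (t * (u + v))]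
  have hsub : ({(u, t * u), (u - 1, t * u + 1), (u + 1, t * u - 1)} : Finset (ℕ × ℕ)) ⊆
      antidiagonal (u + t * u) := by
    intro x hx
    simp only [mem_insert, mem_singleton] at hx
    rw [HasAntidiagonal.mem_antidiagonal]
    rcases hx with rfl | rfl | rfl <;> simp only <;> omega
  refine le_trans (le_of_eq ?_) (sum_le_sum_of_subset (f := fun ij : ℕ × ℕ =>
    (u + v).choose ij.1 * (t * (u + v)).choose ij.2) hsub)
  rw [sum_insert, sum_insert, sum_singleton, add_assoc]
  · simp only [mem_singleton, Prod.mk.injEq]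
    omega
  · simp only [mem_insert, mem_singleton, Prod.mk.injEq]
    omega

theorem choose_mul_choose_le_pred {u v t : ℕ} (hu : 1 ≤ u) (ht : 1 ≤ t) :
    (u + v).choose u * (t * (u + v)).choose (t * u) * (u * v) ≤
      (u + 1) * (v + 1) * ((u + v).choose (u - 1) * (t * (u + v)).choose (t * u + 1)) := by
  obtain ⟨u, rfl⟩ := Nat.exists_eq_add_of_le' hu
  have choose_pred : (u + 1 + v).choose (u + 1) * (u + 1) = (u + 1 + v).choose u * (v + 1) := by
    rw [Nat.choose_succ_right_eq, Nat.add_assoc, Nat.add_sub_cancel_left, Nat.add_comm 1 v]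
  have choose_succ : (t * (u + 1 + v)).choose (t * (u + 1)) * (t * v) =
      (t * (u + 1 + v)).choose (t * (u + 1) + 1) * (t * (u + 1) + 1) := by
    rw [Nat.choose_succ_right_eq, ← Nat.mul_sub, Nat.add_sub_cancel_left]
  rw [Nat.add_sub_cancel]
  set c := (u + 1 + v).choose (u + 1)
  set c' := (u + 1 + v).choose u
  set d := (t * (u + 1 + v)).choose (t * (u + 1))
  set d' := (t * (u + 1 + v)).choose (t * (u + 1) + 1)
  refine Nat.le_of_mul_le_mul_left ?_ (Nat.lt_of_lt_of_le Nat.zero_lt_one ht)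
  calc t * (c * d * ((u + 1) * v)) = (c * (u + 1)) * (d * (t * v)) := by ring
    _ = (c' * (v + 1)) * (d' * (t * (u + 1) + 1)) := by rw [choose_pred, choose_succ]
    _ ≤ (c' * (v + 1)) * (d' * (t * (u + 1) + t)) := by gcongr
    _ = t * ((u + 1 + 1) * (v + 1) * (c' * d')) := by ring

theorem choose_mul_choose_le_succ {u v t : ℕ} (hu : 1 ≤ u) (hv : 1 ≤ v) (ht : 1 ≤ t) :
    (u + v).choose u * (t * (u + v)).choose (t * u) * (u * v) ≤
      (u + 1) * (v + 1) * ((u + v).choose (u + 1) * (t * (u + v)).choose (t * u - 1)) := by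
  have h := choose_mul_choose_le_pred (v := u) hv ht
  have htu : 1 ≤ t * u := Nat.mul_pos ht hu
  rw [Nat.add_comm v u, mul_comm v u, mul_comm (v + 1),
    Nat.choose_symm_of_eq_add (a := v) (b := u) (Nat.add_comm u v),
    Nat.choose_symm_of_eq_add (a := v - 1) (b := u + 1) (by omega),
    Nat.choose_symm_of_eq_add (a := t * v) (b := t * u) (by ring),
    Nat.choose_symm_of_eq_add (a := t * v + 1) (b := t * u - 1) (by rw [Nat.mul_add]; omega)] at h
  exact h

theorem choose_mul_choose_mul_le {u v t : ℕ} (hu : 1 ≤ u) (hv : 1 ≤ v) (ht : 1 ≤ t) :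
    (u + v).choose u * (t * (u + v)).choose (t * u) * (3 * (u * v) + (u + v) + 1) ≤
      (u + 1) * (v + 1) * ((t + 1) * (u + v)).choose ((t + 1) * u) := by
  have pred_le := choose_mul_choose_le_pred (v := v) hu ht
  have succ_le := choose_mul_choose_le_succ hu hv ht
  refine le_trans ?_ (Nat.mul_le_mul_left _ (three_terms_le_choose (v := v) hu ht))
  rw [mul_add, mul_add]
  linarith

theorem choose_smul_growth {u v t : ℕ} (hu : 1 ≤ u) (hv : 1 ≤ v) (ht : 1 ≤ t) :
    (2 * (u + v) - 1) * (t * (u + v)).choose (t * u) ≤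
      ((t + 1) * (u + v)).choose ((t + 1) * u) := by
  have h1 := choose_mul_choose_mul_le hu hv ht
  have h2 := add_le_choose hu hv
  obtain ⟨u, rfl⟩ := Nat.exists_eq_add_of_le' hu
  obtain ⟨v, rfl⟩ := Nat.exists_eq_add_of_le' hv
  refine Nat.le_of_mul_le_mul_left ?_ (show 0 < (u + 1 + 1) * (v + 1 + 1) by positivity)
  refine le_trans ?_ h1
  have h3 : 2 * (u + 1 + (v + 1)) - 1 = 2 * u + 2 * v + 3 := by omega
  rw [h3]
  set d := (t * (u + 1 + (v + 1))).choose (t * (u + 1))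
  calc (u + 1 + 1) * (v + 1 + 1) * ((2 * u + 2 * v + 3) * d)
      = d * ((u + 2) * (v + 2) * (2 * u + 2 * v + 3)) := by ring
    _ ≤ d * ((u + 1 + (v + 1)) * (3 * ((u + 1) * (v + 1)) + (u + 1 + (v + 1)) + 1)) := by
        refine Nat.mul_le_mul_left _ ?_
        zify
        nlinarith [mul_nonneg (mul_nonneg (Nat.cast_nonneg (α := ℤ) u)
          (Nat.cast_nonneg (α := ℤ) v)) (by positivity : (0 : ℤ) ≤ u + v + 3)]
    _ = (u + 1 + (v + 1)) * d * (3 * ((u + 1) * (v + 1)) + (u + 1 + (v + 1)) + 1) := by ring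
    _ ≤ _ := by gcongr

theorem choose_smul_growth_lt {u v t : ℕ} (hu : 2 ≤ u) (hv : 2 ≤ v) (ht : 1 ≤ t) :
    (2 * (u + v) - 1) * (t * (u + v)).choose (t * u) <
      ((t + 1) * (u + v)).choose ((t + 1) * u) := by
  have h1 := choose_mul_choose_mul_le (by omega : 1 ≤ u) (by omega : 1 ≤ v) ht
  have h2 := add_le_choose (by omega : 1 ≤ u) (by omega : 1 ≤ v)
  have hd : 0 < (t * (u + v)).choose (t * u) :=
    Nat.choose_pos (Nat.mul_le_mul_left _ (Nat.le_add_right _ _))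
  obtain ⟨u, rfl⟩ := Nat.exists_eq_add_of_le' hu
  obtain ⟨v, rfl⟩ := Nat.exists_eq_add_of_le' hv
  refine Nat.lt_of_mul_lt_mul_left (a := (u + 2 + 1) * (v + 2 + 1)) ?_
  refine lt_of_lt_of_le ?_ h1
  have h3 : 2 * (u + 2 + (v + 2)) - 1 = 2 * u + 2 * v + 7 := by omega
  rw [h3]
  set d := (t * (u + 2 + (v + 2))).choose (t * (u + 2))
  calc (u + 2 + 1) * (v + 2 + 1) * ((2 * u + 2 * v + 7) * d)
      = d * ((u + 3) * (v + 3) * (2 * u + 2 * v + 7)) := by ring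
    _ < d * ((u + 2 + (v + 2)) * (3 * ((u + 2) * (v + 2)) + (u + 2 + (v + 2)) + 1)) := by
        refine Nat.mul_lt_mul_of_pos_left ?_ hd
        zify
        nlinarith [mul_nonneg (mul_nonneg (Nat.cast_nonneg (α := ℤ) u)
          (Nat.cast_nonneg (α := ℤ) v)) (by positivity : (0 : ℤ) ≤ u + v + 5),
          mul_nonneg (Nat.cast_nonneg (α := ℤ) u) (Nat.cast_nonneg (α := ℤ) v),
          sq_nonneg ((u : ℤ)), sq_nonneg ((v : ℤ))]
    _ = (u + 2 + (v + 2)) * d * (3 * ((u + 2) * (v + 2)) + (u + 2 + (v + 2)) + 1) := by ring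
    _ ≤ _ := by gcongr

theorem choose_add_mono {x y x' y' : ℕ} (hx : x ≤ x') (hy : y ≤ y') :
    (x + y).choose x ≤ (x' + y').choose x' := by
  refine (Nat.choose_le_choose x (Nat.add_le_add_left hy x)).trans ?_
  rw [Nat.choose_symm_add, Nat.choose_symm_add]
  exact Nat.choose_le_choose y' (Nat.add_le_add_right hx y')

variable {α : Type*}

theorem multinomial_mono {s : Finset α} {f g : α → ℕ} (h : ∀ i, f i ≤ g i) :
    Nat.multinomial s f ≤ Nat.multinomial s g := by
  classical
  induction s using Finset.induction_on with
  | empty => simp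
  | insert a s ha ih =>
    rw [Nat.multinomial_insert ha, Nat.multinomial_insert ha]
    exact Nat.mul_le_mul (choose_add_mono (h a) (sum_le_sum fun i _ => h i)) ih

theorem multinomial_smul_eq [DecidableEq α] {s : Finset α} {i : α} (hi : i ∈ s) (b : α → ℕ)
    (t : ℕ) :
    Nat.multinomial s (t • b) = (t * (b i + ∑ l ∈ s.erase i, b l)).choose (t * b i) *
      Nat.multinomial (s.erase i) (t • b) := by
  conv_lhs => rw [← insert_erase hi]
  rw [Nat.multinomial_insert (notMem_erase i s)]
  simp [mul_add, mul_sum]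

theorem multinomial_growth {s : Finset α} {i j : α} (hi : i ∈ s) (hj : j ∈ s) (hij : i ≠ j)
    {b : α → ℕ} (hbi : 1 ≤ b i) (hbj : 1 ≤ b j) {t : ℕ} (ht : 1 ≤ t) :
    (2 * ∑ l ∈ s, b l - 1) * Nat.multinomial s (t • b) ≤ Nat.multinomial s ((t + 1) • b) := by
  classical
  have hv : 1 ≤ ∑ l ∈ s.erase i, b l :=
    hbj.trans (single_le_sum (f := b) (fun _ _ => Nat.zero_le _) (mem_erase.2 ⟨hij.symm, hj⟩))
  rw [multinomial_smul_eq hi, multinomial_smul_eq hi, ← add_sum_erase s b hi, ← mul_assoc]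
  refine Nat.mul_le_mul (choose_smul_growth hbi hv ht) (multinomial_mono fun l => ?_)
  exact Nat.mul_le_mul_right _ (Nat.le_succ t)

theorem multinomial_growth_lt_of_two [DecidableEq α] {s : Finset α} {i : α} (hi : i ∈ s)
    {b : α → ℕ} (hbi : 2 ≤ b i) (hb : 2 ≤ ∑ l ∈ s.erase i, b l) {t : ℕ} (ht : 1 ≤ t) :
    (2 * ∑ l ∈ s, b l - 1) * Nat.multinomial s (t • b) < Nat.multinomial s ((t + 1) • b) := by
  rw [multinomial_smul_eq hi, multinomial_smul_eq hi, ← add_sum_erase s b hi, ← mul_assoc]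
  refine Nat.mul_lt_mul_of_lt_of_le (choose_smul_growth_lt hbi hb ht) (multinomial_mono fun l => ?_)
    (Nat.multinomial_pos _ _)
  exact Nat.mul_le_mul_right _ (Nat.le_succ t)

theorem multinomial_growth_lt_of_three {s : Finset α} {i j l : α} (hi : i ∈ s) (hj : j ∈ s)
    (hl : l ∈ s) (hij : i ≠ j) (hil : i ≠ l) (hjl : j ≠ l)
    {b : α → ℕ} (hbi : 1 ≤ b i) (hbj : 1 ≤ b j) (hbl : 1 ≤ b l) {t : ℕ} (ht : 1 ≤ t) :
    (2 * ∑ l ∈ s, b l - 1) * Nat.multinomial s (t • b) < Nat.multinomial s ((t + 1) • b) := by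
  classical
  have hj' : j ∈ s.erase i := mem_erase.2 ⟨hij.symm, hj⟩
  have hl' : l ∈ s.erase i := mem_erase.2 ⟨hil.symm, hl⟩
  have hv : b j + b l ≤ ∑ l ∈ s.erase i, b l := by
    rw [← sum_pair hjl]
    exact sum_le_sum_of_subset (by
      intro x hx
      rcases mem_insert.1 hx with rfl | hx
      · exact hj'
      · rw [mem_singleton.1 hx]
        exact hl')
  have h := multinomial_growth hj' hl' hjl hbj hbl ht
  have hpos := Nat.multinomial_pos (s.erase i) (t • b)
  rw [multinomial_smul_eq hi, multinomial_smul_eq hi, ← add_sum_erase s b hi, ← mul_assoc]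
  refine Nat.mul_lt_mul_of_le_of_lt (choose_smul_growth hbi (by omega) ht) ?_ ?_
  · refine lt_of_lt_of_le ?_ h
    refine lt_of_eq_of_lt (one_mul _).symm (Nat.mul_lt_mul_of_pos_right ?_ hpos)
    omega
  · exact Nat.choose_pos (Nat.mul_le_mul_left _ (Nat.le_add_right _ _))

theorem multinomial_pair [Fintype α] [DecidableEq α] {i j : α} (hij : i ≠ j) (c d : ℕ) :
    Nat.multinomial univ (Pi.single i c + Pi.single j d) = (c + d).choose c := by
  have := Nat.multinomial_congr_of_sdiff (s := {i, j}) (t := univ)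
    (f := (Pi.single i c + Pi.single j d : α → ℕ)) (g := Pi.single i c + Pi.single j d)
    (subset_univ _) (fun a ha => ?_) (fun _ _ => rfl)
  · rw [← this, Nat.binomial_eq_choose hij]
    simp [hij, hij.symm]
  · simp only [mem_sdiff, mem_univ, true_and, mem_insert, mem_singleton, not_or] at ha
    simp [ha.1, ha.2]

section NecklaceEstimate

variable {f : ℕ → ℕ} {g h r : ℕ}

theorem pow_mul_le_of_growth (hf : ∀ t, 1 ≤ t → r * f t ≤ f (t + 1)) (hh : 1 ≤ h) (s : ℕ) :
    r ^ s * f h ≤ f (h + s) := by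
  induction s with
  | zero => simp
  | succ s ih =>
    calc r ^ (s + 1) * f h = r * (r ^ s * f h) := by ring
      _ ≤ r * f (h + s) := Nat.mul_le_mul_left _ ih
      _ ≤ f (h + (s + 1)) := hf _ (by omega)

theorem monotoneOn_of_growth (hf : ∀ t, 1 ≤ t → 3 * f t ≤ f (t + 1)) :
    MonotoneOn f (Set.Ici 1) := by
  intro s hs t _ hst
  induction t, hst using Nat.le_induction with
  | base => exact le_rfl
  | succ t hst ih =>
    have ht : 1 ≤ t := le_trans hs hst
    exact (ih ht).trans (le_trans (Nat.le_mul_of_pos_left _ three_pos) (hf t ht))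

theorem two_mul_sum_add_le_of_growth (hf : ∀ t, 1 ≤ t → 3 * f t ≤ f (t + 1)) (hh : 1 ≤ h) :
    2 * ∑ j ∈ Ico 1 (h + 1), f j + f 1 ≤ 3 * f h := by
  induction h, hh using Nat.le_induction with
  | base => rw [sum_Ico_succ_top le_rfl, Ico_self, sum_empty]; omega
  | succ h hh ih =>
    rw [sum_Ico_succ_top (by omega)]
    have := hf h hh
    omega

theorem sum_Ico_gcd_le (hf : MonotoneOn f (Set.Ici 1)) (g h : ℕ) :
    ∑ j ∈ Ico 1 h, f (j.gcd g) ≤ ∑ j ∈ Ico 1 h, f j := by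
  refine sum_le_sum fun j hj => ?_
  have hj1 : 0 < j := (mem_Ico.1 hj).1
  exact hf (Nat.gcd_pos_of_pos_left _ hj1) hj1 (Nat.gcd_le_left _ hj1)

theorem sum_Ico_gcd_le_reflect (hf : MonotoneOn f (Set.Ici 1)) (g h : ℕ) :
    ∑ j ∈ Ico (h + 1) g, f (j.gcd g) ≤ ∑ j ∈ Ico 1 (g - h), f j := by
  have reflect := sum_Ico_reflect f (h + 1) (m := g) (n := g) (by omega)
  rw [Nat.add_sub_cancel_left, Nat.add_sub_add_right] at reflect
  rw [← reflect]
  refine sum_le_sum fun j hj => ?_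
  have hj1 := mem_Ico.1 hj
  have sub_pos : 0 < g - j := Nat.sub_pos_of_lt hj1.2
  exact hf (Nat.gcd_pos_of_pos_left _ (Nat.zero_lt_of_lt hj1.1)) sub_pos
    (Nat.le_of_dvd sub_pos (Nat.dvd_sub (Nat.gcd_dvd_right _ _) (Nat.gcd_dvd_left _ _)))

theorem sum_gcd_even_lt (hf : ∀ t, 1 ≤ t → 3 * f t ≤ f (t + 1)) (hf1 : 1 ≤ f 1) (hh : 1 ≤ h) :
    ∑ j ∈ Ico 1 (2 * h), f (j.gcd (2 * h)) < 2 * f h := by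
  have lower := sum_Ico_gcd_le (monotoneOn_of_growth hf) (2 * h) h
  have upper := sum_Ico_gcd_le_reflect (monotoneOn_of_growth hf) (2 * h) h
  have sum_le := two_mul_sum_add_le_of_growth hf hh
  rw [show 2 * h - h = h by omega] at upper
  rw [sum_Ico_succ_top hh] at sum_le
  rw [← sum_Ico_consecutive _ (by omega : 1 ≤ h + 1) (by omega : h + 1 ≤ 2 * h),
    sum_Ico_succ_top hh, Nat.gcd_mul_left_right]
  omega

theorem sum_gcd_odd_lt (hf : ∀ t, 1 ≤ t → 3 * f t ≤ f (t + 1)) (hf1 : 1 ≤ f 1) (hh : 1 ≤ h) :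
    ∑ j ∈ Ico 1 (2 * h + 1), f (j.gcd (2 * h + 1)) < 3 * f h := by
  have lower := sum_Ico_gcd_le (monotoneOn_of_growth hf) (2 * h + 1) (h + 1)
  have upper := sum_Ico_gcd_le_reflect (monotoneOn_of_growth hf) (2 * h + 1) h
  have sum_le := two_mul_sum_add_le_of_growth hf hh
  rw [show 2 * h + 1 - h = h + 1 by omega] at upper
  rw [← sum_Ico_consecutive _ (by omega : 1 ≤ h + 1) (by omega : h + 1 ≤ 2 * h + 1)]
  omega

theorem four_mul_le_pow {β : ℕ} (hh : 2 ≤ h) (hβ : β = 0 → h ≠ 2) :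
    2 * h * (β + 2) * 2 ≤ (2 * β + 3) ^ h + 2 := by
  obtain rfl | hh3 := Nat.eq_or_lt_of_le hh
  · have : 1 ≤ β := Nat.one_le_iff_ne_zero.2 fun h => hβ h rfl
    nlinarith
  · induction h, hh3 using Nat.le_induction with
    | base => nlinarith [sq_nonneg β]
    | succ h hh3 ih =>
      have := ih (by omega) (by omega)
      rw [pow_succ]
      nlinarith [Nat.zero_le (β * (2 * β + 3) ^ h)]

theorem six_mul_le_pow {β : ℕ} (hh : 1 ≤ h) (hβ : β = 0 → h ≠ 1) :
    (2 * h + 1) * (β + 2) * 3 ≤ (2 * β + 3) ^ (h + 1) + 3 := by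
  obtain rfl | hh2 := Nat.eq_or_lt_of_le hh
  · obtain ⟨γ, rfl⟩ := Nat.exists_eq_succ_of_ne_zero fun h => hβ h rfl
    have expand : (2 * (γ + 1) + 3) ^ (1 + 1) + 3 = 4 * γ ^ 2 + 20 * γ + 28 := by ring
    rw [Nat.succ_eq_add_one, expand]
    nlinarith [Nat.zero_le (γ ^ 2)]
  · induction h, hh2 using Nat.le_induction with
    | base =>
      have expand : (2 * β + 3) ^ (2 + 1) + 3 = 8 * β ^ 3 + 36 * β ^ 2 + 54 * β + 30 := by ring
      rw [Nat.succ_eq_add_one, one_add_one_eq_two, expand]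
      nlinarith [Nat.zero_le (β ^ 3), Nat.zero_le (β ^ 2)]
    | succ h hh2 ih =>
      have := ih (by omega) (by omega)
      rw [pow_succ]
      nlinarith [Nat.zero_le (β * (2 * β + 3) ^ (h + 1))]

theorem mul_lt_add_of_lt_mul {L S C p x y : ℕ} (hL : 2 ≤ L) (hS : S < C * x) (hp : p * x ≤ y)
    (hC : L * C ≤ p + C) : L * S < y + S := by
  obtain ⟨l, rfl⟩ := Nat.exists_eq_add_of_le' hL
  have hC' : (l + 1) * C ≤ p := by linarith
  calc (l + 2) * S = (l + 1) * S + S := by ring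
    _ < (l + 1) * (C * x) + S := by gcongr
    _ = (l + 1) * C * x + S := by rw [mul_assoc]
    _ ≤ p * x + S := by gcongr
    _ ≤ y + S := by gcongr

/-- In the application `f t` is the number of words of degree `t b` with `|b| = B`, and the sums
count the words of degree `g b` fixed by rotations. Equality holds in the exceptional degrees, which
`h2`, `h3` and `h4` exclude. -/
theorem mul_sum_gcd_lt {B : ℕ} (hB : 2 ≤ B) (hg : 1 ≤ g) (hf1 : 1 ≤ f 1)
    (hf : ∀ t, 1 ≤ t → (2 * B - 1) * f t ≤ f (t + 1)) (h2 : g = 2 → (2 * B - 1) * f 1 < f 2)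
    (h3 : B = 2 → g ≠ 3) (h4 : B = 2 → g ≠ 4) :
    g * B * ∑ j ∈ Ico 1 g, f (j.gcd g) < f g + ∑ j ∈ Ico 1 g, f (j.gcd g) := by
  obtain ⟨β, rfl⟩ := Nat.exists_eq_add_of_le' hB
  rw [show 2 * (β + 2) - 1 = 2 * β + 3 by omega] at hf h2
  have triple : ∀ t, 1 ≤ t → 3 * f t ≤ f (t + 1) := fun t ht =>
    (Nat.mul_le_mul_right _ (Nat.le_add_left 3 _)).trans (hf t ht)
  have two_le : 2 ≤ g * (β + 2) := Nat.mul_le_mul hg (Nat.le_add_left 2 β)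
  obtain ⟨h, rfl | rfl⟩ := Nat.even_or_odd' g
  · obtain rfl | hh := Nat.eq_or_lt_of_le (show 1 ≤ h by omega)
    · have := h2 rfl
      simp only [mul_one, Nat.Ico_succ_singleton, sum_singleton, Nat.gcd_one_left]
      linarith
    · have growth := pow_mul_le_of_growth hf hh.le h
      rw [← two_mul] at growth
      exact mul_lt_add_of_lt_mul two_le (sum_gcd_even_lt triple hf1 hh.le) growth
        (four_mul_le_pow hh fun hβ hh2 => h4 (by omega) (by omega))
  · obtain rfl | hh := Nat.eq_zero_or_pos h
    · simp only [mul_zero, zero_add, Ico_self, sum_empty, add_zero]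
      exact hf1
    · have growth := pow_mul_le_of_growth hf hh (h + 1)
      rw [← Nat.add_assoc, ← two_mul] at growth
      exact mul_lt_add_of_lt_mul two_le (sum_gcd_odd_lt triple hf1 hh) growth
        (six_mul_le_pow hh fun hβ hh1 => h3 (by omega) (by omega))

end NecklaceEstimate

end Growth

/-! ### Exceptional degrees -/

section Pairs

open Finset

theorem add_le_sum_of_ne {ι : Type*} [Fintype ι] {i j : ι} (hij : i ≠ j) (b : ι → ℕ) :
    b i + b j ≤ ∑ l, b l := by
  classical
  rw [← sum_pair hij]
  exact sum_le_sum_of_subset (subset_univ _)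

theorem exists_eq_smul_gcd_eq_one {ι : Type*} [Fintype ι] {m : ι → ℕ}
    (hm : 0 < ∑ l, m l) : ∃ g b, 0 < g ∧ m = g • b ∧ univ.gcd b = 1 := by
  obtain ⟨i, -, hi⟩ : ∃ i ∈ univ, m i ≠ 0 := exists_ne_zero_of_sum_ne_zero hm.ne'
  obtain ⟨b, hb, hb1⟩ := Finset.extract_gcd m ⟨i, mem_univ i⟩
  have gcd_ne_zero : univ.gcd m ≠ 0 := fun h => hi (Finset.gcd_eq_zero_iff.1 h i (mem_univ i))
  exact ⟨univ.gcd m, b, Nat.pos_of_ne_zero gcd_ne_zero, funext fun i => hb i (mem_univ i), hb1⟩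

variable {ι : Type*} [DecidableEq ι] {b m : ι → ℕ} {i j : ι}

/-- The exceptional degrees which are supported on two indices. -/
def IsExceptionalPair (m : ι → ℕ) : Prop :=
  (∃ i j : ι, i ≠ j ∧ ∃ c : ℕ, 1 ≤ c ∧ m = Pi.single i 2 + Pi.single j (2 * c)) ∨
  (∃ i j : ι, i ≠ j ∧
    (m = Pi.single i 3 + Pi.single j 3 ∨ m = Pi.single i 4 + Pi.single j 4))

theorem smul_pair (t c d : ℕ) (i j : ι) :
    t • (Pi.single i c + Pi.single j d : ι → ℕ) =
      Pi.single i (t * c) + Pi.single j (t * d) := by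
  rw [smul_add, ← Pi.single_smul, ← Pi.single_smul, smul_eq_mul, smul_eq_mul]

theorem eq_pair_of_forall (hij : i ≠ j) (h : ∀ l, l ≠ i → l ≠ j → b l = 0) :
    b = Pi.single i (b i) + Pi.single j (b j) := by
  ext l
  obtain rfl | hi := eq_or_ne l i
  · simp [hij]
  obtain rfl | hj := eq_or_ne l j
  · simp [hi]
  · simp [hi, hj, h l hi hj]

theorem pair_ne_single (hij : i ≠ j) (hi : m i ≠ 0) (hj : m j ≠ 0) (l : ι) (c : ℕ) :
    m ≠ Pi.single l c := by
  rintro rfl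
  obtain rfl | hil := eq_or_ne i l
  · simp [hij.symm] at hj
  · simp [hil] at hi

theorem not_isExceptionalPair_single (i : ι) (c : ℕ) :
    ¬ IsExceptionalPair (Pi.single i c : ι → ℕ) := by
  have ne_pair : ∀ (l j : ι) (d e : ℕ), l ≠ j → d ≠ 0 → e ≠ 0 →
      (Pi.single i c : ι → ℕ) ≠ Pi.single l d + Pi.single j e := fun l j d e hlj hd he h =>
    pair_ne_single hlj (by simp [hlj, hd]) (by simp [hlj.symm, he]) i c h.symm
  rintro (⟨l, j, hlj, d, hd, e⟩ | ⟨l, j, hlj, e | e⟩)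
  · exact ne_pair l j _ _ hlj (by norm_num) (by omega) e
  · exact ne_pair l j _ _ hlj (by norm_num) (by norm_num) e
  · exact ne_pair l j _ _ hlj (by norm_num) (by norm_num) e

theorem exists_mul_pred_ne_zero {k : Type*} [Field k] (h2 : (2 : k) ≠ 0) (h3 : (3 : k) ≠ 0)
    (hex : IsExceptionalPair m) : ∃ i, ((m i * (m i - 1) : ℕ) : k) ≠ 0 := by
  have six_ne : (6 : k) ≠ 0 := by
    rw [show (6 : k) = 3 * 2 by norm_num]
    exact mul_ne_zero h3 h2
  have twelve_ne : (12 : k) ≠ 0 := by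
    rw [show (12 : k) = 6 * 2 by norm_num]
    exact mul_ne_zero six_ne h2
  rcases hex with ⟨i, j, hij, c, _, rfl⟩ | ⟨i, j, hij, rfl | rfl⟩
  · exact ⟨i, by simpa [hij] using h2⟩
  · exact ⟨i, by simpa [hij] using six_ne⟩
  · exact ⟨i, by simpa [hij] using twelve_ne⟩

variable [Fintype ι]

theorem sum_pair_apply (i j : ι) (c d : ℕ) :
    ∑ l, (Pi.single i c + Pi.single j d : ι → ℕ) l = c + d := by
  simp [sum_add_distrib]

theorem gcd_pair (hij : i ≠ j) (c d : ℕ) :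
    univ.gcd (Pi.single i c + Pi.single j d : ι → ℕ) = c.gcd d := by
  have apply_left : (Pi.single i c + Pi.single j d : ι → ℕ) i = c := by simp [hij]
  have apply_right : (Pi.single i c + Pi.single j d : ι → ℕ) j = d := by simp [hij.symm]
  refine Nat.dvd_antisymm (Nat.dvd_gcd ?_ ?_) (Finset.dvd_gcd fun l _ => ?_)
  · exact (Finset.gcd_dvd (mem_univ i)).trans apply_left.dvd
  · exact (Finset.gcd_dvd (mem_univ j)).trans apply_right.dvd
  · rw [Pi.add_apply, Pi.single_apply, Pi.single_apply]
    exact dvd_add (by split_ifs <;> simp [Nat.gcd_dvd_left])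
      (by split_ifs <;> simp [Nat.gcd_dvd_right])

theorem gcd_pair_sub_single (hij : i ≠ j) {c d : ℕ} (hc : Nat.Coprime (c - 1) d)
    (hd : Nat.Coprime c (d - 1)) (y : ι)
    (hy : (Pi.single i c + Pi.single j d : ι → ℕ) y ≠ 0) :
    univ.gcd (Pi.single i c + Pi.single j d - Pi.single y 1 : ι → ℕ) = 1 := by
  obtain rfl | hyi := eq_or_ne y i
  · have eq_pair := eq_pair_of_forall hij
      (b := (Pi.single y c + Pi.single j d - Pi.single y 1 : ι → ℕ))
      fun l hl hl' => by simp [hl, hl']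
    rw [eq_pair, gcd_pair hij]
    simpa [hij, hij.symm] using hc
  obtain rfl | hyj := eq_or_ne y j
  · have eq_pair := eq_pair_of_forall hij
      (b := (Pi.single i c + Pi.single y d - Pi.single y 1 : ι → ℕ))
      fun l hl hl' => by simp [hl, hl']
    rw [eq_pair, gcd_pair hij]
    simpa [hij, hij.symm] using hd
  · simp [hyi, hyj] at hy

theorem eq_pair_of_sum_eq_two (hij : i ≠ j) (hi : 1 ≤ b i) (hj : 1 ≤ b j)
    (hb : ∑ l, b l = 2) : b = Pi.single i 1 + Pi.single j 1 := by
  have hle := add_le_sum_of_ne hij b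
  have h := eq_pair_of_forall hij (b := b) fun l hli hlj => by
    have hle3 : ∑ x ∈ {l, i, j}, b x ≤ ∑ x, b x := sum_le_sum_of_subset (subset_univ _)
    rw [sum_insert (by simp [hli, hlj]), sum_pair hij] at hle3
    omega
  rw [h, show b i = 1 by omega, show b j = 1 by omega]

theorem exists_eq_single_or_pair (hm : 0 < ∑ l, m l) :
    (∃ i, m = Pi.single i (∑ l, m l)) ∨ ∃ i j, i ≠ j ∧ m i ≠ 0 ∧ m j ≠ 0 := by
  obtain ⟨i, -, hi⟩ : ∃ i ∈ univ, m i ≠ 0 := exists_ne_zero_of_sum_ne_zero hm.ne'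
  by_cases h : ∃ j, i ≠ j ∧ m j ≠ 0
  · obtain ⟨j, hij, hj⟩ := h
    exact Or.inr ⟨i, j, hij, hi, hj⟩
  · push Not at h
    refine Or.inl ⟨i, ?_⟩
    rw [Fintype.sum_eq_single i fun l hl => h l hl.symm]
    ext l
    obtain rfl | hl := eq_or_ne l i
    · rw [Pi.single_eq_same]
    · rw [Pi.single_eq_of_ne hl, h l hl.symm]

theorem multinomial_growth_lt_of_not_isExceptionalPair (hij : i ≠ j) (hi : 1 ≤ b i) (hj : 1 ≤ b j)
    (hex : ¬ IsExceptionalPair (2 • b)) :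
    (2 * ∑ l, b l - 1) * Nat.multinomial univ (1 • b) < Nat.multinomial univ (2 • b) := by
  by_cases h : ∃ l, l ≠ i ∧ l ≠ j ∧ 1 ≤ b l
  · obtain ⟨l, hli, hlj, hl⟩ := h
    exact multinomial_growth_lt_of_three (mem_univ i) (mem_univ j) (mem_univ l) hij hli.symm
      hlj.symm hi hj hl le_rfl
  · have hb := eq_pair_of_forall hij (b := b) fun l hli hlj => by
      by_contra h0
      exact h ⟨l, hli, hlj, Nat.one_le_iff_ne_zero.2 h0⟩
    have hi2 : 2 ≤ b i := by
      by_contra! hlt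
      refine hex (Or.inl ⟨i, j, hij, b j, hj, ?_⟩)
      conv_lhs => rw [hb, smul_pair, show b i = 1 by omega]
    have hj2 : 2 ≤ b j := by
      by_contra! hlt
      refine hex (Or.inl ⟨j, i, hij.symm, b i, hi, ?_⟩)
      conv_lhs => rw [hb, smul_pair, show b j = 1 by omega, add_comm]
    exact multinomial_growth_lt_of_two (mem_univ i) hi2 (hj2.trans
      (single_le_sum (f := b) (fun _ _ => Nat.zero_le _)
        (mem_erase.2 ⟨hij.symm, mem_univ j⟩))) le_rfl

theorem mul_sum_gcd_multinomial_lt (hij : i ≠ j) (hi : 1 ≤ b i) (hj : 1 ≤ b j) {g : ℕ}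
    (hg : 0 < g) (hex : ¬ IsExceptionalPair (g • b)) :
    (∑ l, (g • b) l) * ∑ t ∈ Ico 1 g, Nat.multinomial univ (t.gcd g • b) <
      Nat.multinomial univ (g • b) + ∑ t ∈ Ico 1 g, Nat.multinomial univ (t.gcd g • b) := by
  have two_le : 2 ≤ ∑ l, b l := le_trans (by omega) (add_le_sum_of_ne hij b)
  rw [sum_smul_apply]
  refine mul_sum_gcd_lt (f := fun t => Nat.multinomial univ (t • b)) two_le hg
    (Nat.multinomial_pos _ _)
    (fun t ht => multinomial_growth (mem_univ i) (mem_univ j) hij hi hj ht) ?_ ?_ ?_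
  · rintro rfl
    exact multinomial_growth_lt_of_not_isExceptionalPair hij hi hj hex
  · rintro hB2 rfl
    rw [eq_pair_of_sum_eq_two hij hi hj hB2] at hex
    exact hex (Or.inr ⟨i, j, hij, Or.inl (smul_pair _ _ _ _ _)⟩)
  · rintro hB2 rfl
    rw [eq_pair_of_sum_eq_two hij hi hj hB2] at hex
    exact hex (Or.inr ⟨i, j, hij, Or.inr (smul_pair _ _ _ _ _)⟩)

end Pairs

section Comparison

open Finset

variable {n : ℕ} {k : Type*} [Field k] {q : k} {a : Matrix (Fin n) (Fin n) ℤ} {b m : Fin n → ℕ}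
  {i j : Fin n} {g : ℕ}

theorem sum_mul_finrank_ker_id_sub_braidRot (hq0 : q ≠ 0) (hq : ∀ N : ℕ, 0 < N → q ^ N ≠ 1)
    (hg : 0 < g) (hb : 0 < ∑ l, b l) (hcop : univ.gcd b = 1)
    (hK : quadForm a (g • b) = linForm a (g • b)) :
    (∑ l, (g • b) l) * Module.finrank k
        ↥(component k (g • b) ⊓ LinearMap.ker (LinearMap.id - braidRot (powerMatrix q a))) =
      Nat.multinomial univ (g • b) + ∑ t ∈ Ico 1 g, Nat.multinomial univ (t.gcd g • b) := by
  have deg_pos : 0 < totalDegree (g • b) := by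
    rw [totalDegree, sum_smul_apply]
    exact Nat.mul_pos hg hb
  refine (mul_finrank_ker_id_sub_braidRot hq0 hq deg_pos hK).trans
    ((sum_ncard_rotate_fixed hg hb hcop).trans ?_)
  rw [range_eq_Ico, sum_eq_sum_Ico_succ_bot hg, Nat.gcd_zero_left]
  simp only [ncard_wordsOf, zero_add]

theorem finrank_ker_braidRot_lt (hq0 : q ≠ 0) (hq : ∀ N : ℕ, 0 < N → q ^ N ≠ 1) (hij : i ≠ j)
    (hi : m i ≠ 0) (hj : m j ≠ 0) (hex : ¬ IsExceptionalPair m)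
    (hKm : quadForm a m = linForm a m) :
    Module.finrank k
        ↥(component k m ⊓ LinearMap.ker (LinearMap.id - braidRot (powerMatrix q a))) <
      Module.finrank k
        ↥(component k m ⊓ LinearMap.ker (LinearMap.id - tailBraidRot (powerMatrix q a))) := by
  have two_le : 2 ≤ ∑ l, m l := le_trans (by omega) (add_le_sum_of_ne hij m)
  obtain ⟨N, hN⟩ : ∃ N, ∑ l, m l = N + 1 := Nat.exists_eq_succ_of_ne_zero (by omega)
  have tail_le := (ncard_le_sum_tailRotate_fixed (m := m) (N := N) (by omega)).trans_eq
    (mul_finrank_ker_id_sub_tailBraidRot hq0 hq (by omega) hN hKm).symm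
  rw [ncard_wordsOf] at tail_le
  obtain ⟨g, b, hg, rfl, hcop⟩ := exists_eq_smul_gcd_eq_one (m := m) (by omega)
  have hbi : 1 ≤ b i := Nat.one_le_iff_ne_zero.2 fun h => hi (by simp [h])
  have hbj : 1 ≤ b j := Nat.one_le_iff_ne_zero.2 fun h => hj (by simp [h])
  have rot_eq := sum_mul_finrank_ker_id_sub_braidRot hq0 hq hg
    (by have := add_le_sum_of_ne hij b; omega) hcop hKm
  have estimate := mul_sum_gcd_multinomial_lt hij hbi hbj hg hex
  rw [← rot_eq] at estimate
  have sum_lt := Nat.lt_of_mul_lt_mul_left estimate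
  rw [hN, Nat.succ_mul] at rot_eq
  exact Nat.lt_of_mul_lt_mul_left (a := N) (by omega)

theorem finrank_ker_braidRot_eq (hq0 : q ≠ 0) (hq : ∀ N : ℕ, 0 < N → q ^ N ≠ 1) (hg : 0 < g)
    (hcop : univ.gcd b = 1) (htail : ∀ y, (g • b) y ≠ 0 →
      univ.gcd (g • b - Pi.single y 1 : Fin n → ℕ) = 1) (hdeg : 2 ≤ ∑ l, (g • b) l)
    (hsum : (∑ l, (g • b) l) * ∑ t ∈ Ico 1 g, Nat.multinomial univ (t.gcd g • b) =
      Nat.multinomial univ (g • b) + ∑ t ∈ Ico 1 g, Nat.multinomial univ (t.gcd g • b))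
    (hK : quadForm a (g • b) = linForm a (g • b)) :
    Module.finrank k
        ↥(component k (g • b) ⊓ LinearMap.ker (LinearMap.id - braidRot (powerMatrix q a))) =
      Module.finrank k
        ↥(component k (g • b) ⊓ LinearMap.ker (LinearMap.id - tailBraidRot (powerMatrix q a))) := by
  obtain ⟨N, hN⟩ : ∃ N, ∑ l, (g • b) l = N + 1 := Nat.exists_eq_succ_of_ne_zero (by omega)
  have N_pos : 0 < N := by omega
  have tail_eq := (mul_finrank_ker_id_sub_tailBraidRot hq0 hq N_pos hN hK).trans
    ((sum_ncard_tailRotate_fixed N_pos hN htail).trans (ncard_wordsOf _))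
  have b_pos : 0 < ∑ l, b l := by
    rw [sum_smul_apply] at hdeg
    exact Nat.pos_of_mul_pos_left (a := g) (by omega)
  have rot_eq := sum_mul_finrank_ker_id_sub_braidRot hq0 hq hg b_pos hcop hK
  have finrank_eq := Nat.eq_of_mul_eq_mul_left (by omega) (rot_eq.trans hsum.symm)
  rw [hN, Nat.succ_mul, finrank_eq] at rot_eq
  rw [finrank_eq]
  exact Nat.eq_of_mul_eq_mul_left N_pos (by omega)

theorem finrank_ker_braidRot_eq_of_pair (hq0 : q ≠ 0) (hq : ∀ N : ℕ, 0 < N → q ^ N ≠ 1)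
    (hij : i ≠ j) {e : ℕ} (hg : 0 < g) (he : 0 < e) (hcop : Nat.Coprime (g - 1) e)
    (hsum : (g + g * e) * ∑ t ∈ Ico 1 g, (t.gcd g + t.gcd g * e).choose (t.gcd g) =
      (g + g * e).choose g + ∑ t ∈ Ico 1 g, (t.gcd g + t.gcd g * e).choose (t.gcd g))
    (hm : m = Pi.single i g + Pi.single j (g * e)) (hKm : quadForm a m = linForm a m) :
    Module.finrank k
        ↥(component k m ⊓ LinearMap.ker (LinearMap.id - braidRot (powerMatrix q a))) =
      Module.finrank k
        ↥(component k m ⊓ LinearMap.ker (LinearMap.id - tailBraidRot (powerMatrix q a))) := by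
  have smul_eq : ∀ t : ℕ, t • (Pi.single i 1 + Pi.single j e : Fin n → ℕ) =
      Pi.single i t + Pi.single j (t * e) := fun t => by rw [smul_pair, mul_one]
  have ge_pos : 0 < g * e := Nat.mul_pos hg he
  have tail_left : Nat.Coprime (g - 1) (g * e) := by
    refine Nat.Coprime.mul_right ?_ hcop
    exact (Nat.coprime_self_sub_left hg).2 (Nat.coprime_one_left g)
  have tail_right : Nat.Coprime g (g * e - 1) := by
    refine Nat.Coprime.coprime_mul_right (k := e) ?_
    exact (Nat.coprime_self_sub_right ge_pos).2 (Nat.coprime_one_right _)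
  rw [hm, ← smul_eq] at hKm ⊢
  refine finrank_ker_braidRot_eq hq0 hq hg ?_ ?_ ?_ ?_ hKm
  · rw [gcd_pair hij, Nat.gcd_one_left]
  · rw [smul_eq]
    exact gcd_pair_sub_single hij tail_left tail_right
  · rw [smul_eq, sum_pair_apply]
    omega
  · simp only [smul_eq, sum_pair_apply, multinomial_pair hij]
    exact hsum

theorem finrank_ker_braidRot_eq_of_isExceptionalPair (hq0 : q ≠ 0)
    (hq : ∀ N : ℕ, 0 < N → q ^ N ≠ 1) (hex : IsExceptionalPair m)
    (hKm : quadForm a m = linForm a m) :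
    Module.finrank k
        ↥(component k m ⊓ LinearMap.ker (LinearMap.id - braidRot (powerMatrix q a))) =
      Module.finrank k
        ↥(component k m ⊓ LinearMap.ker (LinearMap.id - tailBraidRot (powerMatrix q a))) := by
  rcases hex with ⟨i, j, hij, c, hc, hm⟩ | ⟨i, j, hij, hm | hm⟩
  · refine finrank_ker_braidRot_eq_of_pair hq0 hq hij two_pos hc (Nat.coprime_one_left c) ?_ hm hKm
    have choose_two : (2 + 2 * c).choose 2 = (c + 1) * (2 * c + 1) := by
      rw [Nat.choose_two_right, show 2 + 2 * c - 1 = 2 * c + 1 by omega]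
      exact Nat.div_eq_of_eq_mul_left two_pos (by ring)
    rw [choose_two, show Ico 1 2 = {1} from rfl, sum_singleton, Nat.gcd_one_left,
      Nat.choose_one_right]
    ring
  · exact finrank_ker_braidRot_eq_of_pair hq0 hq hij three_pos one_pos (by norm_num) (by decide)
      hm hKm
  · exact finrank_ker_braidRot_eq_of_pair hq0 hq hij four_pos one_pos (by norm_num) (by decide)
      hm hKm

theorem qNumber_zpow_eq_zero_iff (hq : ∀ N : ℕ, 0 < N → q ^ N ≠ 1) {c : ℕ} (hc : 0 < c)
    (e : ℤ) : qNumber c (q ^ e) = 0 ↔ e = 0 ∧ (c : k) = 0 := by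
  obtain rfl | he := eq_or_ne e 0
  · simp [qNumber]
  · simp only [he, false_and, iff_false]
    intro h
    have geom := geom_sum_mul (q ^ e) c
    rw [qNumber] at h
    rw [h, zero_mul, eq_comm, sub_eq_zero, ← zpow_natCast, ← zpow_mul,
      zpow_eq_one_iff_of_not_root hq] at geom
    exact mul_ne_zero he (Nat.cast_ne_zero.2 hc.ne') geom

theorem quadForm_single (a : Matrix (Fin n) (Fin n) ℤ) (i : Fin n) (c : ℕ) :
    quadForm a (Pi.single i c) = a i i * c * c := by
  simp [quadForm, Pi.single_apply]

theorem linForm_single (a : Matrix (Fin n) (Fin n) ℤ) (i : Fin n) (c : ℕ) :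
    linForm a (Pi.single i c) = a i i * c := by
  simp [linForm, Pi.single_apply]

theorem isExceptional_iff :
    IsExceptional k a m ↔ (∃ i : Fin n, ∃ c : ℕ, 2 ≤ c ∧ (a i i ≠ 0 ∨ (c : k) ≠ 0) ∧
      m = Pi.single i c) ∨ IsExceptionalPair m := Iff.rfl

theorem isExceptional_single_iff {c : ℕ} (hc : 2 ≤ c) :
    IsExceptional k a (Pi.single i c) ↔ (a i i ≠ 0 ∨ (c : k) ≠ 0) := by
  rw [isExceptional_iff, or_iff_left (not_isExceptionalPair_single i c)]
  refine ⟨?_, fun h => ⟨i, c, hc, h, rfl⟩⟩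
  rintro ⟨l, d, _, h, e⟩
  obtain rfl : i = l := by
    by_contra hne
    have := congrFun e i
    rw [Pi.single_eq_same, Pi.single_eq_of_ne hne] at this
    omega
  rwa [Pi.single_injective i e]

theorem isExceptional_iff_isExceptionalPair (hij : i ≠ j) (hi : m i ≠ 0) (hj : m j ≠ 0) :
    IsExceptional k a m ↔ IsExceptionalPair m := by
  rw [isExceptional_iff, or_iff_right]
  rintro ⟨l, c, -, -, h⟩
  exact pair_ne_single hij hi hj l c h

theorem injectiveAt_powerMatrix_single_iff (hq : ∀ N : ℕ, 0 < N → q ^ N ≠ 1) {c : ℕ}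
    (hc : 2 ≤ c) :
    InjectiveAt (powerMatrix q a) (Pi.single i c) ↔ IsExceptional k a (Pi.single i c) := by
  rw [isExceptional_single_iff hc, injectiveAt_single_iff]
  refine (not_congr (qNumber_zpow_eq_zero_iff hq (by omega) (a i i))).trans ?_
  rw [not_and_or]

theorem injectiveAt_powerMatrix_iff (h2 : (2 : k) ≠ 0) (h3 : (3 : k) ≠ 0) (hq0 : q ≠ 0)
    (hq : ∀ N : ℕ, 0 < N → q ^ N ≠ 1) (hm : 2 ≤ totalDegree m)
    (hlow : ∀ m', totalDegree m' + 1 = totalDegree m → InjectiveAt (powerMatrix q a) m') :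
    InjectiveAt (powerMatrix q a) m ↔ IsExceptional k a m ∨ quadForm a m ≠ linForm a m := by
  have deg_pos : 0 < ∑ l, m l := Nat.zero_lt_of_lt hm
  by_cases hKm : quadForm a m = linForm a m
  · rw [or_iff_left (not_not.2 hKm)]
    rcases exists_eq_single_or_pair deg_pos with ⟨i, hi⟩ | ⟨i, j, hij, hi, hj⟩
    · rw [hi]
      exact injectiveAt_powerMatrix_single_iff hq hm
    · rw [isExceptional_iff_isExceptionalPair hij hi hj]
      constructor
      · intro hinj
        by_contra hex
        exact (finrank_ker_braidRot_lt hq0 hq hij hi hj hex hKm).ne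
          (finrank_ker_eq_of_injectiveAt hlow deg_pos hinj)
      · intro hex
        obtain ⟨l, hl⟩ := exists_mul_pred_ne_zero h2 h3 hex
        refine injectiveAt_of_finrank_eq hlow deg_pos (fun w hw => ?_)
          (finrank_ker_braidRot_eq_of_isExceptionalPair hq0 hq hex hKm) l hl
        rw [monodromy_powerMatrix hq0 a hw, hKm, sub_self, zpow_zero]
  · refine iff_of_true (injectiveAt_of_monodromy_ne_one hlow deg_pos
      (fun w hw => monodromy_powerMatrix hq0 a hw) ?_) (Or.inr hKm)
    rwa [Ne, zpow_eq_one_iff_of_not_root hq, sub_eq_zero]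

theorem injectiveAt_of_totalDegree_eq_one (Q : Matrix (Fin n) (Fin n) k)
    (hm : totalDegree m = 1) : InjectiveAt Q m := by
  have deg_eq : ∑ l, m l = 1 := hm
  rcases exists_eq_single_or_pair (m := m) (by omega) with ⟨i, hi⟩ | ⟨i, j, hij, hi, hj⟩
  · rw [hi, deg_eq, injectiveAt_single_iff]
    simp [qNumber]
  · have := add_le_sum_of_ne hij m
    omega

theorem nicholsIsFree_powerMatrix_iff (h2 : (2 : k) ≠ 0) (h3 : (3 : k) ≠ 0) (hq0 : q ≠ 0)
    (hq : ∀ N : ℕ, 0 < N → q ^ N ≠ 1) {V : Type*} [AddCommGroup V] [Module k V]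
    (x : Module.Basis (Fin n) k V) (a : Matrix (Fin n) (Fin n) ℤ) :
    NicholsIsFree x (powerMatrix q a) ↔
      ¬ ∃ m : Fin n → ℕ, 2 ≤ totalDegree m ∧ ¬ IsExceptional k a m ∧
        quadForm a m = linForm a m := by
  rw [nicholsIsFree_iff_injectiveAt]
  constructor
  · rintro h ⟨m, hm, hex, hKm⟩
    have hinj := (injectiveAt_powerMatrix_iff h2 h3 hq0 hq hm fun m' hm' => h m' (by omega)).1
      (h m (by omega))
    exact hinj.elim hex (absurd hKm)
  · intro h m hm
    induction hd : totalDegree m using Nat.strong_induction_on generalizing m with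
    | _ d ih =>
      rcases Nat.lt_or_ge (totalDegree m) 2 with lt_two | two_le
      · exact injectiveAt_of_totalDegree_eq_one _ (by omega)
      · rw [injectiveAt_powerMatrix_iff h2 h3 hq0 hq two_le
          fun m' hm' => ih _ (by omega) m' (by omega) rfl]
        by_contra! hn
        exact h ⟨m, two_le, hn⟩

end Comparison

/-! ### The values of the polynomials `P_m` -/

section Values

open Finset

variable {n : ℕ} {k : Type*} [Field k] {q : k} {a : Matrix (Fin n) (Fin n) ℤ} {m : Fin n → ℕ}
  {i j : Fin n} {c d : ℕ}

theorem one_sub_zpow_eq_zero_iff (hq : ∀ N : ℕ, 0 < N → q ^ N ≠ 1) (e : ℤ) :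
    1 - q ^ e = 0 ↔ e = 0 := by
  rw [sub_eq_zero, eq_comm, zpow_eq_one_iff_of_not_root hq]

theorem one_add_zpow_ne_zero (h2 : (2 : k) ≠ 0) (hq : ∀ N : ℕ, 0 < N → q ^ N ≠ 1) (e : ℤ) :
    1 + q ^ e ≠ 0 := by
  have qNumber_two : qNumber 2 (q ^ e) = 1 + q ^ e := by simp [qNumber, sum_range_succ]
  rw [← qNumber_two, Ne, qNumber_zpow_eq_zero_iff hq two_pos]
  exact fun h => h2 (by exact_mod_cast h.2)

theorem qNumber_three_zpow_ne_zero (h3 : (3 : k) ≠ 0) (hq : ∀ N : ℕ, 0 < N → q ^ N ≠ 1) (e : ℤ) :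
    qNumber 3 (q ^ e) ≠ 0 := by
  rw [Ne, qNumber_zpow_eq_zero_iff hq three_pos]
  exact fun h => h3 (by exact_mod_cast h.2)

theorem zpow_sum₀ {ι : Type*} (hq0 : q ≠ 0) (s : Finset ι) (f : ι → ℤ) :
    q ^ ∑ i ∈ s, f i = ∏ i ∈ s, q ^ f i := by
  classical
  induction s using Finset.induction_on with
  | empty => simp
  | insert i s hi ih => rw [sum_insert hi, prod_insert hi, zpow_add₀ hq0, ih]

theorem map_qNumber {R S : Type*} [CommRing R] [CommRing S] (f : R →+* S) (c : ℕ) (t : R) :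
    f (qNumber c t) = qNumber c (f t) := by
  simp [qNumber]

theorem aeval_qNumber (Q : Matrix (Fin n) (Fin n) k) (c : ℕ)
    (t : MvPolynomial (Fin n × Fin n) ℤ) :
    MvPolynomial.aeval (fun ij : Fin n × Fin n => Q ij.1 ij.2) (qNumber c t) =
      qNumber c (MvPolynomial.aeval (fun ij : Fin n × Fin n => Q ij.1 ij.2) t) :=
  map_qNumber (MvPolynomial.aeval (R := ℤ) (fun ij : Fin n × Fin n => Q ij.1 ij.2)).toRingHom c t

theorem powerMatrix_monomial (hq0 : q ≠ 0) (a : Matrix (Fin n) (Fin n) ℤ) (i j : Fin n)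
    (r s t : ℕ) :
    powerMatrix q a i i ^ r * (powerMatrix q a i j * powerMatrix q a j i) ^ s *
      powerMatrix q a j j ^ t = q ^ (a i i * r + (a i j + a j i) * s + a j j * t) := by
  simp only [powerMatrix, Matrix.of_apply, zpow_add₀ hq0, zpow_mul, zpow_natCast]

theorem evalP_single (a : Matrix (Fin n) (Fin n) ℤ) (i : Fin n) (hc : 0 < c) :
    evalP (powerMatrix q a) (Pi.single i c) = qNumber c (q ^ a i i) := by
  rw [evalP, P_single i hc, aeval_qNumber]
  simp [p, powerMatrix]

theorem IsPair.evalP_one (h : IsPair m (i, j) 1 d) (hq0 : q ≠ 0) :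
    evalP (powerMatrix q a) m = 1 - q ^ (a j j * (d - 1) + (a i j + a j i)) := by
  have monomial := powerMatrix_monomial hq0 a i j 0 1 (d - 1)
  rw [Nat.cast_sub h.2.2.1, Nat.cast_zero, Nat.cast_one, mul_zero, zero_add, mul_one,
    add_comm] at monomial
  rw [← monomial, evalP, P_one h]
  simp only [p, map_sub, map_mul, map_pow, map_one, MvPolynomial.aeval_X]
  ring

theorem IsPair.evalP_two_even (h : IsPair m (i, j) 2 (2 * c)) (hq0 : q ≠ 0) :
    ∃ e : ℤ, evalP (powerMatrix q a) m = 1 + q ^ e := by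
  refine ⟨_, Eq.trans ?_ (congrArg (1 + ·)
    (powerMatrix_monomial hq0 a i j 1 (2 * c) (2 * c * (2 * c - 1) / 2)))⟩
  rw [evalP, P_two h]
  simp only [p, map_add, map_mul, map_pow, map_one, MvPolynomial.aeval_X,
    (even_two_mul c).neg_pow]
  ring

theorem IsPair.evalP_two_odd (h : IsPair m (i, j) 2 (2 * c + 1)) (hq0 : q ≠ 0) :
    evalP (powerMatrix q a) m =
      1 - q ^ (a i i + (a i j + a j i) * (2 * c + 1) + a j j * ((2 * c + 1) * c)) := by
  have half : (2 * c + 1) * (2 * c + 1 - 1) / 2 = (2 * c + 1) * c := by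
    refine Nat.div_eq_of_eq_mul_left two_pos ?_
    rw [Nat.add_sub_cancel]
    ring
  have monomial := powerMatrix_monomial hq0 a i j 1 (2 * c + 1) ((2 * c + 1) * c)
  push_cast at monomial
  rw [mul_one] at monomial
  rw [← monomial, evalP, P_two h, half]
  simp only [p, map_add, map_mul, map_pow, map_neg, map_one, MvPolynomial.aeval_X,
    (odd_two_mul_add_one c).neg_pow]
  ring

theorem IsPair.evalP_three_three (h : IsPair m (i, j) 3 3) (hq0 : q ≠ 0) :
    ∃ e : ℤ, evalP (powerMatrix q a) m = qNumber 3 (q ^ e) := by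
  rw [evalP, P_three_three h, aeval_qNumber]
  simp only [p, map_mul, map_pow, MvPolynomial.aeval_X, powerMatrix_monomial hq0]
  exact ⟨_, rfl⟩

theorem IsPair.evalP_three_four (h : IsPair m (i, j) 3 4) (hq0 : q ≠ 0) :
    ∃ e : ℤ, evalP (powerMatrix q a) m =
      (1 - q ^ (a i i * 2 + (a i j + a j i) * 4 + a j j * 4)) * qNumber 3 (q ^ e) := by
  have monomial := powerMatrix_monomial hq0 a i j 2 4 4
  have root_monomial := powerMatrix_monomial hq0 a i j 1 2 2
  rw [pow_one] at root_monomial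
  rw [evalP, P_three_four h, map_mul, aeval_qNumber]
  simp only [p, map_sub, map_one, map_mul, map_pow, MvPolynomial.aeval_X]
  rw [monomial, root_monomial]
  exact ⟨_, rfl⟩

theorem IsPair.evalP_three_six (h : IsPair m (i, j) 3 6) (hq0 : q ≠ 0) :
    ∃ e : ℤ, evalP (powerMatrix q a) m =
      (1 - q ^ (a i i + (a i j + a j i) * 3 + a j j * 5)) * qNumber 3 (q ^ e) := by
  have monomial := powerMatrix_monomial hq0 a i j 1 3 5
  rw [pow_one, Nat.cast_one, mul_one] at monomial
  rw [evalP, P_three_six h, map_mul, aeval_qNumber]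
  simp only [p, map_sub, map_one, map_mul, map_pow, MvPolynomial.aeval_X]
  rw [monomial, powerMatrix_monomial hq0]
  exact ⟨_, rfl⟩

theorem IsPair.evalP_four_four (h : IsPair m (i, j) 4 4) (hq0 : q ≠ 0) :
    ∃ e e' : ℤ, evalP (powerMatrix q a) m = (1 + q ^ e) * (1 + q ^ e') := by
  rw [evalP, P_four_four h, map_mul]
  simp only [p, map_add, map_one, map_mul, map_pow, MvPolynomial.aeval_X,
    powerMatrix_monomial hq0]
  exact ⟨_, _, rfl⟩

theorem quadForm_sub_linForm (a : Matrix (Fin n) (Fin n) ℤ) (m : Fin n → ℕ) :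
    quadForm a m - linForm a m = ∑ i, a i i * (m i * (m i - 1)) +
      ∑ i, ∑ j ∈ Ioi i, (a i j + a j i) * (m i * m j) := by
  have symmetrize : ∑ i, ∑ j ∈ Ioi i, (a i j + a j i) * ((m i : ℤ) * m j) =
      ∑ i, ∑ j ∈ Ioi i, (a i j * m i * m j + a j i * m j * m i) :=
    sum_congr rfl fun i _ => sum_congr rfl fun j _ => by ring
  have split_diagonal : ∀ i, ∑ j, a i j * (m i : ℤ) * m j =
      a i i * m i * m i + ∑ j ∈ {i}ᶜ, a i j * (m i : ℤ) * m j := fun i => by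
    rw [← sum_add_sum_compl {i}, sum_singleton]
  rw [symmetrize, sum_sum_Ioi_add_eq_sum_sum_off_diag (fun i j => a j i * (m j : ℤ) * m i),
    quadForm, linForm, sum_congr rfl fun i _ => split_diagonal i, sum_add_distrib,
    add_sub_right_comm, ← sum_sub_distrib, sum_congr rfl fun i _ => (by ring :
      a i i * (m i : ℤ) * m i - a i i * m i = a i i * (m i * (m i - 1)))]

theorem IsPair.quadForm_eq_linForm_iff (h : IsPair m (i, j) c d) :
    quadForm a m = linForm a m ↔
      a i i * (c * (c - 1)) + a j j * (d * (d - 1)) + (a i j + a j i) * (c * d) = 0 := by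
  have diff : quadForm a m - linForm a m =
      a i i * (c * (c - 1)) + a j j * (d * (d - 1)) + (a i j + a j i) * (c * d) := by
    rw [h.2.2.2]
    simp only [quadForm, linForm, Pi.add_apply, Pi.single_apply, Nat.cast_add, Nat.cast_ite,
      Nat.cast_zero, mul_add, add_mul, mul_ite, ite_mul, mul_zero, zero_mul, sum_add_distrib,
      sum_ite_eq', mem_univ, if_true]
    ring
  rw [← sub_eq_zero, diff]

theorem IsPair.isExceptional_iff (h : IsPair m (i, j) c d) :
    IsExceptional k a m ↔ (c = 2 ∧ Even d) ∨ (d = 2 ∧ Even c) ∨ (c = 3 ∧ d = 3) ∨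
      (c = 4 ∧ d = 4) := by
  have hmi : m i = c := h.symm.snd
  have hmj : m j = d := h.snd
  obtain ⟨hij, hc, hd, hm⟩ := id h
  rw [isExceptional_iff_isExceptionalPair hij (hmi ▸ hc.ne') (hmj ▸ hd.ne')]
  constructor
  · rintro (⟨i', j', hij', e, he, hm'⟩ | ⟨i', j', hij', hm' | hm'⟩)
    · have h' : IsPair m (i', j') 2 (2 * e) := ⟨hij', two_pos, by omega, hm'⟩
      rcases h.unique h' with ⟨-, rfl, rfl⟩ | ⟨-, rfl, rfl⟩
      · exact Or.inl ⟨rfl, even_two_mul e⟩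
      · exact Or.inr (Or.inl ⟨rfl, even_two_mul e⟩)
    · have := h.unique (⟨hij', three_pos, three_pos, hm'⟩ : IsPair m (i', j') 3 3)
      omega
    · have := h.unique (⟨hij', four_pos, four_pos, hm'⟩ : IsPair m (i', j') 4 4)
      omega
  · rintro (⟨rfl, e, rfl⟩ | ⟨rfl, e, rfl⟩ | ⟨rfl, rfl⟩ | ⟨rfl, rfl⟩)
    · exact Or.inl ⟨i, j, hij, e, by omega, by rw [hm, two_mul]⟩
    · exact Or.inl ⟨j, i, hij.symm, e, by omega, by rw [h.symm.2.2.2, two_mul]⟩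
    · exact Or.inr ⟨i, j, hij, Or.inl hm⟩
    · exact Or.inr ⟨i, j, hij, Or.inr hm⟩

theorem evalP_single_eq_zero_iff (hq : ∀ N : ℕ, 0 < N → q ^ N ≠ 1) (hc : 2 ≤ c) :
    evalP (powerMatrix q a) (Pi.single i c) = 0 ↔ ¬ IsExceptional k a (Pi.single i c) ∧
      quadForm a (Pi.single i c) = linForm a (Pi.single i c) := by
  rw [evalP_single a i (by omega), isExceptional_single_iff hc, quadForm_single, linForm_single,
    qNumber_zpow_eq_zero_iff hq (by omega), not_or, not_not, not_not]
  refine ⟨fun h => ⟨h, ?_⟩, And.left⟩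
  rw [h.1, zero_mul, zero_mul]

theorem IsPair.evalP_one_eq_zero_iff (h : IsPair m (i, j) 1 d) (hq0 : q ≠ 0)
    (hq : ∀ N : ℕ, 0 < N → q ^ N ≠ 1) :
    evalP (powerMatrix q a) m = 0 ↔ ¬ IsExceptional k a m ∧ quadForm a m = linForm a m := by
  have hex : ¬ IsExceptional k a m := by
    rw [h.isExceptional_iff]
    simp
  have hd : (d : ℤ) ≠ 0 := by exact_mod_cast h.2.2.1.ne'
  rw [and_iff_right hex, h.evalP_one hq0, one_sub_zpow_eq_zero_iff hq,
    h.quadForm_eq_linForm_iff, ← mul_eq_zero_iff_left hd]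
  push_cast
  ring_nf

theorem IsPair.evalP_two_eq_zero_iff (h : IsPair m (i, j) 2 d) (h2 : (2 : k) ≠ 0) (hq0 : q ≠ 0)
    (hq : ∀ N : ℕ, 0 < N → q ^ N ≠ 1) :
    evalP (powerMatrix q a) m = 0 ↔ ¬ IsExceptional k a m ∧ quadForm a m = linForm a m := by
  rcases Nat.even_or_odd' d with ⟨c, rfl | rfl⟩
  · obtain ⟨e, he⟩ := h.evalP_two_even (a := a) hq0
    refine iff_of_false (he ▸ one_add_zpow_ne_zero h2 hq e) fun hn => hn.1 ?_
    exact h.isExceptional_iff.2 (Or.inl ⟨rfl, even_two_mul c⟩)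
  · have hex : ¬ IsExceptional k a m := by
      rw [h.isExceptional_iff]
      rintro (⟨-, h_even⟩ | h' | h' | h')
      · exact Nat.not_even_two_mul_add_one c h_even
      all_goals omega
    rw [and_iff_right hex, h.evalP_two_odd hq0, one_sub_zpow_eq_zero_iff hq,
      h.quadForm_eq_linForm_iff, ← mul_eq_zero_iff_left (two_ne_zero (α := ℤ))]
    push_cast
    ring_nf

theorem IsPair.evalP_three_three_ne_zero (h : IsPair m (i, j) 3 3) (h3 : (3 : k) ≠ 0)
    (hq0 : q ≠ 0) (hq : ∀ N : ℕ, 0 < N → q ^ N ≠ 1) : evalP (powerMatrix q a) m ≠ 0 := by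
  obtain ⟨e, he⟩ := h.evalP_three_three (a := a) hq0
  exact he ▸ qNumber_three_zpow_ne_zero h3 hq e

theorem IsPair.evalP_four_four_ne_zero (h : IsPair m (i, j) 4 4) (h2 : (2 : k) ≠ 0)
    (hq0 : q ≠ 0) (hq : ∀ N : ℕ, 0 < N → q ^ N ≠ 1) : evalP (powerMatrix q a) m ≠ 0 := by
  obtain ⟨e, e', he⟩ := h.evalP_four_four (a := a) hq0
  exact he ▸ mul_ne_zero (one_add_zpow_ne_zero h2 hq e) (one_add_zpow_ne_zero h2 hq e')

theorem IsPair.evalP_three_four_eq_zero_iff (h : IsPair m (i, j) 3 4) (h3 : (3 : k) ≠ 0)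
    (hq0 : q ≠ 0) (hq : ∀ N : ℕ, 0 < N → q ^ N ≠ 1) :
    evalP (powerMatrix q a) m = 0 ↔ quadForm a m = linForm a m := by
  obtain ⟨e, he⟩ := h.evalP_three_four (a := a) hq0
  rw [he, mul_eq_zero, or_iff_left (qNumber_three_zpow_ne_zero h3 hq e),
    one_sub_zpow_eq_zero_iff hq, h.quadForm_eq_linForm_iff]
  push_cast
  constructor <;> intro h' <;> linarith

theorem IsPair.evalP_three_six_eq_zero_iff (h : IsPair m (i, j) 3 6) (h3 : (3 : k) ≠ 0)
    (hq0 : q ≠ 0) (hq : ∀ N : ℕ, 0 < N → q ^ N ≠ 1) :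
    evalP (powerMatrix q a) m = 0 ↔ quadForm a m = linForm a m := by
  obtain ⟨e, he⟩ := h.evalP_three_six (a := a) hq0
  rw [he, mul_eq_zero, or_iff_left (qNumber_three_zpow_ne_zero h3 hq e),
    one_sub_zpow_eq_zero_iff hq, h.quadForm_eq_linForm_iff]
  push_cast
  constructor <;> intro h' <;> linarith

/-- The pairs `(c, d)` such that the definition of `P_m` has a clause of its own for
`m = c e_i + d e_j`. -/
def IsSpecial (c d : ℕ) : Prop :=
  c = 1 ∨ c = 2 ∨ (c = 3 ∧ (d = 3 ∨ d = 4 ∨ d = 6)) ∨ (c = 4 ∧ d = 4)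

theorem IsPair.evalP_eq_zero_iff_of_isSpecial (h : IsPair m (i, j) c d) (hs : IsSpecial c d)
    (h2 : (2 : k) ≠ 0) (h3 : (3 : k) ≠ 0) (hq0 : q ≠ 0) (hq : ∀ N : ℕ, 0 < N → q ^ N ≠ 1) :
    evalP (powerMatrix q a) m = 0 ↔ ¬ IsExceptional k a m ∧ quadForm a m = linForm a m := by
  rcases hs with rfl | rfl | ⟨rfl, rfl | rfl | rfl⟩ | ⟨rfl, rfl⟩
  · exact h.evalP_one_eq_zero_iff hq0 hq
  · exact h.evalP_two_eq_zero_iff h2 hq0 hq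
  · exact iff_of_false (h.evalP_three_three_ne_zero h3 hq0 hq) fun hn =>
      hn.1 (h.isExceptional_iff.2 (by decide))
  · rw [and_iff_right (by rw [h.isExceptional_iff]; decide)]
    exact h.evalP_three_four_eq_zero_iff h3 hq0 hq
  · rw [and_iff_right (by rw [h.isExceptional_iff]; decide)]
    exact h.evalP_three_six_eq_zero_iff h3 hq0 hq
  · exact iff_of_false (h.evalP_four_four_ne_zero h2 hq0 hq) fun hn =>
      hn.1 (h.isExceptional_iff.2 (by decide))

theorem natCast_mul_pred (c : ℕ) : ((c * (c - 1) : ℕ) : ℤ) = c * (c - 1) := by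
  cases c <;> simp

theorem evalP_of_not_isSpecial (hq0 : q ≠ 0) (hm : ¬ ∃ i, m = Pi.single i (m i))
    (hs : ∀ ij c d, IsPair m ij c d → ¬ IsSpecial c d) :
    evalP (powerMatrix q a) m = 1 - q ^ (quadForm a m - linForm a m) := by
  have not_pair : ∀ c d : (Fin n × Fin n) → ℕ, (∀ ij, IsSpecial (c ij) (d ij)) →
      ¬ ∃ ij, IsPair m ij (c ij) (d ij) := fun c d hcd ⟨ij, hp⟩ => hs ij _ _ hp (hcd ij)
  rw [evalP, P, dif_neg hm]
  iterate 6 rw [dif_neg (not_pair _ _ fun _ => by simp [IsSpecial])]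
  rw [quadForm_sub_linForm, zpow_add₀ hq0, zpow_sum₀ hq0, zpow_sum₀ hq0]
  simp only [p, map_sub, map_one, map_mul, map_prod, map_pow, MvPolynomial.aeval_X]
  congr 2
  · refine prod_congr rfl fun i _ => ?_
    rw [powerMatrix, Matrix.of_apply, ← natCast_mul_pred, zpow_mul, zpow_natCast]
  · refine prod_congr rfl fun i _ => ?_
    rw [zpow_sum₀ hq0]
    refine prod_congr rfl fun j _ => ?_
    rw [powerMatrix, Matrix.of_apply, Matrix.of_apply, ← zpow_add₀ hq0, ← Nat.cast_mul,
      zpow_mul, zpow_natCast]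

theorem not_isExceptional_of_not_isSpecial (hm : ¬ ∃ i, m = Pi.single i (m i))
    (hs : ∀ ij c d, IsPair m ij c d → ¬ IsSpecial c d) : ¬ IsExceptional k a m := by
  rintro (⟨i, c, -, -, rfl⟩ | ⟨i, j, hij, c, hc, hp⟩ | ⟨i, j, hij, hp | hp⟩)
  · exact hm ⟨i, by simp⟩
  · exact hs (i, j) 2 (2 * c) ⟨hij, two_pos, by omega, hp⟩ (by simp [IsSpecial])
  · exact hs (i, j) 3 3 ⟨hij, three_pos, three_pos, hp⟩ (by simp [IsSpecial])
  · exact hs (i, j) 4 4 ⟨hij, four_pos, four_pos, hp⟩ (by simp [IsSpecial])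

theorem evalP_powerMatrix_eq_zero_iff (h2 : (2 : k) ≠ 0) (h3 : (3 : k) ≠ 0) (hq0 : q ≠ 0)
    (hq : ∀ N : ℕ, 0 < N → q ^ N ≠ 1) (hm : 2 ≤ totalDegree m) :
    evalP (powerMatrix q a) m = 0 ↔ ¬ IsExceptional k a m ∧ quadForm a m = linForm a m := by
  by_cases single : ∃ i, m = Pi.single i (m i)
  · obtain ⟨i, hi⟩ := single
    have degree_eq : totalDegree m = m i := by
      rw [hi]
      simp [totalDegree]
    rw [hi]
    exact evalP_single_eq_zero_iff hq (degree_eq ▸ hm)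
  by_cases special : ∃ ij c d, IsPair m ij c d ∧ IsSpecial c d
  · obtain ⟨ij, c, d, h, hs⟩ := special
    exact h.evalP_eq_zero_iff_of_isSpecial hs h2 h3 hq0 hq
  · have hs : ∀ ij c d, IsPair m ij c d → ¬ IsSpecial c d := fun ij c d h hs =>
      special ⟨ij, c, d, h, hs⟩
    rw [evalP_of_not_isSpecial hq0 single hs, one_sub_zpow_eq_zero_iff hq, sub_eq_zero,
      and_iff_right (not_isExceptional_of_not_isSpecial single hs)]

end Values

/-! ### Rank two -/

section RankTwo

theorem mul_le_mul_sub_one_add_mul_sub_one {x y : ℤ} (hx : 2 ≤ x) (hy : 0 ≤ y) :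
    x * y ≤ x * (x - 1) + y * (y - 1) := by
  suffices 0 < (x - 1) * (y - 1) + (x - y) ^ 2 by linarith
  rcases hy.eq_or_lt with rfl | hy
  · nlinarith
  have prod_nonneg : 0 ≤ (x - 1) * (y - 1) := mul_nonneg (by omega) (by omega)
  rcases eq_or_ne x y with rfl | hne
  · nlinarith
  · exact add_pos_of_nonneg_of_pos prod_nonneg (sq_pos_of_ne_zero (sub_ne_zero.2 hne))

theorem mul_lt_of_two_le {a b x y : ℤ} (hb : 0 < b) (hab : b < a) (hx : 2 ≤ x) (hy : 0 ≤ y) :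
    b * (x * y) < a * (x * (x - 1)) + a * (y * (y - 1)) := by
  have pos : 0 < x * (x - 1) + y * (y - 1) := by
    rcases hy.eq_or_lt with rfl | hy
    · nlinarith
    · exact add_pos_of_pos_of_nonneg (mul_pos (by omega) (by omega))
        (mul_nonneg hy.le (by omega))
  calc b * (x * y) ≤ b * (x * (x - 1) + y * (y - 1)) :=
        mul_le_mul_of_nonneg_left (mul_le_mul_sub_one_add_mul_sub_one hx hy) hb.le
    _ < a * (x * (x - 1) + y * (y - 1)) := mul_lt_mul_of_pos_right hab pos
    _ = a * (x * (x - 1)) + a * (y * (y - 1)) := mul_add _ _ _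

theorem rankTwo_form_ne_zero {a b x y : ℤ} (hb : 0 < b) (hab : b < a) (hx : 0 ≤ x) (hy : 0 ≤ y)
    (hxy : 2 ≤ x + y) : a * (x * (x - 1)) + a * (y * (y - 1)) - b * (x * y) ≠ 0 := by
  rcases le_or_gt 2 x with two_le_x | x_lt
  · exact (sub_pos.2 (mul_lt_of_two_le hb hab two_le_x hy)).ne'
  rcases le_or_gt 2 y with two_le_y | y_lt
  · have := mul_lt_of_two_le hb hab two_le_y hx
    rw [mul_comm y x, add_comm] at this
    exact (sub_pos.2 this).ne'
  obtain ⟨rfl, rfl⟩ : x = 1 ∧ y = 1 := by omega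
  omega

theorem nicholsIsFree_rankTwo {k : Type*} [Field k] {q : k} (h2 : (2 : k) ≠ 0) (h3 : (3 : k) ≠ 0)
    (hq0 : q ≠ 0) (hq : ∀ N : ℕ, 0 < N → q ^ N ≠ 1) {V : Type*} [AddCommGroup V] [Module k V]
    (x : Module.Basis (Fin 2) k V) (Q : Matrix (Fin 2) (Fin 2) k) {a b c d : ℤ} (hb : 0 < b)
    (hab : b < a) (h00 : Q 0 0 = q ^ a) (h11 : Q 1 1 = q ^ a) (h01 : Q 0 1 = q ^ c)
    (h10 : Q 1 0 = q ^ d) (hprod : Q 0 1 * Q 1 0 = q ^ (-b)) : NicholsIsFree x Q := by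
  have Q_eq : Q = powerMatrix q !![a, c; d, a] := by
    ext i j
    fin_cases i <;> fin_cases j <;> simp [powerMatrix, h00, h11, h01, h10]
  have c_add_d : c + d = -b := by
    rw [h01, h10, ← zpow_add₀ hq0, ← mul_inv_eq_one₀ (zpow_ne_zero _ hq0), ← zpow_neg,
      ← zpow_add₀ hq0, zpow_eq_one_iff_of_not_root hq] at hprod
    omega
  rw [Q_eq, nicholsIsFree_powerMatrix_iff h2 h3 hq0 hq]
  rintro ⟨m, hm, -, hK⟩
  rw [totalDegree, Fin.sum_univ_two] at hm
  refine rankTwo_form_ne_zero hb hab (Int.natCast_nonneg (m 0)) (Int.natCast_nonneg (m 1))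
    (by exact_mod_cast hm) ?_
  simp only [quadForm, linForm, Fin.sum_univ_two, Matrix.of_apply, Matrix.cons_val',
    Matrix.cons_val_zero, Matrix.cons_val_one, Matrix.cons_val_fin_one] at hK
  linear_combination hK - (m 0 : ℤ) * m 1 * c_add_d

end RankTwo

end DiagonalNichols

open DiagonalNichols in
theorem mainTheorem3 {k : Type*} [Field k] (hchar2 : ringChar k ≠ 2) (hchar3 : ringChar k ≠ 3)
    (q : k) (hq0 : q ≠ 0) (hq : ∀ N : ℕ, 0 < N → q ^ N ≠ 1)
    {V : Type*} [AddCommGroup V] [Module k V] :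
    (∀ (n : ℕ) (x : Module.Basis (Fin n) k V) (a : Matrix (Fin n) (Fin n) ℤ),
      (∀ m : Fin n → ℕ, 2 ≤ totalDegree m → IsExceptional k a m →
        evalP (powerMatrix q a) m ≠ 0) ∧
      (∀ m : Fin n → ℕ, 2 ≤ totalDegree m → ¬ IsExceptional k a m →
        (evalP (powerMatrix q a) m = 0 ↔ quadForm a m = linForm a m)) ∧
      (NicholsIsFree x (powerMatrix q a) ↔
        ¬ ∃ m : Fin n → ℕ, 2 ≤ totalDegree m ∧ ¬ IsExceptional k a m ∧
          quadForm a m = linForm a m)) ∧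
    (∀ (x : Module.Basis (Fin 2) k V) (Q : Matrix (Fin 2) (Fin 2) k) (a b : ℤ),
      0 < b → b < a →
      Q 0 0 = q ^ a → Q 1 1 = q ^ a →
      (∃ c : ℤ, Q 0 1 = q ^ c) → (∃ d : ℤ, Q 1 0 = q ^ d) →
      Q 0 1 * Q 1 0 = q ^ (-b) →
      NicholsIsFree x Q) := by
  have h2 : (2 : k) ≠ 0 := CharP.cast_ne_zero_of_ne_of_prime k Nat.prime_two hchar2
  have h3 : (3 : k) ≠ 0 := CharP.cast_ne_zero_of_ne_of_prime k Nat.prime_three hchar3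
  have evalP_iff {n : ℕ} {a : Matrix (Fin n) (Fin n) ℤ} {m : Fin n → ℕ}
      (hm : 2 ≤ totalDegree m) := evalP_powerMatrix_eq_zero_iff (a := a) h2 h3 hq0 hq hm
  refine ⟨fun n x a => ⟨fun m hm hex h0 => ((evalP_iff hm).1 h0).1 hex,
    fun m hm hex => (evalP_iff hm).trans (and_iff_right hex),
    nicholsIsFree_powerMatrix_iff h2 h3 hq0 hq x a⟩, ?_⟩
  rintro x Q a b hb hab h00 h11 ⟨c, h01⟩ ⟨d, h10⟩ hprod
  exact nicholsIsFree_rankTwo h2 h3 hq0 hq x Q hb hab h00 h11 h01 h10 hprod
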